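/- **Setting.** Fix $d\ge 0$, $N_1\ge 1$, $M\ge 1$, a data set $(x^{(m)},y^{(m)})_{m=1}^M\subset\mathbb R^d\times\mathbb R$, and put $\pi=\frac1M\sum_{m=1}^M\delta_{(x^{(m)},y^{(m)})}$. Let $\sigma:\mathbb R\to\mathbb R$ be bounded and infinitely differentiable. For $N_2\ge 1$ and parameters $\theta=((C^i)_{i\le N_2},(W^{2,j,i})_{j\le N_1,i\le N_2},(W^{1,j})_{j\le N_1})$ with $C^i,W^{2,j,i}\in\mathbb R$, $W^{1,j}\in\mathbb R^d$, consider the network $$g_\theta^{N_1,N_2}(x)=\frac1{N_2^{\gamma_2}}\sum_{i=1}^{N_2}C^i\sigma\big(Z^{2,i}(x)\big),\qquad Z^{2,i}(x)=\frac1{N_1^{\gamma_1}}\sum_{j=1}^{N_1}W^{2,j,i}\sigma(W^{1,j}\cdot x).$$ The initial parameters $C_0^i$, $W_0^{2,j,i}$ ($i\in\mathbb N$, $j\le N_1$) and $W_0^{1,j}$ ($j\le N_1$) are mutually independent random variables on one probability space, with laws $\mu_C$, $\mu_{W^2}$, $\mu_{W^1}$ respectively; these laws have mean zero and are carried by compact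 sets. The network with $N_2$ units starts from those with $i\le N_2$. The data points $(x_k,y_k)_{k\ge0}$ are i.i.d. with law $\pi$ and independent of the initial parameters. The parameters $\theta_k$ are trained by stochastic gradient descent: with $g_k=g^{N_1,N_2}_{\theta_k}$ and $Z_k^{2,i}$ formed with $\theta_k$, $$\begin{aligned} C^i_{k+1}&=C^i_k+\frac{\alpha_C^{N_1,N_2}}{N_2^{\gamma_2}}(y_k-g_k(x_k))\,\sigma(Z^{2,i}_k(x_k)),\\ W^{1,j}_{k+1}&=W^{1,j}_k+\frac{\alpha_{W,1}^{N_1,N_2}}{N_1^{\gamma_1}}(y_k-g_k(x_k))\Big(\frac1{N_2^{\gamma_2}}\sum_{i=1}^{N_2}C^i_k\sigma'(Z^{2,i}_k(x_k))W^{2,j,i}_k\Big)\sigma'(W^{1,j}_k\cdot x_k)\,x_k,\\ W^{2,j,i}_{k+1}&=W^{2,j,i}_k+\frac{\alpha_{W,2}^{N_1,N_2}}{N_1^{\gamma_1}N_2^{\gamma_2}}(y_k-g_k(x_k))\,C^i_k\sigma'(Z^{2,i}_k(x_k))\sigma(W^{1,j}_k\cdot x_k), \end{aligned}$$ with learning rates,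 for constants $\alpha_C,\alpha_{W,1},\alpha_{W,2}\in(0,\infty)$, $$\alpha_C^{N_1,N_2}=\frac{\alpha_C}{N_2^{2-2\gamma_2}},\qquad \alpha_{W,1}^{N_1,N_2}=\frac{\alpha_{W,1}}{N_1^{1-2\gamma_1}N_2^{3-2\gamma_2}},\qquad \alpha_{W,2}^{N_1,N_2}=\frac{\alpha_{W,2}}{N_1^{1-2\gamma_1}N_2^{2-2\gamma_2}}.$$ Let $$\gamma^{N_1,N_2}_t=\frac1{N_2}\sum_{i=1}^{N_2}\delta_{(C^i_k,\,W^{2,1,i}_k,\dots,W^{2,N_1,i}_k,\,W^{1,1}_k,\dots,W^{1,N_1}_k)}\Big|_{k=\lfloor N_2t\rfloor},\qquad h_t^{N_1,N_2}=\big(g^{N_1,N_2}_{\theta_{\lfloor N_2t\rfloor}}(x^{(m)})\big)_{m=1}^M .$$ Let $E=\mathcal M(\mathbb R^{1+N_1(1+d)})\times\mathbb R^M$, where $\mathcal M$ is the space of probability measures with the topology of weak convergence (metrized by the Lévy–Prokhorov metric), and let $D_E([0,T])$ be the Skorokhod space of càdlàg paths $[0,T]\to E$ with the $J_1$ metric.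 Define the (random, through $W^{1,j}_0$) measure $$\gamma_0^{N_1}=\mu_C(dc)\otimes\bigotimes_{j=1}^{N_1}\mu_{W^2}(dw^{2,j})\otimes\bigotimes_{j=1}^{N_1}\delta_{W^{1,j}_0}(dw^{1,j}).$$ With $\theta=(c,w^2,w^1)$ and $Z(x)=N_1^{-\gamma_1}\sum_jw^{2,j}\sigma(w^{1,j}\cdot x)$, set $B^1_{x,x'}=\sigma(Z(x'))\sigma(Z(x))$, $B^{2,j}_{x,x'}=c^2\sigma'(Z(x'))\sigma'(Z(x))\sigma(w^{1,j}\cdot x')\sigma(w^{1,j}\cdot x)$, $B^{3,j}_x=c\,w^{2,j}\sigma'(w^{1,j}\cdot x)\sigma'(Z(x))$, and, with $\langle f,\gamma\rangle=\int f\,d\gamma$, $$A^{N_1}_{x,x'}=\alpha_C\langle B^1_{x,x'},\gamma_0^{N_1}\rangle+\frac1{N_1}\sum_{j=1}^{N_1}\Big[\alpha_{W,2}\langle B^{2,j}_{x,x'},\gamma_0^{N_1}\rangle+\alpha_{W,1}\,(x\cdot x')\,\langle B^{3,j}_x,\gamma_0^{N_1}\rangle\langle B^{3,j}_{x'},\gamma_0^{N_1}\rangle\Big].$$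 **Theorem.** Let $0\le T<\infty$ and $\gamma_1,\gamma_2\in(1/2,1)$. As $N_2\to\infty$, the process $(\gamma^{N_1,N_2}_t,h^{N_1,N_2}_t)_{t\in[0,T]}$ converges in probability in $D_E([0,T])$ to a process $(\gamma^{N_1}_t,h^{N_1}_t)_{t\in[0,T]}$ such that $\gamma^{N_1}_t=\gamma^{N_1}_0$ for all $t\in[0,T]$, and, for all $t\in[0,T]$ and every $x\in\{x^{(1)},\dots,x^{(M)}\}$, $$h^{N_1}_t(x)=h^{N_1}_0(x)+\int_0^t\int\big(y-h_s^{N_1}(x')\big)A^{N_1}_{x,x'}\,\pi(dx',dy)\,ds,\qquad h^{N_1}_0(x)=0 .$$ -/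

import Mathlib

open MeasureTheory ProbabilityTheory Filter Set
open scoped ENNReal Topology

/-! ### The Skorokhod space of càdlàg paths -/

/-- The set `D_E([0,T])` of càdlàg paths `[0,T] → E`: right-continuous with left limits. -/
structure SkorokhodSpace (T : ℝ) (E : Type*) [TopologicalSpace E] where
  /-- The underlying path. -/
  toFun : Set.Icc (0 : ℝ) T → E
  right_continuous : ∀ t, ContinuousWithinAt toFun (Set.Ici t) t
  left_limits : ∀ t, ∃ l, Tendsto toFun (𝓝[<] t) (𝓝 l)

namespace SkorokhodSpace

instance {T : ℝ} {E : Type*} [TopologicalSpace E] :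
    CoeFun (SkorokhodSpace T E) (fun _ => Set.Icc (0 : ℝ) T → E) := ⟨toFun⟩

/-- The cost of matching the path `X` with the path `Y` by the time change `l`, an increasing
bijection (hence a homeomorphism) of `[0,T]`:
the maximum of `sup_t |l(t) - t|` and `sup_t dist (X(t), Y(l(t)))`. -/
noncomputable def cost {T : ℝ} {E : Type*} [PseudoEMetricSpace E]
    (X Y : SkorokhodSpace T E) (l : Set.Icc (0 : ℝ) T ≃o Set.Icc (0 : ℝ) T) : ℝ≥0∞ :=
  max (⨆ t, edist (l t) t) (⨆ t, edist (X t) (Y (l t)))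

/-- The Skorokhod (J1) metric on `D_E([0,T])`: the infimum over all time changes `l` of the
maximum of `sup_t |l(t) - t|` and `sup_t dist (X(t), Y(l(t)))`. -/
noncomputable instance {T : ℝ} {E : Type*} [PseudoEMetricSpace E] :
    PseudoEMetricSpace (SkorokhodSpace T E) where
  edist X Y := ⨅ l : Set.Icc (0 : ℝ) T ≃o Set.Icc (0 : ℝ) T, cost X Y l
  edist_self X := by
    refine le_antisymm (iInf_le_of_le (OrderIso.refl _) ?_) bot_le
    simp [cost]
  edist_comm X Y := by
    have key : ∀ X Y : SkorokhodSpace T E, ∀ l : Set.Icc (0 : ℝ) T ≃o Set.Icc (0 : ℝ) T,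
        cost X Y l.symm ≤ cost Y X l := by
      intro X Y l
      refine max_le_max (iSup_le fun t => ?_) (iSup_le fun t => ?_)
      · refine le_iSup_of_le (l.symm t) ?_
        rw [OrderIso.apply_symm_apply, edist_comm]
      · refine le_iSup_of_le (l.symm t) ?_
        rw [OrderIso.apply_symm_apply, edist_comm]
    refine le_antisymm (le_iInf fun l => ?_) (le_iInf fun l => ?_)
    · exact iInf_le_of_le l.symm (key X Y l)
    · exact iInf_le_of_le l.symm (key Y X l)
  edist_triangle X Y Z := by
    refine ENNReal.le_iInf_add_iInf ?_
    intro l m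
    refine iInf_le_of_le (l.trans m) (max_le (iSup_le fun t => ?_) (iSup_le fun t => ?_))
    · have h1 : edist (m (l t)) (l t) ≤ cost Y Z m :=
        le_max_of_le_left (le_iSup (fun s => edist (m s) s) (l t))
      have h2 : edist (l t) t ≤ cost X Y l :=
        le_max_of_le_left (le_iSup (fun s => edist (l s) s) t)
      calc edist ((l.trans m) t) t ≤ edist (m (l t)) (l t) + edist (l t) t := edist_triangle _ _ _
        _ ≤ cost Y Z m + cost X Y l := add_le_add h1 h2
        _ = cost X Y l + cost Y Z m := add_comm _ _
    · have h1 : edist (X t) (Y (l t)) ≤ cost X Y l :=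
        le_max_of_le_right (le_iSup (fun s => edist (X s) (Y (l s))) t)
      have h2 : edist (Y (l t)) (Z (m (l t))) ≤ cost Y Z m :=
        le_max_of_le_right (le_iSup (fun s => edist (Y s) (Z (m s))) (l t))
      exact (edist_triangle _ _ _).trans (add_le_add h1 h2)

/-- The piecewise constant path `t ↦ u_{⌊n t⌋}` on `[0,T]`. -/
noncomputable def ofSeq (T : ℝ) {E : Type*} [TopologicalSpace E] (n : ℕ) (u : ℕ → E) :
    SkorokhodSpace T E where
  toFun t := u ⌊(n : ℝ) * (t : ℝ)⌋₊
  right_continuous t := by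
    have h1 : Tendsto (fun s : Set.Icc (0 : ℝ) T => (n : ℝ) * (s : ℝ)) (𝓝[≥] t)
        (𝓝[≥] ((n : ℝ) * (t : ℝ))) := by
      refine tendsto_nhdsWithin_iff.2 ⟨?_, ?_⟩
      · exact ((by fun_prop : Continuous fun s : Set.Icc (0 : ℝ) T =>
          (n : ℝ) * (s : ℝ)).tendsto t).mono_left nhdsWithin_le_nhds
      · filter_upwards [self_mem_nhdsWithin] with s hs
        exact mul_le_mul_of_nonneg_left (show (t : ℝ) ≤ s from hs) (Nat.cast_nonneg n)
    have h2 := (tendsto_floor_right_pure_floor ((n : ℝ) * (t : ℝ))).comp h1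
    have h3 : ∀ᶠ s : Set.Icc (0 : ℝ) T in 𝓝[≥] t,
        ⌊(n : ℝ) * (s : ℝ)⌋ = ⌊(n : ℝ) * (t : ℝ)⌋ := tendsto_pure.1 h2
    refine Tendsto.congr' (f₁ := fun _ => u ⌊(n : ℝ) * (t : ℝ)⌋₊) ?_ tendsto_const_nhds
    filter_upwards [h3] with s hs
    rw [← Int.floor_toNat, ← Int.floor_toNat, hs]
  left_limits t := by
    rcases Nat.eq_zero_or_pos n with rfl | hn
    · exact ⟨u 0, by simpa using tendsto_const_nhds⟩
    have hn' : (0 : ℝ) < n := Nat.cast_pos.2 hn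
    have h1 : Tendsto (fun s : Set.Icc (0 : ℝ) T => (n : ℝ) * (s : ℝ)) (𝓝[<] t)
        (𝓝[<] ((n : ℝ) * (t : ℝ))) := by
      refine tendsto_nhdsWithin_iff.2 ⟨?_, ?_⟩
      · exact ((by fun_prop : Continuous fun s : Set.Icc (0 : ℝ) T =>
          (n : ℝ) * (s : ℝ)).tendsto t).mono_left nhdsWithin_le_nhds
      · filter_upwards [self_mem_nhdsWithin] with s hs
        exact mul_lt_mul_of_pos_left (show (s : ℝ) < t from hs) hn'
    have h2 := (tendsto_floor_left_pure_ceil_sub_one ((n : ℝ) * (t : ℝ))).comp h1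
    have h3 : ∀ᶠ s : Set.Icc (0 : ℝ) T in 𝓝[<] t,
        ⌊(n : ℝ) * (s : ℝ)⌋ = ⌈(n : ℝ) * (t : ℝ)⌉ - 1 := tendsto_pure.1 h2
    refine ⟨u (⌈(n : ℝ) * (t : ℝ)⌉ - 1).toNat, Tendsto.congr'
      (f₁ := fun _ => u (⌈(n : ℝ) * (t : ℝ)⌉ - 1).toNat) ?_ tendsto_const_nhds⟩
    filter_upwards [h3] with s hs
    rw [← Int.floor_toNat, hs]

end SkorokhodSpace

/-! ### The two-layer network and its training by stochastic gradient descent -/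

namespace TwoLayer

/-- All parameters `C^i`, `W^{2,j,i}`, `W^{1,j}` of a network with `N₁` and `N₂` hidden units and
inputs in `ℝ^d`. -/
structure Params (d N₁ N₂ : ℕ) where
  /-- The outer weights `C^i`. -/
  C : Fin N₂ → ℝ
  /-- The second-layer weights `W^{2,j,i}`, written `W2 j i`. -/
  W2 : Fin N₁ → Fin N₂ → ℝ
  /-- The first-layer weights `W^{1,j}`. -/
  W1 : Fin N₁ → EuclideanSpace ℝ (Fin d)

/-- The space `ℝ^{1 + N₁(1+d)}` of points `θ = (c, (w^{2,j})_j, (w^{1,j})_j)`. -/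
abbrev Theta (d N₁ : ℕ) : Type :=
  ℝ × (Fin N₁ → ℝ) × (Fin N₁ → EuclideanSpace ℝ (Fin d))

/-- `Z^{2,N₁}(x) = N₁^{-γ₁} ∑_j w^{2,j} σ(w^{1,j} x)` at the parameter `θ = (c, w², w¹)`. -/
noncomputable def Z {d N₁ : ℕ} (σ : ℝ → ℝ) (γ₁ : ℝ) (x : EuclideanSpace ℝ (Fin d))
    (θ : Theta d N₁) : ℝ :=
  1 / (N₁ : ℝ) ^ γ₁ * ∑ j, θ.2.1 j * σ (inner ℝ (θ.2.2 j) x)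

namespace Params

/-- The point `(C^i, (W^{2,j,i})_j, (W^{1,j})_j)`. -/
def unit {d N₁ N₂ : ℕ} (p : Params d N₁ N₂) (i : Fin N₂) : Theta d N₁ :=
  (p.C i, fun j => p.W2 j i, p.W1)

/-- The network output `g(x) = N₂^{-γ₂} ∑_i C^i σ(N₁^{-γ₁} ∑_j W^{2,j,i} σ(W^{1,j} x))`. -/
noncomputable def output {d N₁ N₂ : ℕ} (σ : ℝ → ℝ) (γ₁ γ₂ : ℝ) (p : Params d N₁ N₂)
    (x : EuclideanSpace ℝ (Fin d)) : ℝ :=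
  1 / (N₂ : ℝ) ^ γ₂ * ∑ i, p.C i * σ (Z σ γ₁ x (p.unit i))

/-- The empirical measure `(1/N₂) ∑_i δ_{(C^i, W^{2,·,i}, W^{1,·})}` on `ℝ^{1 + N₁(1+d)}`. -/
noncomputable def empirical {d N₁ N₂ : ℕ} [NeZero N₂] (p : Params d N₁ N₂) :
    ProbabilityMeasure (Theta d N₁) :=
  ⟨(N₂ : ℝ≥0∞)⁻¹ • ∑ i, Measure.dirac (p.unit i), ⟨by
    simp [ENNReal.inv_mul_cancel, NeZero.ne N₂]⟩⟩

/-- One step of stochastic gradient descent with learning rates `aC`, `aW1`, `aW2` on the data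
point `q = (x, y)`. -/
noncomputable def sgdStep {d N₁ N₂ : ℕ} (σ : ℝ → ℝ) (γ₁ γ₂ aC aW1 aW2 : ℝ)
    (q : EuclideanSpace ℝ (Fin d) × ℝ) (p : Params d N₁ N₂) : Params d N₁ N₂ where
  C i := p.C i + aC / (N₂ : ℝ) ^ γ₂ * (q.2 - p.output σ γ₁ γ₂ q.1) * σ (Z σ γ₁ q.1 (p.unit i))
  W2 j i := p.W2 j i + aW2 / ((N₁ : ℝ) ^ γ₁ * (N₂ : ℝ) ^ γ₂) * (q.2 - p.output σ γ₁ γ₂ q.1) *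
    p.C i * deriv σ (Z σ γ₁ q.1 (p.unit i)) * σ (inner ℝ (p.W1 j) q.1)
  W1 j := p.W1 j + (aW1 / (N₁ : ℝ) ^ γ₁ * (q.2 - p.output σ γ₁ γ₂ q.1) *
    (1 / (N₂ : ℝ) ^ γ₂ * ∑ i, p.C i * deriv σ (Z σ γ₁ q.1 (p.unit i)) * p.W2 j i) *
    deriv σ (inner ℝ (p.W1 j) q.1)) • q.1

/-- The parameters `θ_k` after `k` steps of stochastic gradient descent started at `p₀`, run on the
data sequence `(x_k, y_k)_k`, with the learning rates
`αC / N₂^{2-2γ₂}`, `αW1 / (N₁^{1-2γ₁} N₂^{3-2γ₂})`, `αW2 / (N₁^{1-2γ₁} N₂^{2-2γ₂})`. -/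
noncomputable def sgd {d N₁ N₂ : ℕ} (σ : ℝ → ℝ) (γ₁ γ₂ αC αW1 αW2 : ℝ)
    (p₀ : Params d N₁ N₂) (q : ℕ → EuclideanSpace ℝ (Fin d) × ℝ) : ℕ → Params d N₁ N₂
  | 0 => p₀
  | k + 1 => sgdStep σ γ₁ γ₂
      (αC / (N₂ : ℝ) ^ (2 - 2 * γ₂))
      (αW1 / ((N₁ : ℝ) ^ (1 - 2 * γ₁) * (N₂ : ℝ) ^ (3 - 2 * γ₂)))
      (αW2 / ((N₁ : ℝ) ^ (1 - 2 * γ₁) * (N₂ : ℝ) ^ (2 - 2 * γ₂)))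
      (q k) (sgd σ γ₁ γ₂ αC αW1 αW2 p₀ q k)

end Params

/-- The state space `E = 𝓜(ℝ^{1 + N₁(1+d)}) × ℝ^M`: probability measures with the Lévy-Prokhorov
metric (which metrizes weak convergence), times `ℝ^M` (with the sup norm). -/
abbrev State (d N₁ M : ℕ) : Type :=
  LevyProkhorov (ProbabilityMeasure (Theta d N₁)) × (Fin M → ℝ)

/-- The path `t ↦ (γ_t, h_t)` in `D_E([0,T])`, where `γ_t` is the empirical measure of the
parameters after `⌊N₂ t⌋` steps of stochastic gradient descent, and `h_t` is the vector of the
network outputs at the inputs `x^{(1)}, …, x^{(M)}` after `⌊N₂ t⌋` steps. -/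
noncomputable def trainingPath {d N₁ N₂ M : ℕ} [NeZero N₂] (T : ℝ) (σ : ℝ → ℝ)
    (γ₁ γ₂ αC αW1 αW2 : ℝ) (x : Fin M → EuclideanSpace ℝ (Fin d))
    (p₀ : Params d N₁ N₂) (q : ℕ → EuclideanSpace ℝ (Fin d) × ℝ) :
    SkorokhodSpace T (State d N₁ M) :=
  SkorokhodSpace.ofSeq T N₂ fun k =>
    (LevyProkhorov.ofMeasure (Params.sgd σ γ₁ γ₂ αC αW1 αW2 p₀ q k).empirical,
      fun m => (Params.sgd σ γ₁ γ₂ αC αW1 αW2 p₀ q k).output σ γ₁ γ₂ (x m))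

/-- The distribution `π = (1/M) ∑_m δ_{(x^{(m)}, y^{(m)})}` of the data. -/
noncomputable def dataMeasure {d M : ℕ} (x : Fin M → EuclideanSpace ℝ (Fin d)) (y : Fin M → ℝ) :
    Measure (EuclideanSpace ℝ (Fin d) × ℝ) :=
  (M : ℝ≥0∞)⁻¹ • ∑ m, Measure.dirac (x m, y m)

/-- The measure `γ₀^{N₁} = μ_C ⊗ μ_{W²}^{⊗ N₁} ⊗ δ_{w^{1,1}} ⊗ ⋯ ⊗ δ_{w^{1,N₁}}` on
`ℝ^{1 + N₁(1+d)}`, for given first-layer weights `w^{1,1}, …, w^{1,N₁}`. -/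
noncomputable def initialMeasure {d N₁ : ℕ} (μC μW2 : ProbabilityMeasure ℝ)
    (w1 : Fin N₁ → EuclideanSpace ℝ (Fin d)) : ProbabilityMeasure (Theta d N₁) :=
  ⟨(μC : Measure ℝ).prod ((Measure.pi fun _ : Fin N₁ => (μW2 : Measure ℝ)).prod
    (Measure.pi fun j => Measure.dirac (w1 j))), inferInstance⟩

/-- `B¹_{x,x'}(θ) = σ(Z(x')) σ(Z(x))`. -/
noncomputable def B1 {d N₁ : ℕ} (σ : ℝ → ℝ) (γ₁ : ℝ) (x x' : EuclideanSpace ℝ (Fin d))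
    (θ : Theta d N₁) : ℝ :=
  σ (Z σ γ₁ x' θ) * σ (Z σ γ₁ x θ)

/-- `B^{2,j}_{x,x'}(θ) = c² σ'(Z(x')) σ'(Z(x)) σ(w^{1,j} x') σ(w^{1,j} x)`. -/
noncomputable def B2 {d N₁ : ℕ} (σ : ℝ → ℝ) (γ₁ : ℝ) (j : Fin N₁)
    (x x' : EuclideanSpace ℝ (Fin d)) (θ : Theta d N₁) : ℝ :=
  θ.1 ^ 2 * deriv σ (Z σ γ₁ x' θ) * deriv σ (Z σ γ₁ x θ) *
    σ (inner ℝ (θ.2.2 j) x') * σ (inner ℝ (θ.2.2 j) x)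

/-- `B^{3,j}_x(θ) = c w^{2,j} σ'(w^{1,j} x) σ'(Z(x))`. -/
noncomputable def B3 {d N₁ : ℕ} (σ : ℝ → ℝ) (γ₁ : ℝ) (j : Fin N₁)
    (x : EuclideanSpace ℝ (Fin d)) (θ : Theta d N₁) : ℝ :=
  θ.1 * θ.2.1 j * deriv σ (inner ℝ (θ.2.2 j) x) * deriv σ (Z σ γ₁ x θ)

/-- The kernel
`A_{x,x'} = αC ⟨B¹_{x,x'}, γ⟩ + (1/N₁) ∑_j (αW2 ⟨B^{2,j}_{x,x'}, γ⟩`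
`+ αW1 (x · x') ⟨B^{3,j}_x, γ⟩ ⟨B^{3,j}_{x'}, γ⟩)`
for a probability measure `γ` on `ℝ^{1 + N₁(1+d)}`; the normalization
`αC = αW1 = αW2 = 1` gives the kernel without weights. -/
noncomputable def kernelA {d N₁ : ℕ} (σ : ℝ → ℝ) (γ₁ αC αW1 αW2 : ℝ)
    (γ : ProbabilityMeasure (Theta d N₁)) (x x' : EuclideanSpace ℝ (Fin d)) : ℝ :=
  αC * (∫ θ, B1 σ γ₁ x x' θ ∂(γ : Measure (Theta d N₁))) +
    1 / (N₁ : ℝ) * ∑ j, (αW2 * (∫ θ, B2 σ γ₁ j x x' θ ∂(γ : Measure (Theta d N₁))) +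
      αW1 * inner ℝ x x' * (∫ θ, B3 σ γ₁ j x θ ∂(γ : Measure (Theta d N₁))) *
        (∫ θ, B3 σ γ₁ j x' θ ∂(γ : Measure (Theta d N₁))))

end TwoLayer

/-! Write N for N₂. The learning rates are tuned so that one gradient step moves every unit (c, w²,
w¹) by N^(γ₂-2) times the residual times a bounded direction. Over the O(N) steps up to time T a
unit therefore moves by O(N^(γ₂-1)), which vanishes because γ₂ < 1: the empirical measure, and with
it the kernel, stays at its initial value. The output still moves, because it adds N units with
weight N^(-γ₂). By the chain rule (`fderiv_unitOutput_stepDirection`, `kernelA_empirical`) a step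
changes it by 1/N times the residual times the kernel of the current empirical measure, with a
Taylor remainder of order N^(-γ₂) · N · N^(2γ₂-4) = N^(γ₂-3). The outputs on the data set are thus a
noisy Euler scheme of mesh 1/N for the linear equation h' = (1/M) A (y - h).

The noise of the random data is handled pathwise. The drawn point is encoded by `dataWeight`, whose
partial sums centred at 1/M are o(N) by the strong law. The residuals change by O(1/N) per step, so
summation by parts makes the accumulated noise small. A discrete Gronwall inequality then compares
the scheme with the explicit solution `evolution` (`norm_sub_evolution_le_of_noisy_euler`). This
deterministic half ends in `training_close_to_limit`.

Probability only verifies its hypotheses. The initial output is N^(-γ₂) times a sum of N terms that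
are centred, since C has mean zero, and i.i.d. given the first layer, so its variance is
O(N^(1-2γ₂)), which vanishes because γ₂ > 1/2. The same second-moment estimate with exponent 1
treats the integrals that form the initial kernel, and Varadarajan's theorem treats the initial
empirical measure. A union bound over finitely many bad events concludes. The limit is explicit and
the estimate uniform in time, so the identity time change suffices and no tightness argument is
needed. -/

section Calculus

/-! ### Smooth functions on balls: Lipschitz bounds and Taylor remainders. -/

variable {E : Type*} [NormedAddCommGroup E] [NormedSpace ℝ E] [FiniteDimensional ℝ E]

theorem ContDiff.exists_lipschitz_closedBall {F : Type*} [NormedAddCommGroup F] [NormedSpace ℝ F]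
    {f : E → F} (hf : ContDiff ℝ 1 f) (R : ℝ) :
    ∃ K : ℝ, 0 ≤ K ∧ ∀ a ∈ Metric.closedBall (0 : E) R, ∀ b ∈ Metric.closedBall (0 : E) R,
      ‖f a - f b‖ ≤ K * ‖a - b‖ := by
  obtain ⟨K, hK⟩ := hf.contDiffOn.exists_lipschitzOnWith one_ne_zero
    (convex_closedBall (0 : E) R) (isCompact_closedBall 0 R)
  refine ⟨K, K.2, fun a ha b hb => ?_⟩
  simpa only [dist_eq_norm] using hK.dist_le_mul a ha b hb

theorem Continuous.exists_bound_closedBall {F : Type*} [NormedAddCommGroup F]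
    {f : E → F} (hf : Continuous f) (R : ℝ) :
    ∃ K : ℝ, 0 ≤ K ∧ ∀ a ∈ Metric.closedBall (0 : E) R, ‖f a‖ ≤ K := by
  obtain ⟨K, hK⟩ := (isCompact_closedBall (0 : E) R).exists_bound_of_continuousOn hf.continuousOn
  exact ⟨max K 0, le_max_right _ _, fun a ha => (hK a ha).trans (le_max_left _ _)⟩

/-- On the segment from a to b the derivative differs from its value at a by at most K‖b - a‖, so
the mean value inequality gives the quadratic remainder. -/
theorem ContDiff.exists_taylor_closedBall {f : E → ℝ} (hf : ContDiff ℝ 2 f) (R : ℝ) :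
    ∃ K : ℝ, 0 ≤ K ∧ ∀ a ∈ Metric.closedBall (0 : E) R, ∀ b ∈ Metric.closedBall (0 : E) R,
      |f b - f a - fderiv ℝ f a (b - a)| ≤ K * ‖b - a‖ ^ 2 := by
  obtain ⟨K, hK0, hK⟩ := (hf.fderiv_right (m := 1) (by norm_num)).exists_lipschitz_closedBall R
  refine ⟨K, hK0, fun a ha b hb => ?_⟩
  have hseg : segment ℝ a b ⊆ Metric.closedBall (0 : E) R :=
    (convex_closedBall (0 : E) R).segment_subset ha hb
  have := (convex_segment a b).norm_image_sub_le_of_norm_hasFDerivWithin_le' (f := f)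
    (f' := fderiv ℝ f) (φ := fderiv ℝ f a) (C := K * ‖b - a‖) (x := a) (y := b)
    (fun x _ => ((hf.differentiable (by norm_num)) x).hasFDerivAt.hasFDerivWithinAt)
    (fun x hx => (hK x (hseg hx) a ha).trans (by
      gcongr
      exact (norm_sub_le_of_mem_segment hx)))
    (left_mem_segment ℝ a b) (right_mem_segment ℝ a b)
  rw [Real.norm_eq_abs] at this
  linarith [this, sq (‖b - a‖), mul_assoc K ‖b - a‖ ‖b - a‖]

end Calculus

/-! ### The output of one unit and its derivative. -/

namespace TwoLayer

variable {d N₁ : ℕ} {σ : ℝ → ℝ} {γ₁ : ℝ}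

/-- The contribution `c σ(Z(x))` of one unit to the output of the network. -/
noncomputable def unitOutput (σ : ℝ → ℝ) (γ₁ : ℝ) (x : EuclideanSpace ℝ (Fin d))
    (θ : Theta d N₁) : ℝ :=
  θ.1 * σ (Z σ γ₁ x θ)

theorem contDiff_deriv (hσ : ContDiff ℝ ((⊤ : ℕ∞) : WithTop ℕ∞) σ) :
    ContDiff ℝ ((⊤ : ℕ∞) : WithTop ℕ∞) (deriv σ) :=
  (contDiff_infty_iff_deriv.1 hσ).2

theorem contDiff_Z (hσ : ContDiff ℝ ((⊤ : ℕ∞) : WithTop ℕ∞) σ) (x : EuclideanSpace ℝ (Fin d)) :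
    ContDiff ℝ ((⊤ : ℕ∞) : WithTop ℕ∞) (Z σ γ₁ x : Theta d N₁ → ℝ) := by
  unfold Z
  refine contDiff_const.mul (ContDiff.sum fun j _ => ContDiff.mul (by fun_prop) (hσ.comp ?_))
  exact ContDiff.inner ℝ (by fun_prop) contDiff_const

theorem contDiff_unitOutput (hσ : ContDiff ℝ ((⊤ : ℕ∞) : WithTop ℕ∞) σ)
    (x : EuclideanSpace ℝ (Fin d)) :
    ContDiff ℝ ((⊤ : ℕ∞) : WithTop ℕ∞) (unitOutput σ γ₁ x : Theta d N₁ → ℝ) :=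
  contDiff_fst.mul (hσ.comp (contDiff_Z hσ x))

theorem contDiff_inner_W1 {φ : ℝ → ℝ} (hφ : ContDiff ℝ ((⊤ : ℕ∞) : WithTop ℕ∞) φ) (j : Fin N₁)
    (x : EuclideanSpace ℝ (Fin d)) :
    ContDiff ℝ ((⊤ : ℕ∞) : WithTop ℕ∞) (fun θ : Theta d N₁ => φ (inner ℝ (θ.2.2 j) x)) :=
  hφ.comp (ContDiff.inner ℝ (by fun_prop) contDiff_const)

theorem contDiff_B1 (hσ : ContDiff ℝ ((⊤ : ℕ∞) : WithTop ℕ∞) σ)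
    (x x' : EuclideanSpace ℝ (Fin d)) :
    ContDiff ℝ ((⊤ : ℕ∞) : WithTop ℕ∞) (B1 σ γ₁ x x' : Theta d N₁ → ℝ) :=
  (hσ.comp (contDiff_Z hσ x')).mul (hσ.comp (contDiff_Z hσ x))

theorem contDiff_B2 (hσ : ContDiff ℝ ((⊤ : ℕ∞) : WithTop ℕ∞) σ) (j : Fin N₁)
    (x x' : EuclideanSpace ℝ (Fin d)) :
    ContDiff ℝ ((⊤ : ℕ∞) : WithTop ℕ∞) (B2 σ γ₁ j x x' : Theta d N₁ → ℝ) :=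
  (((((contDiff_fst.pow 2).mul ((contDiff_deriv hσ).comp (contDiff_Z hσ x'))).mul
    ((contDiff_deriv hσ).comp (contDiff_Z hσ x))).mul (contDiff_inner_W1 hσ j x')).mul
    (contDiff_inner_W1 hσ j x))

theorem contDiff_B3 (hσ : ContDiff ℝ ((⊤ : ℕ∞) : WithTop ℕ∞) σ) (j : Fin N₁)
    (x : EuclideanSpace ℝ (Fin d)) :
    ContDiff ℝ ((⊤ : ℕ∞) : WithTop ℕ∞) (B3 σ γ₁ j x : Theta d N₁ → ℝ) :=
  ((contDiff_fst.mul (by fun_prop)).mul (contDiff_inner_W1 (contDiff_deriv hσ) j x)).mul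
    ((contDiff_deriv hσ).comp (contDiff_Z hσ x))

/-- Restricting to the line s ↦ θ + s • v reduces the computation to one-variable calculus;
uniqueness of derivatives identifies the two expressions. -/
theorem fderiv_unitOutput (hσ : ContDiff ℝ ((⊤ : ℕ∞) : WithTop ℕ∞) σ)
    (x : EuclideanSpace ℝ (Fin d)) (θ v : Theta d N₁) :
    fderiv ℝ (unitOutput σ γ₁ x) θ v = v.1 * σ (Z σ γ₁ x θ) +
      θ.1 * (deriv σ (Z σ γ₁ x θ) * (1 / (N₁ : ℝ) ^ γ₁ * ∑ j,
        (v.2.1 j * σ (inner ℝ (θ.2.2 j) x) +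
          θ.2.1 j * (deriv σ (inner ℝ (θ.2.2 j) x) * inner ℝ (v.2.2 j) x)))) := by
  have hσ' : ∀ z, HasDerivAt σ (deriv σ z) z := fun z =>
    (hσ.differentiable (by simp) z).hasDerivAt
  have hline : ∀ s : ℝ, HasDerivAt (fun s : ℝ => θ + s • v) v s := fun s => by
    simpa using ((hasDerivAt_id s).smul_const v).const_add θ
  have h1 : HasDerivAt (fun s : ℝ => unitOutput σ γ₁ x (θ + s • v))
      (fderiv ℝ (unitOutput σ γ₁ x) θ v) 0 := by
    have hd := ((contDiff_unitOutput (γ₁ := γ₁) hσ x).differentiable (by simp)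
      (θ + (0 : ℝ) • v)).hasFDerivAt
    have := hd.comp_hasDerivAt (0 : ℝ) (hline 0)
    rw [zero_smul, add_zero] at this
    exact this
  have hin : ∀ j, HasDerivAt (fun s : ℝ => inner ℝ (θ.2.2 j + s • v.2.2 j) x)
      (inner ℝ (v.2.2 j) x) 0 := by
    intro j
    have : (fun s : ℝ => inner ℝ (θ.2.2 j + s • v.2.2 j) x) =
        fun s : ℝ => inner ℝ (θ.2.2 j) x + s * inner ℝ (v.2.2 j) x := by
      funext s
      rw [inner_add_left, real_inner_smul_left]
    rw [this]
    simpa using ((hasDerivAt_id (0 : ℝ)).mul_const (inner ℝ (v.2.2 j) x)).const_add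
      (inner ℝ (θ.2.2 j) x)
  have hlin : ∀ a b : ℝ, HasDerivAt (fun s : ℝ => a + s * b) b 0 := fun a b => by
    simpa using ((hasDerivAt_id (0 : ℝ)).mul_const b).const_add a
  have hZ : HasDerivAt (fun s : ℝ => Z σ γ₁ x (θ + s • v))
      (1 / (N₁ : ℝ) ^ γ₁ * ∑ j, (v.2.1 j * σ (inner ℝ (θ.2.2 j) x) +
          θ.2.1 j * (deriv σ (inner ℝ (θ.2.2 j) x) * inner ℝ (v.2.2 j) x))) 0 := by
    unfold Z
    refine HasDerivAt.const_mul _ (HasDerivAt.fun_sum fun j _ => ?_)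
    have hs := HasDerivAt.comp (0 : ℝ) (hσ' (inner ℝ (θ.2.2 j + (0 : ℝ) • v.2.2 j) x)) (hin j)
    have := (hlin (θ.2.1 j) (v.2.1 j)).mul hs
    simp only [zero_smul, add_zero, zero_mul, Function.comp_def] at this
    exact this
  have h2 : HasDerivAt (fun s : ℝ => unitOutput σ γ₁ x (θ + s • v))
      (v.1 * σ (Z σ γ₁ x θ) + θ.1 * (deriv σ (Z σ γ₁ x θ) * (1 / (N₁ : ℝ) ^ γ₁ * ∑ j,
        (v.2.1 j * σ (inner ℝ (θ.2.2 j) x) +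
          θ.2.1 j * (deriv σ (inner ℝ (θ.2.2 j) x) * inner ℝ (v.2.2 j) x))))) 0 := by
    have hs := HasDerivAt.comp (0 : ℝ) (hσ' (Z σ γ₁ x (θ + (0 : ℝ) • v))) hZ
    have := (hlin θ.1 v.1).mul hs
    simp only [zero_smul, add_zero, zero_mul, Function.comp_def] at this
    exact this
  exact h1.unique h2

/-- The direction, per unit of learning rate and residual, in which a step of gradient descent on
the input `x` moves a unit; `b j` is the average of `B³ʲₓ` over the units. -/
noncomputable def stepDirection (σ : ℝ → ℝ) (γ₁ αC αW1 αW2 : ℝ) (x : EuclideanSpace ℝ (Fin d))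
    (b : Fin N₁ → ℝ) (θ : Theta d N₁) : Theta d N₁ :=
  (αC * σ (Z σ γ₁ x θ),
    fun j => αW2 * (N₁ : ℝ) ^ (γ₁ - 1) * (θ.1 * deriv σ (Z σ γ₁ x θ) * σ (inner ℝ (θ.2.2 j) x)),
    fun j => (αW1 * (N₁ : ℝ) ^ (γ₁ - 1) * b j) • x)

/-- This is where the kernel comes from: each block of parameters contributes one of the three
families of terms, and N₁^(-γ₁) · N₁^(γ₁-1) produces the factor 1/N₁. The first layer is shared by
all units, so its step enters through the average `b`; this is why the kernel contains a product of
two integrals of B³. -/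
theorem fderiv_unitOutput_stepDirection (hσ : ContDiff ℝ ((⊤ : ℕ∞) : WithTop ℕ∞) σ)
    (hN₁ : 0 < N₁) (αC αW1 αW2 : ℝ) (x x' : EuclideanSpace ℝ (Fin d)) (b : Fin N₁ → ℝ)
    (θ : Theta d N₁) :
    fderiv ℝ (unitOutput σ γ₁ x) θ (stepDirection σ γ₁ αC αW1 αW2 x' b θ) =
      αC * B1 σ γ₁ x x' θ + 1 / (N₁ : ℝ) * ∑ j, (αW2 * B2 σ γ₁ j x x' θ +
        αW1 * inner ℝ x x' * B3 σ γ₁ j x θ * b j) := by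
  have hN : (0 : ℝ) < N₁ := Nat.cast_pos.2 hN₁
  have hpow : 1 / (N₁ : ℝ) ^ γ₁ * (N₁ : ℝ) ^ (γ₁ - 1) = 1 / (N₁ : ℝ) := by
    rw [Real.rpow_sub hN, Real.rpow_one]
    have := (Real.rpow_pos_of_pos hN γ₁).ne'
    field_simp
  rw [fderiv_unitOutput hσ]
  unfold stepDirection B1 B2 B3
  simp only
  rw [← hpow, mul_assoc (1 / (N₁ : ℝ) ^ γ₁) ((N₁ : ℝ) ^ (γ₁ - 1))]
  simp only [Finset.mul_sum]
  congr 1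
  · ring
  · refine Finset.sum_congr rfl fun j _ => ?_
    rw [real_inner_smul_left, real_inner_comm x x']
    ring

end TwoLayer

/-! ### The effect of a single gradient step. -/

theorem exists_uniform_bound {ι X : Type*} [Finite ι] {f g : ι → X → ℝ} {S : Set X}
    (hg : ∀ i x, x ∈ S → 0 ≤ g i x)
    (h : ∀ i, ∃ K : ℝ, 0 ≤ K ∧ ∀ x ∈ S, f i x ≤ K * g i x) :
    ∃ K : ℝ, 0 ≤ K ∧ ∀ i, ∀ x ∈ S, f i x ≤ K * g i x := by
  cases nonempty_fintype ι
  choose K hK0 hK using h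
  refine ⟨∑ i, K i, Finset.sum_nonneg fun i _ => hK0 i, fun i x hx => (hK i x hx).trans ?_⟩
  exact mul_le_mul_of_nonneg_right
    (Finset.single_le_sum (fun j _ => hK0 j) (Finset.mem_univ i)) (hg i x hx)

theorem abs_sum_le_card_mul {N : ℕ} {f : Fin N → ℝ} {K : ℝ} (h : ∀ i, |f i| ≤ K) :
    |∑ i, f i| ≤ N * K :=
  (Finset.abs_sum_le_sum_abs _ _).trans
    ((Finset.sum_le_card_nsmul _ _ K fun i _ => h i).trans (by simp))

namespace TwoLayer

variable {d N₁ N : ℕ} {σ : ℝ → ℝ} {γ₁ : ℝ}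

theorem integral_empirical [NeZero N] (p : Params d N₁ N) (f : Theta d N₁ → ℝ) :
    ∫ θ, f θ ∂(p.empirical : Measure (Theta d N₁)) = 1 / (N : ℝ) * ∑ i, f (p.unit i) := by
  have : (p.empirical : Measure (Theta d N₁)) =
      (N : ℝ≥0∞)⁻¹ • ∑ i, Measure.dirac (p.unit i) := rfl
  rw [this, integral_smul_measure, integral_finsetSum_measure]
  · simp
  · intro i _
    exact integrable_dirac (by simp)

theorem Params.output_eq_sum_unitOutput (γ₁ γ₂ : ℝ) (p : Params d N₁ N)
    (x : EuclideanSpace ℝ (Fin d)) :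
    p.output σ γ₁ γ₂ x = 1 / (N : ℝ) ^ γ₂ * ∑ i, unitOutput σ γ₁ x (p.unit i) := rfl

/-- One step of stochastic gradient descent with the learning rates used for training. -/
noncomputable def Params.trainStep (σ : ℝ → ℝ) (γ₁ γ₂ αC αW1 αW2 : ℝ)
    (q : EuclideanSpace ℝ (Fin d) × ℝ) (p : Params d N₁ N) : Params d N₁ N :=
  p.sgdStep σ γ₁ γ₂
    (αC / (N : ℝ) ^ (2 - 2 * γ₂))
    (αW1 / ((N₁ : ℝ) ^ (1 - 2 * γ₁) * (N : ℝ) ^ (3 - 2 * γ₂)))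
    (αW2 / ((N₁ : ℝ) ^ (1 - 2 * γ₁) * (N : ℝ) ^ (2 - 2 * γ₂))) q

/-- The scalings cancel so that all three blocks share the rate N^(γ₂-2). The first layer has an
additional factor 1/N, which turns the sum over units in its gradient into the average of B³. -/
theorem Params.unit_trainStep (hN₁ : 0 < N₁) (hN : 0 < N) (γ₂ αC αW1 αW2 : ℝ)
    (q : EuclideanSpace ℝ (Fin d) × ℝ) (p : Params d N₁ N) (i : Fin N) :
    (p.trainStep σ γ₁ γ₂ αC αW1 αW2 q).unit i = p.unit i +
      ((N : ℝ) ^ (γ₂ - 2) * (q.2 - p.output σ γ₁ γ₂ q.1)) •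
        stepDirection σ γ₁ αC αW1 αW2 q.1
          (fun j => 1 / (N : ℝ) * ∑ i, B3 σ γ₁ j q.1 (p.unit i)) (p.unit i) := by
  have h1 : (0 : ℝ) < N₁ := Nat.cast_pos.2 hN₁
  have h2 : (0 : ℝ) < N := Nat.cast_pos.2 hN
  have e1 : ((N₁ : ℝ) ^ (1 - 2 * γ₁) * (N₁ : ℝ) ^ γ₁)⁻¹ = (N₁ : ℝ) ^ (γ₁ - 1) := by
    rw [← Real.rpow_add h1, ← Real.rpow_neg h1.le]; ring_nf
  have e2 : ((N : ℝ) ^ (2 - 2 * γ₂) * (N : ℝ) ^ γ₂)⁻¹ = (N : ℝ) ^ (γ₂ - 2) := by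
    rw [← Real.rpow_add h2, ← Real.rpow_neg h2.le]; ring_nf
  have e3 : ((N : ℝ) ^ (3 - 2 * γ₂) * (N : ℝ) ^ γ₂)⁻¹ = (N : ℝ) ^ (γ₂ - 2) * (1 / (N : ℝ)) := by
    rw [← Real.rpow_add h2, ← Real.rpow_neg h2.le, one_div, ← Real.rpow_neg_one,
      ← Real.rpow_add h2]
    ring_nf
  set r := q.2 - p.output σ γ₁ γ₂ q.1 with hr
  refine Prod.ext ?_ (Prod.ext (funext fun j => ?_) (funext fun j => ?_))
  · simp only [Params.unit, Params.trainStep, Params.sgdStep, stepDirection, Prod.fst_add,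
      Prod.smul_fst, smul_eq_mul, ← hr, ← e2]
    rw [mul_inv]
    ring
  · simp only [Params.unit, Params.trainStep, Params.sgdStep, stepDirection, Prod.fst_add,
      Prod.snd_add, Prod.smul_fst, Prod.smul_snd, smul_eq_mul, ← hr, ← e2, ← e1, Pi.add_apply,
      Pi.smul_apply]
    rw [mul_inv, mul_inv]
    ring
  · simp only [Params.unit, Params.trainStep, Params.sgdStep, stepDirection,
      Prod.snd_add, Prod.smul_snd, smul_smul, ← hr, Pi.add_apply, Pi.smul_apply]
    congr 2
    have hS : ∑ i, B3 σ γ₁ j q.1 (p.unit i) = (∑ i, p.C i * deriv σ (Z σ γ₁ q.1 (p.unit i)) *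
        p.W2 j i) * deriv σ (inner ℝ (p.W1 j) q.1) := by
      rw [Finset.sum_mul]
      refine Finset.sum_congr rfl fun i _ => ?_
      simp only [B3, Params.unit]
      ring
    simp only [Params.unit] at hS ⊢
    rw [hS]
    set S := ∑ i, p.C i * deriv σ (Z σ γ₁ q.1 (p.C i, fun j => p.W2 j i, p.W1)) * p.W2 j i
    calc _ = αW1 * ((N₁ : ℝ) ^ (1 - 2 * γ₁) * (N₁ : ℝ) ^ γ₁)⁻¹ *
          ((N : ℝ) ^ (3 - 2 * γ₂) * (N : ℝ) ^ γ₂)⁻¹ * r * S *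
          deriv σ (inner ℝ (p.W1 j) q.1) := by
          rw [mul_inv, mul_inv]; ring
      _ = _ := by rw [e1, e3]; ring

/-- The right-hand side is the average over the units of the derivative in
`fderiv_unitOutput_stepDirection`, with `b` the empirical mean of B³. The first-order change of the
output is thus governed by the kernel of the current empirical measure. -/
theorem kernelA_empirical [NeZero N] (αC αW1 αW2 : ℝ) (p : Params d N₁ N)
    (x x' : EuclideanSpace ℝ (Fin d)) :
    kernelA σ γ₁ αC αW1 αW2 p.empirical x x' =
      1 / (N : ℝ) * ∑ i, (αC * B1 σ γ₁ x x' (p.unit i) +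
        1 / (N₁ : ℝ) * ∑ j, (αW2 * B2 σ γ₁ j x x' (p.unit i) +
          αW1 * inner ℝ x x' * B3 σ γ₁ j x (p.unit i) *
            (1 / (N : ℝ) * ∑ i, B3 σ γ₁ j x' (p.unit i)))) := by
  have h : ∀ i : Fin N, (αC * B1 σ γ₁ x x' (p.unit i) +
        1 / (N₁ : ℝ) * ∑ j, (αW2 * B2 σ γ₁ j x x' (p.unit i) +
          αW1 * inner ℝ x x' * B3 σ γ₁ j x (p.unit i) *
            (1 / (N : ℝ) * ∑ i, B3 σ γ₁ j x' (p.unit i)))) =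
      αC * B1 σ γ₁ x x' (p.unit i) + ∑ j, 1 / (N₁ : ℝ) * (αW2 * B2 σ γ₁ j x x' (p.unit i) +
          αW1 * inner ℝ x x' * (1 / (N : ℝ) * ∑ i, B3 σ γ₁ j x' (p.unit i)) *
            B3 σ γ₁ j x (p.unit i)) := fun i => by
    rw [Finset.mul_sum]
    congr 1
    exact Finset.sum_congr rfl fun j _ => by ring
  rw [Finset.sum_congr rfl fun i _ => h i, Finset.sum_add_distrib, Finset.sum_comm, mul_add,
    ← Finset.mul_sum, kernelA]
  simp only [integral_empirical]
  congr 1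
  · ring
  · rw [Finset.mul_sum, Finset.mul_sum]
    refine Finset.sum_congr rfl fun j _ => ?_
    rw [← Finset.mul_sum, Finset.sum_add_distrib, ← Finset.mul_sum, ← Finset.mul_sum]
    ring

/-- The bound is uniform in N because a unit sees the others only through `b`, an average of bounded
numbers; the pair (b, θ) stays in one compact ball whatever N is. -/
theorem stepDirection_bounded (hσ : ContDiff ℝ ((⊤ : ℕ∞) : WithTop ℕ∞) σ) (αC αW1 αW2 : ℝ)
    (x : EuclideanSpace ℝ (Fin d)) (R : ℝ) :
    ∃ K : ℝ, 0 ≤ K ∧ ∀ (N : ℕ) (p : Params d N₁ N), 0 < N → (∀ i, ‖p.unit i‖ ≤ R) →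
      ∀ i, ‖stepDirection σ γ₁ αC αW1 αW2 x
        (fun j => 1 / (N : ℝ) * ∑ i, B3 σ γ₁ j x (p.unit i)) (p.unit i)‖ ≤ K := by
  have hσc := hσ.continuous
  have hσ'c := (contDiff_deriv hσ).continuous
  have hZ : Continuous (Z σ γ₁ x : Theta d N₁ → ℝ) := (contDiff_Z hσ x).continuous
  have hc : Continuous fun a : (Fin N₁ → ℝ) × Theta d N₁ =>
      stepDirection σ γ₁ αC αW1 αW2 x a.1 a.2 := by
    unfold stepDirection
    have h1 : Continuous fun a : (Fin N₁ → ℝ) × Theta d N₁ => Z σ γ₁ x a.2 :=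
      hZ.comp continuous_snd
    refine Continuous.prodMk (by fun_prop) (Continuous.prodMk ?_ (by fun_prop))
    refine continuous_pi fun j => ?_
    have h2 := (contDiff_inner_W1 (N₁ := N₁) hσ j x).continuous.comp
      (continuous_snd : Continuous fun a : (Fin N₁ → ℝ) × Theta d N₁ => a.2)
    exact continuous_const.mul ((continuous_snd.fst.mul (hσ'c.comp h1)).mul h2)
  obtain ⟨Kb, hKb0, hKb⟩ := exists_uniform_bound (ι := Fin N₁) (S := Metric.closedBall 0 R)
    (f := fun j θ => |B3 σ γ₁ j x θ|) (g := fun _ _ => 1) (fun _ _ _ => zero_le_one)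
    (fun j => by
      obtain ⟨K, h0, h⟩ := (contDiff_B3 (γ₁ := γ₁) hσ j x).continuous.exists_bound_closedBall R
      exact ⟨K, h0, fun θ hθ => by simpa using h θ hθ⟩)
  obtain ⟨K, hK0, hK⟩ := hc.exists_bound_closedBall (max R Kb)
  refine ⟨K, hK0, fun N p hN hp i => hK (_, _) ?_⟩
  rw [mem_closedBall_zero_iff]
  refine max_le ?_ ((hp i).trans (le_max_left _ _))
  refine le_trans ?_ (le_max_right R Kb)
  refine (pi_norm_le_iff_of_nonneg hKb0).2 fun j => ?_
  have hN' : (0 : ℝ) < N := Nat.cast_pos.2 hN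
  rw [Real.norm_eq_abs, abs_mul, abs_of_pos (by positivity), one_div, inv_mul_le_iff₀ hN']
  refine abs_sum_le_card_mul fun i => ?_
  simpa using hKb j (p.unit i) (mem_closedBall_zero_iff.2 (hp i))

/-- The effect of one training step, as long as the units stay in a ball. -/
theorem trainStep_estimates (hσ : ContDiff ℝ ((⊤ : ℕ∞) : WithTop ℕ∞) σ) (hN₁ : 0 < N₁)
    (γ₂ αC αW1 αW2 : ℝ) {M : ℕ} (x : Fin M → EuclideanSpace ℝ (Fin d)) (R : ℝ) :
    ∃ K : ℝ, 0 ≤ K ∧ ∀ (N : ℕ) [NeZero N] (p : Params d N₁ N) (m : Fin M) (y : ℝ),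
      (∀ i, ‖p.unit i‖ ≤ R) →
      (∀ i, ‖(p.trainStep σ γ₁ γ₂ αC αW1 αW2 (x m, y)).unit i - p.unit i‖ ≤
        K * (N : ℝ) ^ (γ₂ - 2) * |y - p.output σ γ₁ γ₂ (x m)|) ∧
      ((∀ i, ‖(p.trainStep σ γ₁ γ₂ αC αW1 αW2 (x m, y)).unit i‖ ≤ R) → ∀ l,
        |(p.trainStep σ γ₁ γ₂ αC αW1 αW2 (x m, y)).output σ γ₁ γ₂ (x l) -
          p.output σ γ₁ γ₂ (x l)| ≤ K / N * |y - p.output σ γ₁ γ₂ (x m)| ∧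
        |(p.trainStep σ γ₁ γ₂ αC αW1 αW2 (x m, y)).output σ γ₁ γ₂ (x l) -
          p.output σ γ₁ γ₂ (x l) - 1 / N * ((y - p.output σ γ₁ γ₂ (x m)) *
            kernelA σ γ₁ αC αW1 αW2 p.empirical (x l) (x m))| ≤
          K * (N : ℝ) ^ (γ₂ - 3) * |y - p.output σ γ₁ γ₂ (x m)| ^ 2) := by
  choose D hD0 hD using fun m => stepDirection_bounded (N₁ := N₁) (γ₁ := γ₁) hσ αC αW1 αW2 (x m) R
  choose K₁ hK₁0 hK₁ using fun l => ((contDiff_unitOutput (N₁ := N₁) (γ₁ := γ₁) hσ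
    (x l)).of_le (by exact_mod_cast le_top) :
    ContDiff ℝ 1 (unitOutput σ γ₁ (x l) : Theta d N₁ → ℝ)).exists_lipschitz_closedBall R
  choose K₂ hK₂0 hK₂ using fun l => ((contDiff_unitOutput (N₁ := N₁) (γ₁ := γ₁) hσ
    (x l)).of_le (by norm_cast) :
    ContDiff ℝ 2 (unitOutput σ γ₁ (x l) : Theta d N₁ → ℝ)).exists_taylor_closedBall R
  set DD := ∑ m, D m
  set KK₁ := ∑ m, K₁ m
  set KK₂ := ∑ m, K₂ m
  have hDD : ∀ m, D m ≤ DD := fun m =>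
    Finset.single_le_sum (fun j _ => hD0 j) (Finset.mem_univ m)
  have hKK₁ : ∀ m, K₁ m ≤ KK₁ := fun m =>
    Finset.single_le_sum (fun j _ => hK₁0 j) (Finset.mem_univ m)
  have hKK₂ : ∀ m, K₂ m ≤ KK₂ := fun m =>
    Finset.single_le_sum (fun j _ => hK₂0 j) (Finset.mem_univ m)
  have hDD0 : 0 ≤ DD := Finset.sum_nonneg fun m _ => hD0 m
  have hKK₁0 : 0 ≤ KK₁ := Finset.sum_nonneg fun m _ => hK₁0 m
  have hKK₂0 : 0 ≤ KK₂ := Finset.sum_nonneg fun m _ => hK₂0 m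
  -- The three summands serve the displacement, the Lipschitz bound and the Taylor bound
  -- respectively.
  refine ⟨DD + KK₁ * DD + KK₂ * DD ^ 2, by positivity, ?_⟩
  intro N _ p m y hp
  have hN : 0 < N := NeZero.pos N
  have hN' : (0 : ℝ) < N := Nat.cast_pos.2 hN
  set p' := p.trainStep σ γ₁ γ₂ αC αW1 αW2 (x m, y) with hp'
  set r := y - p.output σ γ₁ γ₂ (x m) with hr
  set G : Fin N → Theta d N₁ := fun i => stepDirection σ γ₁ αC αW1 αW2 (x m)
          (fun j => 1 / (N : ℝ) * ∑ i, B3 σ γ₁ j (x m) (p.unit i)) (p.unit i) with hG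
  have hunit : ∀ i, p'.unit i - p.unit i = ((N : ℝ) ^ (γ₂ - 2) * r) • G i := fun i => by
    rw [hp', Params.unit_trainStep hN₁ hN, add_sub_cancel_left]
  have hGb : ∀ i, ‖G i‖ ≤ DD := fun i => (hD m N p hN hp i).trans (hDD m)
  have hΔ : ∀ i, ‖p'.unit i - p.unit i‖ ≤ DD * ((N : ℝ) ^ (γ₂ - 2) * |r|) := fun i => by
    rw [hunit, norm_smul, Real.norm_eq_abs, abs_mul, abs_of_nonneg (by positivity), mul_comm DD]
    exact mul_le_mul_of_nonneg_left (hGb i) (by positivity)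
  -- N units, each moving at rate N^(γ₂-2), weighted by N^(-γ₂): the output changes at order 1/N.
  have hpow1 : 1 / (N : ℝ) ^ γ₂ * (N * (N : ℝ) ^ (γ₂ - 2)) = 1 / N := by
    rw [Real.rpow_sub hN', Real.rpow_two]
    have := (Real.rpow_pos_of_pos hN' γ₂).ne'
    field_simp
  -- The same count with squared displacements gives the order of the Taylor remainder.
  have hpow2 : 1 / (N : ℝ) ^ γ₂ * (N * ((N : ℝ) ^ (γ₂ - 2)) ^ 2) = (N : ℝ) ^ (γ₂ - 3) := by
    rw [Real.rpow_sub hN', Real.rpow_two, Real.rpow_sub hN', Real.rpow_ofNat]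
    have := (Real.rpow_pos_of_pos hN' γ₂).ne'
    field_simp
  refine ⟨fun i => (hΔ i).trans ?_, fun hpR l => ⟨?_, ?_⟩⟩
  · rw [mul_assoc]
    refine mul_le_mul_of_nonneg_right ?_ (by positivity)
    nlinarith [mul_nonneg hKK₁0 hDD0, mul_nonneg hKK₂0 (sq_nonneg DD)]
  · rw [Params.output_eq_sum_unitOutput, Params.output_eq_sum_unitOutput, ← mul_sub,
      ← Finset.sum_sub_distrib, abs_mul, abs_of_nonneg (by positivity)]
    calc 1 / (N : ℝ) ^ γ₂ * |∑ i, (unitOutput σ γ₁ (x l) (p'.unit i) -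
            unitOutput σ γ₁ (x l) (p.unit i))|
        ≤ 1 / (N : ℝ) ^ γ₂ * (N * (KK₁ * (DD * ((N : ℝ) ^ (γ₂ - 2) * |r|)))) := by
          refine mul_le_mul_of_nonneg_left ?_ (by positivity)
          refine abs_sum_le_card_mul fun i => ?_
          refine (hK₁ l _ (mem_closedBall_zero_iff.2 (hpR i)) _
            (mem_closedBall_zero_iff.2 (hp i))).trans ?_
          exact mul_le_mul (hKK₁ l) (hΔ i) (norm_nonneg _) hKK₁0
      _ = (KK₁ * DD) * (1 / (N : ℝ) ^ γ₂ * (N * (N : ℝ) ^ (γ₂ - 2))) * |r| := by ring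
      _ = (KK₁ * DD) / N * |r| := by rw [hpow1]; ring
      _ ≤ _ := by
          gcongr
          nlinarith [mul_nonneg hKK₁0 hDD0, mul_nonneg hKK₂0 (sq_nonneg DD)]
  -- The kernel term equals the sum of the first-order Taylor terms exactly, so only the
  -- second-order remainders are left to bound.
  · have hlin : 1 / (N : ℝ) * (r * kernelA σ γ₁ αC αW1 αW2 p.empirical (x l) (x m)) =
        1 / (N : ℝ) ^ γ₂ * ∑ i, fderiv ℝ (unitOutput σ γ₁ (x l)) (p.unit i)
          (p'.unit i - p.unit i) := by
      simp only [hunit, map_smul, smul_eq_mul, hG, fderiv_unitOutput_stepDirection hσ hN₁]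
      rw [← Finset.mul_sum, kernelA_empirical]
      have e : ∀ S : ℝ, 1 / (N : ℝ) * (r * (1 / N * S)) =
          1 / (N : ℝ) ^ γ₂ * ((N : ℝ) ^ (γ₂ - 2) * r * S) := fun S => by
        have := hpow1
        rw [mul_left_comm, mul_comm] at this
        linear_combination (-(r * S / N)) * hpow1 + (r * S * (1 / (N : ℝ) ^ γ₂ *
          (N : ℝ) ^ (γ₂ - 2))) * (mul_one_div_cancel hN'.ne')
      exact e _
    rw [hlin, Params.output_eq_sum_unitOutput, Params.output_eq_sum_unitOutput, ← mul_sub,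
      ← mul_sub, ← Finset.sum_sub_distrib, ← Finset.sum_sub_distrib, abs_mul,
      abs_of_nonneg (by positivity)]
    calc 1 / (N : ℝ) ^ γ₂ * |∑ i, (unitOutput σ γ₁ (x l) (p'.unit i) -
            unitOutput σ γ₁ (x l) (p.unit i) -
            fderiv ℝ (unitOutput σ γ₁ (x l)) (p.unit i) (p'.unit i - p.unit i))|
        ≤ 1 / (N : ℝ) ^ γ₂ * (N * (KK₂ * (DD * ((N : ℝ) ^ (γ₂ - 2) * |r|)) ^ 2)) := by
          refine mul_le_mul_of_nonneg_left ?_ (by positivity)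
          refine abs_sum_le_card_mul fun i => ?_
          refine (hK₂ l _ (mem_closedBall_zero_iff.2 (hp i)) _
            (mem_closedBall_zero_iff.2 (hpR i))).trans ?_
          exact mul_le_mul (hKK₂ l) (pow_le_pow_left₀ (norm_nonneg _) (hΔ i) 2)
            (by positivity) hKK₂0
      _ = (KK₂ * DD ^ 2) * (1 / (N : ℝ) ^ γ₂ * (N * ((N : ℝ) ^ (γ₂ - 2)) ^ 2)) * |r| ^ 2 := by
          ring
      _ = (KK₂ * DD ^ 2) * (N : ℝ) ^ (γ₂ - 3) * |r| ^ 2 := by rw [hpow2]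
      _ ≤ _ := by
          gcongr
          nlinarith [mul_nonneg hKK₁0 hDD0, mul_nonneg hKK₂0 (sq_nonneg DD)]

end TwoLayer

/-! ### Stability of the kernel under perturbation of the measure. -/

namespace TwoLayer

variable {d N₁ N M : ℕ} {σ : ℝ → ℝ} {γ₁ : ℝ}

/-- The indices of the functions `B¹`, `B²`, `B³` that enter the kernel on a data set. -/
abbrev KernelIndex (N₁ M : ℕ) : Type :=
  (Fin M × Fin M) ⊕ (Fin N₁ × Fin M × Fin M) ⊕ (Fin N₁ × Fin M)

/-- The functions `B¹`, `B²`, `B³` that enter the kernel on a data set. -/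
noncomputable def kernelTest (σ : ℝ → ℝ) (γ₁ : ℝ) (x : Fin M → EuclideanSpace ℝ (Fin d)) :
    KernelIndex N₁ M → Theta d N₁ → ℝ
  | .inl (l, m) => B1 σ γ₁ (x l) (x m)
  | .inr (.inl (j, l, m)) => B2 σ γ₁ j (x l) (x m)
  | .inr (.inr (j, l)) => B3 σ γ₁ j (x l)

theorem contDiff_kernelTest (hσ : ContDiff ℝ ((⊤ : ℕ∞) : WithTop ℕ∞) σ)
    (x : Fin M → EuclideanSpace ℝ (Fin d)) (i : KernelIndex N₁ M) :
    ContDiff ℝ ((⊤ : ℕ∞) : WithTop ℕ∞) (kernelTest σ γ₁ x i) := by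
  rcases i with ⟨l, m⟩ | ⟨j, l, m⟩ | ⟨j, l⟩
  · exact contDiff_B1 hσ _ _
  · exact contDiff_B2 hσ _ _ _
  · exact contDiff_B3 hσ _ _

theorem abs_average_le {N : ℕ} (hN : 0 < N) {f : Fin N → ℝ} {K : ℝ} (h : ∀ i, |f i| ≤ K) :
    |1 / (N : ℝ) * ∑ i, f i| ≤ K := by
  have hN' : (0 : ℝ) < N := Nat.cast_pos.2 hN
  rw [abs_mul, abs_of_pos (by positivity), one_div, inv_mul_le_iff₀ hN']
  exact abs_sum_le_card_mul h

/-- The kernel is a quadratic polynomial in finitely many integrals, so it suffices to control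
those. The factor 2K comes from ab - a'b' = (a - a')b + a'(b - b'). -/
theorem abs_kernelA_sub_le (hN₁ : 0 < N₁) (αC αW1 αW2 : ℝ)
    (x : Fin M → EuclideanSpace ℝ (Fin d)) {γ γ' : ProbabilityMeasure (Theta d N₁)} {δ K : ℝ}
    (hK : ∀ i, |∫ θ, kernelTest σ γ₁ x i θ ∂(γ : Measure (Theta d N₁))| ≤ K)
    (hK' : ∀ i, |∫ θ, kernelTest σ γ₁ x i θ ∂(γ' : Measure (Theta d N₁))| ≤ K)
    (hδ : ∀ i, |∫ θ, kernelTest σ γ₁ x i θ ∂(γ : Measure (Theta d N₁)) -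
      ∫ θ, kernelTest σ γ₁ x i θ ∂(γ' : Measure (Theta d N₁))| ≤ δ) (l m : Fin M) :
    |kernelA σ γ₁ αC αW1 αW2 γ (x l) (x m) - kernelA σ γ₁ αC αW1 αW2 γ' (x l) (x m)| ≤
      (|αC| + |αW2| + |αW1| * |inner ℝ (x l) (x m)| * (2 * K)) * δ := by
  have hd1 := hδ (.inl (l, m))
  have hd2 := fun j => hδ (.inr (.inl (j, l, m)))
  have hd3 := fun j l => hδ (.inr (.inr (j, l)))
  have hb3 := fun j l => hK (.inr (.inr (j, l)))
  have hb3' := fun j l => hK' (.inr (.inr (j, l)))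
  simp only [kernelTest] at hd1 hd2 hd3 hb3 hb3'
  unfold kernelA
  rw [add_sub_add_comm, ← mul_sub, ← mul_sub, ← Finset.sum_sub_distrib, add_assoc, add_mul]
  refine (abs_add_le _ _).trans (add_le_add ?_ (abs_average_le hN₁ fun j => ?_))
  · rw [abs_mul]
    exact mul_le_mul_of_nonneg_left hd1 (abs_nonneg _)
  · specialize hd2 j
    set a := ∫ θ, B3 σ γ₁ j (x l) θ ∂(γ : Measure (Theta d N₁))
    set b := ∫ θ, B3 σ γ₁ j (x m) θ ∂(γ : Measure (Theta d N₁))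
    set a' := ∫ θ, B3 σ γ₁ j (x l) θ ∂(γ' : Measure (Theta d N₁))
    set b' := ∫ θ, B3 σ γ₁ j (x m) θ ∂(γ' : Measure (Theta d N₁))
    have hab : |a * b - a' * b'| ≤ 2 * K * δ := by
      have e : a * b - a' * b' = (a - a') * b + a' * (b - b') := by ring
      rw [e]
      refine (abs_add_le _ _).trans ?_
      rw [abs_mul, abs_mul]
      have h1 := mul_le_mul (hd3 j l) (hb3 j m) (abs_nonneg _) ((abs_nonneg _).trans (hd3 j l))
      have h2 := mul_le_mul (hb3' j l) (hd3 j m) (abs_nonneg _) ((abs_nonneg _).trans (hb3' j l))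
      linarith
    rw [add_sub_add_comm, ← mul_sub, mul_assoc _ a b, mul_assoc _ a' b', ← mul_sub]
    refine (abs_add_le _ _).trans ?_
    rw [abs_mul, abs_mul, abs_mul, add_mul, mul_assoc (|αW1| * _)]
    exact add_le_add (mul_le_mul_of_nonneg_left hd2 (abs_nonneg _))
      (mul_le_mul_of_nonneg_left hab (by positivity))

theorem kernelTest_bounds (hσ : ContDiff ℝ ((⊤ : ℕ∞) : WithTop ℕ∞) σ)
    (x : Fin M → EuclideanSpace ℝ (Fin d)) (R : ℝ) :
    ∃ K : ℝ, 0 ≤ K ∧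
      (∀ i : KernelIndex N₁ M, ∀ θ, ‖θ‖ ≤ R → |kernelTest σ γ₁ x i θ| ≤ K) ∧
      ∀ i : KernelIndex N₁ M, ∀ θ θ', ‖θ‖ ≤ R → ‖θ'‖ ≤ R →
        |kernelTest σ γ₁ x i θ - kernelTest σ γ₁ x i θ'| ≤ K * ‖θ - θ'‖ := by
  choose K₁ hK₁0 hK₁ using fun i : KernelIndex N₁ M =>
    (contDiff_kernelTest (γ₁ := γ₁) hσ x i).continuous.exists_bound_closedBall R
  choose K₂ hK₂0 hK₂ using fun i : KernelIndex N₁ M =>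
    ((contDiff_kernelTest (γ₁ := γ₁) hσ x i).of_le (by exact_mod_cast le_top) :
      ContDiff ℝ 1 _).exists_lipschitz_closedBall R
  have h1 := fun i => Finset.single_le_sum (fun j _ => hK₁0 j) (Finset.mem_univ i)
  have h2 := fun i => Finset.single_le_sum (fun j _ => hK₂0 j) (Finset.mem_univ i)
  have h10 := Finset.sum_nonneg fun i (_ : i ∈ Finset.univ) => hK₁0 i
  have h20 := Finset.sum_nonneg fun i (_ : i ∈ Finset.univ) => hK₂0 i
  refine ⟨∑ i, K₁ i + ∑ i, K₂ i, by positivity, fun i θ hθ => ?_, fun i θ θ' hθ hθ' => ?_⟩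
  · have := hK₁ i θ (mem_closedBall_zero_iff.2 hθ)
    rw [Real.norm_eq_abs] at this
    linarith [h1 i]
  · have := hK₂ i θ (mem_closedBall_zero_iff.2 hθ) θ' (mem_closedBall_zero_iff.2 hθ')
    rw [Real.norm_eq_abs] at this
    exact this.trans (mul_le_mul_of_nonneg_right (by linarith [h2 i]) (norm_nonneg _))

/-- Applied to the parameters at step k and at step 0, this freezes the kernel during training; K
depends on the ball but not on N. -/
theorem abs_kernelA_empirical_sub_le (hσ : ContDiff ℝ ((⊤ : ℕ∞) : WithTop ℕ∞) σ) (hN₁ : 0 < N₁)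
    (αC αW1 αW2 : ℝ) (x : Fin M → EuclideanSpace ℝ (Fin d)) (R : ℝ) :
    ∃ K : ℝ, 0 ≤ K ∧ ∀ (N : ℕ) [NeZero N] (p p' : Params d N₁ N) (ρ : ℝ),
      (∀ i, ‖p.unit i‖ ≤ R) → (∀ i, ‖p'.unit i‖ ≤ R) → (∀ i, ‖p.unit i - p'.unit i‖ ≤ ρ) →
      ∀ l m, |kernelA σ γ₁ αC αW1 αW2 p.empirical (x l) (x m) -
        kernelA σ γ₁ αC αW1 αW2 p'.empirical (x l) (x m)| ≤ K * ρ := by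
  obtain ⟨K, hK0, hKb, hKl⟩ := kernelTest_bounds (N₁ := N₁) (γ₁ := γ₁) hσ x R
  refine ⟨∑ l : Fin M, ∑ m : Fin M,
    (|αC| + |αW2| + |αW1| * |inner ℝ (x l) (x m)| * (2 * K)) * K, by positivity, ?_⟩
  intro N _ p p' ρ hp hp' hρ l m
  have hρ0 : 0 ≤ ρ := (norm_nonneg _).trans (hρ ⟨0, NeZero.pos N⟩)
  have := abs_kernelA_sub_le (σ := σ) (γ₁ := γ₁) hN₁ αC αW1 αW2 x (γ := p.empirical)
    (γ' := p'.empirical) (K := K) (δ := K * ρ)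
    (fun i => by
      rw [integral_empirical]
      exact abs_average_le (NeZero.pos N) fun k => hKb i _ (hp k))
    (fun i => by
      rw [integral_empirical]
      exact abs_average_le (NeZero.pos N) fun k => hKb i _ (hp' k))
    (fun i => by
      rw [integral_empirical, integral_empirical, ← mul_sub, ← Finset.sum_sub_distrib]
      exact abs_average_le (NeZero.pos N) fun k => (hKl i _ _ (hp k) (hp' k)).trans
        (mul_le_mul_of_nonneg_left (hρ k) hK0)) l m
  refine this.trans ?_
  rw [← mul_assoc]
  refine mul_le_mul_of_nonneg_right ?_ hρ0
  refine le_trans ?_ (Finset.single_le_sum (f := fun l => ∑ m : Fin M,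
    (|αC| + |αW2| + |αW1| * |inner ℝ (x l) (x m)| * (2 * K)) * K)
    (fun l _ => by positivity) (Finset.mem_univ l))
  exact Finset.single_le_sum (f := fun m : Fin M =>
    (|αC| + |αW2| + |αW1| * |inner ℝ (x l) (x m)| * (2 * K)) * K)
    (fun l _ => by positivity) (Finset.mem_univ m)

end TwoLayer

/-! ### The limiting linear evolution -/

section LinearEvolution

variable {M : ℕ}

/-- The operator `v ↦ (1/M) A v`. -/
noncomputable def averageOperator (A : Matrix (Fin M) (Fin M) ℝ) :
    (Fin M → ℝ) →L[ℝ] (Fin M → ℝ) :=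
  (1 / (M : ℝ)) • LinearMap.toContinuousLinearMap (Matrix.toLin' A)

theorem averageOperator_apply (A : Matrix (Fin M) (Fin M) ℝ) (v : Fin M → ℝ) (l : Fin M) :
    averageOperator A v l = 1 / (M : ℝ) * ∑ m, A l m * v m := by
  simp [averageOperator, Matrix.mulVec, dotProduct]

theorem continuous_averageOperator :
    Continuous (averageOperator : Matrix (Fin M) (Fin M) ℝ → _) := by
  have : Continuous ((LinearMap.toContinuousLinearMap : ((Fin M → ℝ) →ₗ[ℝ] (Fin M → ℝ)) ≃ₗ[ℝ]
      ((Fin M → ℝ) →L[ℝ] (Fin M → ℝ))).toLinearMap ∘ₗ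
      (Matrix.toLin' : Matrix (Fin M) (Fin M) ℝ ≃ₗ[ℝ] _).toLinearMap) :=
    LinearMap.continuous_of_finiteDimensional _
  exact this.const_smul (1 / (M : ℝ))

theorem norm_averageOperator_apply_le (hM : 0 < M) {A : Matrix (Fin M) (Fin M) ℝ} {K : ℝ}
    (hA : ∀ l m, |A l m| ≤ K) (v : Fin M → ℝ) : ‖averageOperator A v‖ ≤ K * ‖v‖ := by
  have hK : 0 ≤ K := (abs_nonneg _).trans (hA ⟨0, hM⟩ ⟨0, hM⟩)
  refine (pi_norm_le_iff_of_nonneg (by positivity)).2 fun l => ?_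
  rw [averageOperator_apply]
  refine TwoLayer.abs_average_le hM fun m => ?_
  rw [abs_mul]
  exact mul_le_mul (hA l m) (norm_le_pi_norm v m) (abs_nonneg _) hK

/-- The solution of `h' = (1/M) A (y - h)`, `h(0) = 0`. -/
noncomputable def evolution (A : Matrix (Fin M) (Fin M) ℝ) (y : Fin M → ℝ) (t : ℝ) : Fin M → ℝ :=
  y - NormedSpace.exp (t • (-averageOperator A)) y

theorem evolution_zero (A : Matrix (Fin M) (Fin M) ℝ) (y : Fin M → ℝ) : evolution A y 0 = 0 := by
  simp [evolution]

theorem hasDerivAt_evolution (A : Matrix (Fin M) (Fin M) ℝ) (y : Fin M → ℝ) (t : ℝ) :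
    HasDerivAt (evolution A y) (averageOperator A (y - evolution A y t)) t := by
  have h := ((hasDerivAt_exp_smul_const' (𝕂 := ℝ) (-averageOperator A) t).clm_apply
    (hasDerivAt_const t y)).const_sub y
  have e : averageOperator A (y - evolution A y t) =
      -((-averageOperator A * NormedSpace.exp (t • (-averageOperator A))) y +
        NormedSpace.exp (t • (-averageOperator A)) 0) := by
    simp [evolution]
  rw [e]
  exact h

theorem continuous_evolution (A : Matrix (Fin M) (Fin M) ℝ) (y : Fin M → ℝ) :
    Continuous (evolution A y) :=
  continuous_iff_continuousAt.2 fun t => (hasDerivAt_evolution A y t).continuousAt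

/-- Needed because the limiting kernel is random: it makes the limit output a measurable function of
the first layer. -/
theorem continuous_evolution_left (y : Fin M → ℝ) (t : ℝ) :
    Continuous fun A : Matrix (Fin M) (Fin M) ℝ => evolution A y t := by
  unfold evolution
  let : NormedAlgebra ℚ ((Fin M → ℝ) →L[ℝ] (Fin M → ℝ)) := NormedAlgebra.restrictScalars ℚ ℝ _
  have h : Continuous fun A : Matrix (Fin M) (Fin M) ℝ =>
      NormedSpace.exp (t • (-averageOperator A)) :=
    (NormedSpace.exp_continuous (𝔸 := (Fin M → ℝ) →L[ℝ] (Fin M → ℝ))).comp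
      (continuous_averageOperator.neg.const_smul t)
  exact continuous_const.sub (h.clm_apply continuous_const)

/-- The residual r = y - h solves r' = -(1/M) A r with r(0) = y, so Gronwall applies without a
forcing term. -/
theorem norm_sub_evolution_le (hM : 0 < M) {A : Matrix (Fin M) (Fin M) ℝ} {K : ℝ}
    (hA : ∀ l m, |A l m| ≤ K) (y : Fin M → ℝ) {T t : ℝ} (ht : t ∈ Icc 0 T) :
    ‖y - evolution A y t‖ ≤ ‖y‖ * Real.exp (K * T) := by
  have hK : 0 ≤ K := (abs_nonneg _).trans (hA ⟨0, hM⟩ ⟨0, hM⟩)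
  have hd : ∀ s, HasDerivAt (fun s => y - evolution A y s)
      (-averageOperator A (y - evolution A y s)) s := fun s =>
    (hasDerivAt_evolution A y s).const_sub y
  have := norm_le_gronwallBound_of_norm_deriv_right_le (f := fun s => y - evolution A y s)
    (f' := fun s => -averageOperator A (y - evolution A y s)) (δ := ‖y‖) (K := K) (ε := 0)
    (a := 0) (b := T) (fun s _ => (hd s).continuousAt.continuousWithinAt)
    (fun s _ => (hd s).hasDerivWithinAt) (by simp [evolution_zero])
    (fun s _ => by
      rw [norm_neg, add_zero]
      exact norm_averageOperator_apply_le hM hA _) t ht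
  rw [gronwallBound_ε0, sub_zero] at this
  refine this.trans ?_
  gcongr
  exact ht.2

theorem norm_evolution_sub_le (hM : 0 < M) {A : Matrix (Fin M) (Fin M) ℝ} {K : ℝ}
    (hA : ∀ l m, |A l m| ≤ K) (y : Fin M → ℝ) {T s t : ℝ} (hs : s ∈ Icc 0 T) (ht : t ∈ Icc 0 T) :
    ‖evolution A y t - evolution A y s‖ ≤ K * (‖y‖ * Real.exp (K * T)) * |t - s| := by
  have hK : 0 ≤ K := (abs_nonneg _).trans (hA ⟨0, hM⟩ ⟨0, hM⟩)
  exact (convex_Icc 0 T).norm_image_sub_le_of_norm_hasDerivWithin_le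
    (fun r _ => (hasDerivAt_evolution A y r).hasDerivWithinAt)
    (fun r hr => (norm_averageOperator_apply_le hM hA _).trans
      (mul_le_mul_of_nonneg_left (norm_sub_evolution_le hM hA y hr) hK)) hs ht

/-- Local truncation error of the Euler scheme: on [s, t] the velocity departs from its value at s
by at most K times the displacement of the solution. Subtracting the linear motion lets the mean
value inequality see only this departure. -/
theorem norm_evolution_euler_le (hM : 0 < M) {A : Matrix (Fin M) (Fin M) ℝ} {K : ℝ}
    (hA : ∀ l m, |A l m| ≤ K) (y : Fin M → ℝ) {T s t : ℝ} (hs : s ∈ Icc 0 T) (ht : t ∈ Icc 0 T)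
    (hst : s ≤ t) :
    ‖evolution A y t - evolution A y s - (t - s) • averageOperator A (y - evolution A y s)‖ ≤
      K * (K * (‖y‖ * Real.exp (K * T))) * (t - s) ^ 2 := by
  have hK : 0 ≤ K := (abs_nonneg _).trans (hA ⟨0, hM⟩ ⟨0, hM⟩)
  have h := (convex_Icc s t).norm_image_sub_le_of_norm_hasDerivWithin_le (x := s) (y := t)
    (f := fun r => evolution A y r - r • averageOperator A (y - evolution A y s))
    (f' := fun r => averageOperator A (y - evolution A y r) -
      (1 : ℝ) • averageOperator A (y - evolution A y s))
    (C := K * (K * (‖y‖ * Real.exp (K * T)) * (t - s)))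
    (fun r _ => ((hasDerivAt_evolution A y r).sub
      ((hasDerivAt_id r).smul_const _)).hasDerivWithinAt)
    (fun r hr => by
      rw [one_smul, ← map_sub, sub_sub_sub_cancel_left]
      refine (norm_averageOperator_apply_le hM hA _).trans (mul_le_mul_of_nonneg_left ?_ hK)
      have hr' : r ∈ Icc 0 T := ⟨hs.1.trans hr.1, hr.2.trans ht.2⟩
      refine (norm_evolution_sub_le hM hA y hr' hs).trans
        (mul_le_mul_of_nonneg_left ?_ (by positivity))
      rw [abs_sub_comm, abs_of_nonneg (sub_nonneg.2 hr.1)]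
      linarith [hr.2])
    (left_mem_Icc.2 hst) (right_mem_Icc.2 hst)
  rw [Real.norm_of_nonneg (sub_nonneg.2 hst)] at h
  convert h using 1
  · congr 1
    rw [sub_smul]
    abel
  · ring

end LinearEvolution

/-! ### Discrete Gronwall inequality and comparison of a noisy Euler scheme with its limit. -/

section DiscreteComparison

/-- Summation by parts for a sum of small partial sums against a slowly varying sequence. -/
theorem abs_sum_mul_le_of_partial_sums {ξ φ : ℕ → ℝ} {n : ℕ} {s b c : ℝ}
    (hs : ∀ k ≤ n, |∑ i ∈ Finset.range k, ξ i| ≤ s) (hb : |φ n| ≤ b)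
    (hc : ∀ k < n, |φ (k + 1) - φ k| ≤ c) :
    |∑ k ∈ Finset.range n, ξ k * φ k| ≤ s * (b + n * c) := by
  -- Abel's identity: the differences fall on φ, which varies slowly.
  have hid : ∀ n, ∑ k ∈ Finset.range n, ξ k * φ k = (∑ i ∈ Finset.range n, ξ i) * φ n -
      ∑ k ∈ Finset.range n, (∑ i ∈ Finset.range (k + 1), ξ i) * (φ (k + 1) - φ k) := by
    intro n
    induction n with
    | zero => simp
    | succ n ih =>
      rw [Finset.sum_range_succ, ih, Finset.sum_range_succ (fun k =>
        (∑ i ∈ Finset.range (k + 1), ξ i) * (φ (k + 1) - φ k)), Finset.sum_range_succ ξ n]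
      ring
  have hs0 : 0 ≤ s := (abs_nonneg _).trans (hs 0 (Nat.zero_le _))
  rw [hid]
  refine (abs_sub _ _).trans ?_
  rw [mul_add]
  refine add_le_add ?_ ?_
  · rw [abs_mul]
    exact mul_le_mul (hs n le_rfl) hb (abs_nonneg _) hs0
  · refine (Finset.abs_sum_le_sum_abs _ _).trans
      ((Finset.sum_le_card_nsmul _ _ (s * c) fun k hk => ?_).trans ?_)
    · rw [abs_mul]
      exact mul_le_mul (hs _ (Finset.mem_range.1 hk)) (hc k (Finset.mem_range.1 hk))
        (abs_nonneg _) hs0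
    · rw [Finset.card_range, nsmul_eq_mul]
      exact le_of_eq (by ring)

/-- Discrete Gronwall: the right-hand side of the hypothesis grows by a factor of at most 1 + β ≤
exp β per step. -/
theorem le_mul_exp_of_le_add_sum {a : ℕ → ℝ} {c β : ℝ} {n₀ : ℕ} (hc : 0 ≤ c) (hβ : 0 ≤ β)
    (h : ∀ n ≤ n₀, a n ≤ c + β * ∑ k ∈ Finset.range n, a k) {n : ℕ} (hn : n ≤ n₀) :
    a n ≤ c * Real.exp (β * n) := by
  have hS : ∀ n ≤ n₀, c + β * ∑ k ∈ Finset.range n, a k ≤ c * (1 + β) ^ n := by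
    intro n
    induction n with
    | zero => simp
    | succ n ih =>
      intro hn
      have h1 := ih (by omega)
      have h2 := h n (by omega)
      rw [Finset.sum_range_succ, pow_succ]
      nlinarith [mul_le_mul_of_nonneg_left (h2.trans h1) hβ]
  refine (h n hn).trans ((hS n hn).trans ?_)
  rw [mul_comm β, Real.exp_nat_mul]
  gcongr
  linarith [Real.add_one_le_exp β]

variable {M : ℕ}

/-- A slowly varying noisy Euler scheme for the linear evolution, whose weights average out,
stays close to the solution. -/
theorem norm_sub_evolution_le_of_noisy_euler (hM : 0 < M) {A : Matrix (Fin M) (Fin M) ℝ}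
    (y : Fin M → ℝ) {T K H K' δ η : ℝ} {N : ℕ} (hN : 0 < N) {h : ℕ → Fin M → ℝ}
    {w : ℕ → Fin M → ℝ} {n₀ : ℕ} (hη : 0 ≤ η) (hK' : 0 ≤ K') (hn₀ : (n₀ : ℝ) / N ≤ T)
    (hA : ∀ l m, |A l m| ≤ K)
    (hstep : ∀ k < n₀, ∀ l, |h (k + 1) l - h k l -
      1 / N * ∑ m, w k m * ((y m - h k m) * A l m)| ≤ η / N)
    (hH : ∀ k ≤ n₀, ‖h k‖ ≤ H) (hslow : ∀ k < n₀, ‖h (k + 1) - h k‖ ≤ K' / N)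
    (hw : ∀ n ≤ n₀, ∀ m, |∑ k ∈ Finset.range n, (w k m - 1 / M)| ≤ δ * N)
    (h0 : ‖h 0‖ ≤ δ) {n : ℕ} (hn : n ≤ n₀) :
    ‖h n - evolution A y (n / N)‖ ≤ (δ + M * (δ * ((‖y‖ + H) * K + T * (K' * K))) + T * η +
      T * (K * (K * (‖y‖ * Real.exp (K * T)))) / N) * Real.exp (K * T) := by
  have hN' : (0 : ℝ) < N := Nat.cast_pos.2 hN
  have hK : 0 ≤ K := (abs_nonneg _).trans (hA ⟨0, hM⟩ ⟨0, hM⟩)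
  have hH0 : 0 ≤ H := (norm_nonneg _).trans (hH 0 (Nat.zero_le _))
  have hδ : 0 ≤ δ := (norm_nonneg _).trans h0
  have hT : 0 ≤ T := le_trans (by positivity) hn₀
  have htime : ∀ k ≤ n₀, (k : ℝ) / N ∈ Icc 0 T := fun k hk =>
    ⟨by positivity, le_trans (by gcongr) hn₀⟩
  have hcount : ∀ k ≤ n₀, ∀ z : ℝ, 0 ≤ z → k * (z / N) ≤ T * z := fun k hk z hz => by
    have := mul_le_mul_of_nonneg_right (htime k hk).2 hz
    calc (k : ℝ) * (z / N) = k / N * z := by ring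
      _ ≤ T * z := this
  set E := K * (K * (‖y‖ * Real.exp (K * T))) with hE
  have hE0 : 0 ≤ E := by positivity
  set D : ℕ → Fin M → ℝ := fun k => h k - evolution A y (k / N) with hD
  -- The noise accumulated by replacing the mean weight 1/M with the actual weights. The error minus
  -- this noise obeys a noiseless recursion.
  set ν : ℕ → Fin M → ℝ := fun n l =>
    1 / N * ∑ m, ∑ k ∈ Finset.range n, (w k m - 1 / M) * ((y m - h k m) * A l m) with hν
  -- Summation by parts: the partial sums of the weights are at most δN, while the residuals times A
  -- change by at most K'K/N per step.
  have hνb : ∀ n ≤ n₀, ‖ν n‖ ≤ M * (δ * ((‖y‖ + H) * K + T * (K' * K))) := by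
    intro n hn
    refine (pi_norm_le_iff_of_nonneg (by positivity)).2 fun l => ?_
    rw [hν, Real.norm_eq_abs, abs_mul, abs_of_pos (by positivity), one_div,
      inv_mul_le_iff₀ hN']
    refine (abs_sum_le_card_mul (K := δ * N * ((‖y‖ + H) * K + n * (K' * K / N)))
      fun m => ?_).trans ?_
    · refine abs_sum_mul_le_of_partial_sums (fun k hk => hw k (hk.trans hn) m) ?_ fun k hk => ?_
      · rw [abs_mul]
        refine mul_le_mul ?_ (hA l m) (abs_nonneg _) (by positivity)
        exact (abs_sub _ _).trans (add_le_add (norm_le_pi_norm y m)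
          ((norm_le_pi_norm (h n) m).trans (hH n hn)))
      · rw [← sub_mul, abs_mul, sub_sub_sub_cancel_left, mul_div_right_comm]
        refine mul_le_mul ?_ (hA l m) (abs_nonneg _) (by positivity)
        rw [abs_sub_comm]
        exact (norm_le_pi_norm (h (k + 1) - h k) m).trans (hslow k (hk.trans_le hn))
    · have := hcount n hn (K' * K) (by positivity)
      calc (M : ℝ) * (δ * N * ((‖y‖ + H) * K + n * (K' * K / N)))
          ≤ M * (δ * N * ((‖y‖ + H) * K + T * (K' * K))) := by gcongr
        _ = _ := by ring
  -- Only the defect η/N of the scheme and the Euler truncation error E/N² of the solution remain.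
  have hone : ∀ k < n₀, ‖(D (k + 1) - ν (k + 1)) - (D k - ν k) +
      (1 / (N : ℝ)) • averageOperator A (D k)‖ ≤ η / N + E * (1 / N) ^ 2 := by
    intro k hk
    have hcast : ((k + 1 : ℕ) : ℝ) / N - k / N = 1 / N := by push_cast; ring
    have hev := norm_evolution_euler_le hM hA y (htime k hk.le) (htime (k + 1) hk)
      (by gcongr; omega)
    rw [hcast] at hev
    refine (pi_norm_le_iff_of_nonneg (by positivity)).2 fun l => ?_
    have hev' := (norm_le_pi_norm _ l).trans hev
    have hν' : ν (k + 1) l - ν k l =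
        1 / N * ∑ m, (w k m - 1 / M) * ((y m - h k m) * A l m) := by
      simp only [hν, Finset.sum_range_succ, Finset.sum_add_distrib]
      ring
    have hw' : ∑ m, (w k m - 1 / M) * ((y m - h k m) * A l m) =
        ∑ m, w k m * ((y m - h k m) * A l m) - averageOperator A (y - h k) l := by
      rw [averageOperator_apply, Finset.mul_sum, ← Finset.sum_sub_distrib]
      refine Finset.sum_congr rfl fun m _ => ?_
      rw [Pi.sub_apply]
      ring
    have hlin : averageOperator A (D k) l =
        averageOperator A (y - evolution A y (k / N)) l - averageOperator A (y - h k) l := by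
      rw [← Pi.sub_apply, ← map_sub, sub_sub_sub_cancel_left]
    have key : ((D (k + 1) - ν (k + 1)) - (D k - ν k) +
        (1 / (N : ℝ)) • averageOperator A (D k)) l =
        (h (k + 1) l - h k l - 1 / N * ∑ m, w k m * ((y m - h k m) * A l m)) -
        (evolution A y ((k + 1 : ℕ) / N) - evolution A y (k / N) -
          (1 / (N : ℝ)) • averageOperator A (y - evolution A y (k / N))) l := by
      simp only [Pi.add_apply, Pi.sub_apply, Pi.smul_apply, smul_eq_mul, hlin]
      have hDk : ∀ k, D k l = h k l - evolution A y (k / N) l := fun k => rfl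
      rw [hDk, hDk]
      rw [hw'] at hν'
      linear_combination (-1 : ℝ) * hν'
    rw [key]
    exact (norm_sub_le _ _).trans (add_le_add (hstep k hk l) hev')
  have hsum : ∀ n ≤ n₀, ‖D n - ν n‖ ≤ ‖h 0‖ + n * (η / N + E * (1 / N) ^ 2) +
      K / N * ∑ k ∈ Finset.range n, ‖D k‖ := by
    intro n
    induction n with
    | zero =>
      intro _
      simp [hD, hν, evolution_zero, ← Pi.zero_def]
    | succ k ih =>
      intro hk
      have e : D (k + 1) - ν (k + 1) = (D k - ν k) - (1 / (N : ℝ)) • averageOperator A (D k) +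
          ((D (k + 1) - ν (k + 1)) - (D k - ν k) +
            (1 / (N : ℝ)) • averageOperator A (D k)) := by abel
      have hop : ‖(1 / (N : ℝ)) • averageOperator A (D k)‖ ≤ K / N * ‖D k‖ := by
        rw [norm_smul, Real.norm_of_nonneg (by positivity)]
        calc 1 / (N : ℝ) * ‖averageOperator A (D k)‖ ≤ 1 / (N : ℝ) * (K * ‖D k‖) := by
              gcongr
              exact norm_averageOperator_apply_le hM hA _
          _ = _ := by ring
      rw [e, Finset.sum_range_succ]
      have h1 := norm_add_le ((D k - ν k) - (1 / (N : ℝ)) • averageOperator A (D k))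
        ((D (k + 1) - ν (k + 1)) - (D k - ν k) + (1 / (N : ℝ)) • averageOperator A (D k))
      have h2 := norm_sub_le (D k - ν k) ((1 / (N : ℝ)) • averageOperator A (D k))
      have h3 := hone k (by omega)
      have h4 := ih (by omega)
      push_cast
      linarith
  -- Adding the noise back gives an inequality in the form required by the discrete Gronwall lemma.
  have hfinal : ∀ n ≤ n₀, ‖D n‖ ≤ (δ + M * (δ * ((‖y‖ + H) * K + T * (K' * K))) + T * η +
      T * E / N) + K / N * ∑ k ∈ Finset.range n, ‖D k‖ := by
    intro n hn
    have h1 := hsum n hn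
    have h2 := hνb n hn
    have h3 : ‖D n‖ ≤ ‖D n - ν n‖ + ‖ν n‖ := by
      simpa using norm_add_le (D n - ν n) (ν n)
    have h4 : (n : ℝ) * (η / N + E * (1 / N) ^ 2) ≤ T * η + T * E / N := by
      have := hcount n hn η hη
      have h5 := hcount n hn (E / N) (by positivity)
      calc (n : ℝ) * (η / N + E * (1 / N) ^ 2) = n * (η / N) + n * (E / N / N) := by ring
        _ ≤ T * η + T * (E / N) := add_le_add this h5
        _ = _ := by ring
    linarith
  refine (le_mul_exp_of_le_add_sum (by positivity) (by positivity) hfinal hn).trans ?_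
  refine mul_le_mul_of_nonneg_left (Real.exp_le_exp.2 ?_) (by positivity)
  calc K / N * n = K * (n / N) := by ring
    _ ≤ K * T := by gcongr; exact (htime n hn).2

end DiscreteComparison

/-! ### Deterministic control of the whole training. -/

namespace TwoLayer

variable {d N₁ N M : ℕ} {σ : ℝ → ℝ} {γ₁ : ℝ}

theorem tendsto_natCast_rpow_sub_one {γ : ℝ} (hγ : γ < 1) :
    Tendsto (fun N : ℕ => (N : ℝ) ^ (γ - 1)) atTop (𝓝 0) := by
  have h := (tendsto_rpow_neg_atTop (show 0 < 1 - γ by linarith)).comp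
    (tendsto_natCast_atTop_atTop (R := ℝ))
  simpa [Function.comp_def] using h

theorem abs_kernelA_empirical_le (hσ : ContDiff ℝ ((⊤ : ℕ∞) : WithTop ℕ∞) σ) (hN₁ : 0 < N₁)
    (αC αW1 αW2 : ℝ) (x : Fin M → EuclideanSpace ℝ (Fin d)) (R : ℝ) :
    ∃ K : ℝ, 0 ≤ K ∧ ∀ (N : ℕ) [NeZero N] (p : Params d N₁ N), (∀ i, ‖p.unit i‖ ≤ R) →
      ∀ l m, |kernelA σ γ₁ αC αW1 αW2 p.empirical (x l) (x m)| ≤ K := by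
  obtain ⟨K, hK0, hKb, -⟩ := kernelTest_bounds (N₁ := N₁) (γ₁ := γ₁) hσ x R
  set c : Fin M → Fin M → ℝ := fun l m =>
    |αC| * K + (|αW2| * K + |αW1| * |inner ℝ (x l) (x m)| * K * K) with hc
  have hc0 : ∀ l m, 0 ≤ c l m := fun l m => by positivity
  refine ⟨∑ l, ∑ m, c l m, Finset.sum_nonneg fun l _ => Finset.sum_nonneg fun m _ => hc0 l m, ?_⟩
  intro N _ p hp l m
  have hb : ∀ i, |∫ θ, kernelTest σ γ₁ x i θ ∂(p.empirical : Measure (Theta d N₁))| ≤ K := by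
    intro i
    rw [integral_empirical]
    exact abs_average_le (NeZero.pos N) fun k => hKb i _ (hp k)
  have h1 := hb (.inl (l, m))
  have h2 := fun j => hb (.inr (.inl (j, l, m)))
  have h3 := fun j l => hb (.inr (.inr (j, l)))
  simp only [kernelTest] at h1 h2 h3
  have : |kernelA σ γ₁ αC αW1 αW2 p.empirical (x l) (x m)| ≤
      |αC| * K + (|αW2| * K + |αW1| * |inner ℝ (x l) (x m)| * K * K) := by
    unfold kernelA
    refine (abs_add_le _ _).trans (add_le_add ?_ (abs_average_le hN₁ fun j => ?_))
    · rw [abs_mul]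
      exact mul_le_mul_of_nonneg_left h1 (abs_nonneg _)
    · refine (abs_add_le _ _).trans (add_le_add ?_ ?_)
      · rw [abs_mul]
        exact mul_le_mul_of_nonneg_left (h2 j) (abs_nonneg _)
      · have ha := h3 j l
        have hb := h3 j m
        generalize ∫ θ, B3 σ γ₁ j (x l) θ ∂(p.empirical : Measure (Theta d N₁)) = a at ha ⊢
        generalize ∫ θ, B3 σ γ₁ j (x m) θ ∂(p.empirical : Measure (Theta d N₁)) = b at hb ⊢
        rw [abs_mul, abs_mul, abs_mul]
        gcongr
  refine this.trans ?_
  exact (Finset.single_le_sum (fun m _ => hc0 l m) (Finset.mem_univ m)).trans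
    (Finset.single_le_sum (f := fun l => ∑ m, c l m)
      (fun l _ => Finset.sum_nonneg fun m _ => hc0 l m) (Finset.mem_univ l))

open Classical in
/-- The weights `w_m(q)` for which `φ(q) = ∑ m, w_m(q) φ(x^{(m)}, y^{(m)})` at every data
point `q`. -/
noncomputable def dataWeight (x : Fin M → EuclideanSpace ℝ (Fin d)) (y : Fin M → ℝ)
    (q : EuclideanSpace ℝ (Fin d) × ℝ) (m : Fin M) : ℝ :=
  if q = (x m, y m) then
    (1 : ℝ) / (Finset.univ.filter fun m' => (x m', y m') = (x m, y m)).card else 0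

theorem dataWeight_nonneg (x : Fin M → EuclideanSpace ℝ (Fin d)) (y : Fin M → ℝ)
    (q : EuclideanSpace ℝ (Fin d) × ℝ) (m : Fin M) : 0 ≤ dataWeight x y q m := by
  unfold dataWeight
  split_ifs <;> positivity

/-- Data points may coincide, so a drawn point does not determine its index. Sharing the mass
equally among the indices of the same point still reproduces the value of φ there, and keeps the
mean weight of every index equal to 1/M. -/
theorem sum_dataWeight_mul (x : Fin M → EuclideanSpace ℝ (Fin d)) (y : Fin M → ℝ) (m₀ : Fin M)
    (φ : EuclideanSpace ℝ (Fin d) × ℝ → ℝ) :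
    ∑ m, dataWeight x y (x m₀, y m₀) m * φ (x m, y m) = φ (x m₀, y m₀) := by
  classical
  set S := Finset.univ.filter fun m' => (x m', y m') = (x m₀, y m₀) with hS
  have hterm : ∀ m, dataWeight x y (x m₀, y m₀) m * φ (x m, y m) =
      if m ∈ S then (1 : ℝ) / S.card * φ (x m₀, y m₀) else 0 := by
    intro m
    unfold dataWeight
    by_cases hm : (x m₀, y m₀) = (x m, y m)
    · have hmS : m ∈ S := by
        rw [hS, Finset.mem_filter]
        exact ⟨Finset.mem_univ m, hm.symm⟩
      rw [if_pos hm, if_pos hmS, ← hm]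
    · have hmS : m ∉ S := by
        rw [hS, Finset.mem_filter]
        exact fun h => hm h.2.symm
      rw [if_neg hm, if_neg hmS, zero_mul]
  have hpos : (0 : ℝ) < S.card := by
    exact_mod_cast Finset.card_pos.2 ⟨m₀, by simp [hS]⟩
  rw [Finset.sum_congr rfl fun m _ => hterm m, Finset.sum_ite_mem, Finset.univ_inter,
    Finset.sum_const, nsmul_eq_mul]
  field_simp

/-- Along the whole training, the units stay in a fixed ball, the residuals stay bounded, and the
units move by at most `O(N^{γ₂ - 1})`. -/
theorem training_a_priori (hσ : ContDiff ℝ ((⊤ : ℕ∞) : WithTop ℕ∞) σ) (hN₁ : 0 < N₁)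
    {γ₂ : ℝ} (hγ₂ : γ₂ < 1) (αC αW1 αW2 : ℝ) (x : Fin M → EuclideanSpace ℝ (Fin d))
    (y : Fin M → ℝ) (R T : ℝ) :
    ∃ K U : ℝ, 0 ≤ K ∧ 0 ≤ U ∧ ∀ᶠ N : ℕ in atTop, ∀ [NeZero N] (p₀ : Params d N₁ N)
      (q : ℕ → EuclideanSpace ℝ (Fin d) × ℝ) (h : ℕ → Fin M → ℝ),
      (∀ k m, h k m = (Params.sgd σ γ₁ γ₂ αC αW1 αW2 p₀ q k).output σ γ₁ γ₂ (x m)) →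
      (∀ i, ‖p₀.unit i‖ ≤ R) → (∀ k, ∃ m, q k = (x m, y m)) → ‖h 0‖ ≤ 1 →
      (∀ n : ℕ, (n : ℝ) / N ≤ T → ‖y‖ + ‖h n‖ ≤ U ∧
        ∀ i, ‖(Params.sgd σ γ₁ γ₂ αC αW1 αW2 p₀ q n).unit i‖ ≤ R + 1 ∧
          ‖(Params.sgd σ γ₁ γ₂ αC αW1 αW2 p₀ q n).unit i - p₀.unit i‖ ≤
            K * (N : ℝ) ^ (γ₂ - 1)) := by
  obtain ⟨K, hK0, hK⟩ := trainStep_estimates (γ₁ := γ₁) hσ hN₁ γ₂ αC αW1 αW2 x (R + 1)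
  -- Per step, ‖y‖ + ‖h‖ grows by a factor of at most 1 + K/N; over NT steps this compounds to at
  -- most exp(KT).
  set U := (‖y‖ + 1) * Real.exp (K * T) with hU
  have hU0 : 0 ≤ U := by positivity
  -- Once the total displacement is below 1, units starting in the ball of radius R never leave the
  -- ball of radius R + 1 on which K was chosen.
  have hlim : Tendsto (fun N : ℕ => K * U * |T| * (N : ℝ) ^ (γ₂ - 1)) atTop (𝓝 0) := by
    simpa using (tendsto_natCast_rpow_sub_one hγ₂).const_mul (K * U * |T|)
  refine ⟨K * U * |T|, U, by positivity, hU0, ?_⟩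
  filter_upwards [hlim.eventually (gt_mem_nhds zero_lt_one)] with N hsmall
  intro _ p₀ q h hh hp₀ hq h0
  have hN' : (0 : ℝ) < N := Nat.cast_pos.2 (NeZero.pos N)
  set p := Params.sgd σ γ₁ γ₂ αC αW1 αW2 p₀ q with hp
  have hpow : (N : ℝ) ^ (γ₂ - 2) = (N : ℝ) ^ (γ₂ - 1) / N := by
    rw [← Real.rpow_sub_one hN'.ne']
    ring_nf
  have hexp : ∀ k : ℕ, (k : ℝ) / N ≤ T → (‖y‖ + 1) * (1 + K / N) ^ k ≤ U := fun k hk => by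
    rw [hU]
    gcongr
    calc (1 + K / N) ^ k ≤ Real.exp (K / N) ^ k := by
          gcongr
          linarith [Real.add_one_le_exp (K / N)]
      _ = Real.exp (K * (k / N)) := by rw [← Real.exp_nat_mul]; ring_nf
      _ ≤ _ := by gcongr
  have hmove : ∀ k : ℕ, (k : ℝ) / N ≤ T →
      k * (K * (N : ℝ) ^ (γ₂ - 2) * U) ≤ K * U * |T| * (N : ℝ) ^ (γ₂ - 1) := fun k hk => by
    rw [hpow]
    calc (k : ℝ) * (K * ((N : ℝ) ^ (γ₂ - 1) / N) * U) =
          K * U * (k / N) * (N : ℝ) ^ (γ₂ - 1) := by ring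
      _ ≤ K * U * |T| * (N : ℝ) ^ (γ₂ - 1) := by
          gcongr
          exact hk.trans (le_abs_self T)
  have hball : ∀ k : ℕ, (k : ℝ) / N ≤ T →
      (∀ i, ‖(p k).unit i - p₀.unit i‖ ≤ k * (K * (N : ℝ) ^ (γ₂ - 2) * U)) →
      ∀ i, ‖(p k).unit i‖ ≤ R + 1 := fun k hk hd i => by
    have h1 := norm_le_norm_add_norm_sub' ((p k).unit i) (p₀.unit i)
    have h2 := (hd i).trans (hmove k hk)
    linarith [hp₀ i]
  -- The two bounds are proved by a joint induction: the displacement needs bounded residuals, and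
  -- the residual estimate needs units in the ball. The displacement at step k + 1 must come first,
  -- since the output estimate also requires the updated units to lie in the ball.
  have main : ∀ n : ℕ, (n : ℝ) / N ≤ T → ‖y‖ + ‖h n‖ ≤ (‖y‖ + 1) * (1 + K / N) ^ n ∧
      ∀ i, ‖(p n).unit i - p₀.unit i‖ ≤ n * (K * (N : ℝ) ^ (γ₂ - 2) * U) := by
    intro n
    induction n with
    | zero =>
      intro _
      refine ⟨by simpa using h0, fun i => by simp [hp, Params.sgd]⟩
    | succ k ih =>
      intro hk
      have hk' : (k : ℝ) / N ≤ T := le_trans (by gcongr; simp) hk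
      obtain ⟨ih1, ih2⟩ := ih hk'
      obtain ⟨m, hm⟩ := hq k
      have hstep : p (k + 1) = (p k).trainStep σ γ₁ γ₂ αC αW1 αW2 (x m, y m) := by
        rw [← hm]; rfl
      have hres : |y m - (p k).output σ γ₁ γ₂ (x m)| ≤ ‖y‖ + ‖h k‖ := by
        rw [← hh k m]
        exact (abs_sub _ _).trans (add_le_add (norm_le_pi_norm y m) (norm_le_pi_norm (h k) m))
      obtain ⟨e1, e2⟩ := hK N (p k) m (y m) (hball k hk' ih2)
      rw [← hstep] at e1 e2
      have hd : ∀ i, ‖(p (k + 1)).unit i - p₀.unit i‖ ≤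
          (k + 1 : ℕ) * (K * (N : ℝ) ^ (γ₂ - 2) * U) := fun i => by
        have h1 := norm_sub_le_norm_sub_add_norm_sub ((p (k + 1)).unit i) ((p k).unit i)
          (p₀.unit i)
        have h2 : K * (N : ℝ) ^ (γ₂ - 2) * |y m - (p k).output σ γ₁ γ₂ (x m)| ≤
            K * (N : ℝ) ^ (γ₂ - 2) * U := by
          gcongr
          exact hres.trans (ih1.trans (hexp k hk'))
        have h3 := e1 i
        have h4 := ih2 i
        push_cast
        linarith
      refine ⟨?_, hd⟩
      have hh1 : ‖h (k + 1)‖ ≤ ‖h k‖ + K / N * (‖y‖ + ‖h k‖) := by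
        refine (pi_norm_le_iff_of_nonneg (by positivity)).2 fun l => ?_
        have h1 := (e2 (hball (k + 1) hk hd) l).1
        rw [← hh, ← hh] at h1
        have h2 := norm_le_norm_add_norm_sub' (h (k + 1) l) (h k l)
        have h3 : K / N * |y m - h k m| ≤ K / N * (‖y‖ + ‖h k‖) := by
          rw [← hh] at hres
          gcongr
        rw [Real.norm_eq_abs (h (k + 1) l - h k l)] at h2
        rw [← hh] at h1
        linarith [norm_le_pi_norm (h k) l]
      rw [pow_succ]
      have : 0 ≤ 1 + K / N := by positivity
      nlinarith [mul_le_mul_of_nonneg_right ih1 this]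
  intro n hn
  obtain ⟨h1, h2⟩ := main n hn
  exact ⟨h1.trans (hexp n hn), fun i => ⟨hball n hn h2 i, (h2 i).trans (hmove n hn)⟩⟩

/-- If the initial outputs are small, the initial kernel is close to `A`, and the data points are
visited with the right frequencies, then the trained network stays close to the limit. -/
theorem training_close_to_limit (hσ : ContDiff ℝ ((⊤ : ℕ∞) : WithTop ℕ∞) σ) (hN₁ : 0 < N₁)
    (hM : 0 < M) {γ₂ : ℝ} (hγ₂ : γ₂ < 1) (αC αW1 αW2 : ℝ)
    (x : Fin M → EuclideanSpace ℝ (Fin d)) (y : Fin M → ℝ) (R : ℝ) {T ε : ℝ} (hT : 0 ≤ T)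
    (hε : 0 < ε) :
    ∃ δ : ℝ, 0 < δ ∧ ∀ᶠ N : ℕ in atTop, ∀ [NeZero N] (p₀ : Params d N₁ N)
      (q : ℕ → EuclideanSpace ℝ (Fin d) × ℝ) (A : Matrix (Fin M) (Fin M) ℝ),
      (∀ i, ‖p₀.unit i‖ ≤ R) → (∀ k, ∃ m, q k = (x m, y m)) →
      (∀ m, |p₀.output σ γ₁ γ₂ (x m)| ≤ δ) →
      (∀ l m, |kernelA σ γ₁ αC αW1 αW2 p₀.empirical (x l) (x m) - A l m| ≤ δ) →
      (∀ n : ℕ, (n : ℝ) ≤ N * T → ∀ m,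
        |∑ k ∈ Finset.range n, (dataWeight x y (q k) m - 1 / M)| ≤ δ * N) →
      ∀ t ∈ Icc 0 T,
        (∀ i, ‖(Params.sgd σ γ₁ γ₂ αC αW1 αW2 p₀ q ⌊(N : ℝ) * t⌋₊).unit i - p₀.unit i‖ ≤ ε) ∧
        ∀ m, |(Params.sgd σ γ₁ γ₂ αC αW1 αW2 p₀ q ⌊(N : ℝ) * t⌋₊).output σ γ₁ γ₂ (x m) -
          evolution A y t m| ≤ ε := by
  obtain ⟨K₀, U, hK₀, hU, hprior⟩ := training_a_priori (γ₁ := γ₁) hσ hN₁ hγ₂ αC αW1 αW2 x y R T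
  obtain ⟨K₁, hK₁0, hK₁⟩ := trainStep_estimates (γ₁ := γ₁) hσ hN₁ γ₂ αC αW1 αW2 x (R + 1)
  obtain ⟨K₂, hK₂0, hK₂⟩ := abs_kernelA_empirical_sub_le (γ₁ := γ₁) hσ hN₁ αC αW1 αW2 x (R + 1)
  obtain ⟨K₃, hK₃0, hK₃⟩ := abs_kernelA_empirical_le (γ₁ := γ₁) hσ hN₁ αC αW1 αW2 x R
  -- A is within δ ≤ 1 of the initial kernel, whose entries are bounded by K₃.
  set K := K₃ + 1 with hK
  have hK0 : 0 ≤ K := by positivity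
  set X := Real.exp (K * T) with hX
  have hX0 : 0 ≤ X := (Real.exp_pos _).le
  -- The final error will be c₁δ + c₂N^(γ₂-1) + c₃/N. The last term of c₃ pays for replacing ⌊Nt⌋/N
  -- by t.
  set c₁ := (1 + M * ((‖y‖ + U) * K + T * (K₁ * U * K)) + T * U) * X with hc₁
  set c₂ := (T * (K₁ * U ^ 2 + U * (K₂ * K₀))) * X with hc₂
  set c₃ := T * (K * (K * (‖y‖ * X))) * X + K * (‖y‖ * X) with hc₃
  have hc₁0 : 0 ≤ c₁ := by positivity
  have hpow0 := tendsto_natCast_rpow_sub_one hγ₂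
  have hl1 : Tendsto (fun N : ℕ => K₀ * (N : ℝ) ^ (γ₂ - 1)) atTop (𝓝 0) := by
    simpa using hpow0.const_mul K₀
  have hl2 : Tendsto (fun N : ℕ => c₂ * (N : ℝ) ^ (γ₂ - 1)) atTop (𝓝 0) := by
    simpa using hpow0.const_mul c₂
  have hl3 : Tendsto (fun N : ℕ => c₃ / N) atTop (𝓝 0) := tendsto_const_div_atTop_nhds_zero_nat c₃
  -- The second entry makes c₁δ ≤ ε/3; the bound 1 supports the a priori estimate and the choice of
  -- K.
  refine ⟨min 1 (ε / (3 * (c₁ + 1))), by positivity, ?_⟩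
  filter_upwards [hprior, hl1.eventually (gt_mem_nhds hε),
    hl2.eventually (gt_mem_nhds (show 0 < ε / 3 by positivity)),
    hl3.eventually (gt_mem_nhds (show 0 < ε / 3 by positivity))] with N hpr he1 he2 he3
  intro _ p₀ q A hp₀ hq hout hker hfreq t ht
  set δ := min 1 (ε / (3 * (c₁ + 1))) with hδ
  have hδ0 : 0 < δ := by positivity
  have hδ1 : δ ≤ 1 := min_le_left _ _
  have hδ2 : c₁ * δ ≤ ε / 3 := by
    have h1 : δ ≤ ε / (3 * (c₁ + 1)) := min_le_right _ _
    rw [le_div_iff₀ (by positivity)] at h1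
    nlinarith
  have hN' : (0 : ℝ) < N := Nat.cast_pos.2 (NeZero.pos N)
  have hN1 : (1 : ℝ) ≤ N := Nat.one_le_cast.2 (NeZero.pos N)
  set p := Params.sgd σ γ₁ γ₂ αC αW1 αW2 p₀ q with hp
  set h : ℕ → Fin M → ℝ := fun k m => (p k).output σ γ₁ γ₂ (x m) with hh
  have h0 : ‖h 0‖ ≤ δ := (pi_norm_le_iff_of_nonneg hδ0.le).2 fun m => hout m
  have hap := hpr p₀ q h (fun _ _ => rfl) hp₀ hq (h0.trans hδ1)
  set n₀ := ⌊(N : ℝ) * T⌋₊ with hn₀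
  have hn₀T : (n₀ : ℝ) ≤ N * T := Nat.floor_le (by positivity)
  have htime : ∀ n ≤ n₀, (n : ℝ) / N ≤ T := fun n hn => by
    rw [div_le_iff₀ hN', mul_comm]
    exact le_trans (by exact_mod_cast hn) hn₀T
  have hAb : ∀ l m, |A l m| ≤ K := fun l m => by
    have h1 := hK₃ N p₀ hp₀ l m
    have h2 := hker l m
    rw [abs_sub_comm] at h2
    have h3 := abs_add_le (A l m - kernelA σ γ₁ αC αW1 αW2 p₀.empirical (x l) (x m))
      (kernelA σ γ₁ αC αW1 αW2 p₀.empirical (x l) (x m))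
    rw [sub_add_cancel] at h3
    linarith
  have hp₀' : ∀ i, ‖p₀.unit i‖ ≤ R + 1 := fun i => (hp₀ i).trans (by linarith)
  have hres : ∀ k ≤ n₀, ∀ m, |y m - h k m| ≤ U := fun k hk m =>
    (abs_sub _ _).trans ((add_le_add (norm_le_pi_norm y m) (norm_le_pi_norm (h k) m)).trans
      (hap k (htime k hk)).1)
  set a := (N : ℝ) ^ (γ₂ - 1) with ha
  have ha0 : 0 ≤ a := by positivity
  have hpow3 : (N : ℝ) ^ (γ₂ - 3) ≤ a / N := by
    rw [ha, ← Real.rpow_sub_one hN'.ne']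
    exact Real.rpow_le_rpow_of_exponent_le hN1 (by linarith)
  -- Defect of the scheme: Taylor remainder, drift of the kernel since time zero, and distance of
  -- the initial kernel from A.
  set η := K₁ * U ^ 2 * a + U * (K₂ * (K₀ * a) + δ) with hη
  have hstep : ∀ k < n₀, ∀ l, |h (k + 1) l - h k l| ≤ K₁ * U / N ∧
      |h (k + 1) l - h k l - 1 / N * ∑ m, dataWeight x y (q k) m * ((y m - h k m) * A l m)| ≤
        η / N := by
    intro k hk l
    obtain ⟨m, hm⟩ := hq k
    have hsucc : p (k + 1) = (p k).trainStep σ γ₁ γ₂ αC αW1 αW2 (x m, y m) := by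
      rw [← hm]; rfl
    obtain ⟨-, e2⟩ := hK₁ N (p k) m (y m) fun i => ((hap k (htime k hk.le)).2 i).1
    rw [← hsucc] at e2
    obtain ⟨e2, e3⟩ := e2 (fun i => ((hap (k + 1) (htime (k + 1) hk)).2 i).1) l
    have hr := hres k hk.le m
    refine ⟨e2.trans ?_, ?_⟩
    · calc K₁ / N * |y m - h k m| ≤ K₁ / N * U := by gcongr
        _ = _ := by ring
    · have hkk : ∀ l m, |kernelA σ γ₁ αC αW1 αW2 (p k).empirical (x l) (x m) - A l m| ≤
          K₂ * (K₀ * a) + δ := fun l m => by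
        have h1 := hK₂ N (p k) p₀ (K₀ * a) (fun i => ((hap k (htime k hk.le)).2 i).1) hp₀'
          (fun i => ((hap k (htime k hk.le)).2 i).2) l m
        exact (abs_sub_le _ _ _).trans (add_le_add h1 (hker l m))
      -- The increment at the drawn point becomes a weighted sum over the data set, the form in
      -- which the noise can be averaged.
      have hw := sum_dataWeight_mul x y m fun z => (z.2 - (p k).output σ γ₁ γ₂ z.1) *
        kernelA σ γ₁ αC αW1 αW2 (p k).empirical (x l) z.1
      have hw1 := sum_dataWeight_mul x y m fun _ => 1
      rw [← hm] at hw hw1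
      simp only [mul_one] at hw1
      have hdiff : |(y m - (p k).output σ γ₁ γ₂ (x m)) *
          kernelA σ γ₁ αC αW1 αW2 (p k).empirical (x l) (x m) -
          ∑ m, dataWeight x y (q k) m * ((y m - h k m) * A l m)| ≤
          U * (K₂ * (K₀ * a) + δ) := by
        have hw' : (y m - (p k).output σ γ₁ γ₂ (x m)) *
            kernelA σ γ₁ αC αW1 αW2 (p k).empirical (x l) (x m) =
            ∑ m, dataWeight x y (q k) m * ((y m - h k m) *
              kernelA σ γ₁ αC αW1 αW2 (p k).empirical (x l) (x m)) := by
          rw [hw, hm]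
        rw [hw', ← Finset.sum_sub_distrib]
        refine (Finset.abs_sum_le_sum_abs _ _).trans ?_
        calc ∑ m', |dataWeight x y (q k) m' * ((y m' - h k m') *
              kernelA σ γ₁ αC αW1 αW2 (p k).empirical (x l) (x m')) -
              dataWeight x y (q k) m' * ((y m' - h k m') * A l m')|
            ≤ ∑ m', dataWeight x y (q k) m' * (U * (K₂ * (K₀ * a) + δ)) := by
              refine Finset.sum_le_sum fun m' _ => ?_
              rw [← mul_sub, ← mul_sub, abs_mul, abs_mul,
                abs_of_nonneg (dataWeight_nonneg x y (q k) m')]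
              exact mul_le_mul_of_nonneg_left (mul_le_mul (hres k hk.le m') (hkk l m')
                (abs_nonneg _) hU) (dataWeight_nonneg x y (q k) m')
          _ = _ := by rw [← Finset.sum_mul, hw1, one_mul]
      have e4 : K₁ * (N : ℝ) ^ (γ₂ - 3) * |y m - (p k).output σ γ₁ γ₂ (x m)| ^ 2 ≤
          K₁ * (a / N) * U ^ 2 := by
        have hr' : |y m - (p k).output σ γ₁ γ₂ (x m)| ≤ U := hr
        gcongr
      have e5 := abs_sub_le (h (k + 1) l - h k l) (1 / N * ((y m - (p k).output σ γ₁ γ₂ (x m)) *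
          kernelA σ γ₁ αC αW1 αW2 (p k).empirical (x l) (x m)))
          (1 / N * ∑ m, dataWeight x y (q k) m * ((y m - h k m) * A l m))
      rw [← mul_sub (1 / (N : ℝ)), abs_mul, abs_of_nonneg (by positivity : 0 ≤ 1 / (N : ℝ))] at e5
      have e6 := mul_le_mul_of_nonneg_left hdiff (by positivity : 0 ≤ 1 / (N : ℝ))
      have e7 := e3.trans e4
      have e8 : η / N = K₁ * (a / N) * U ^ 2 + 1 / N * (U * (K₂ * (K₀ * a) + δ)) := by
        rw [hη]; ring
      rw [e8]
      exact e5.trans (add_le_add e7 e6)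
  set n := ⌊(N : ℝ) * t⌋₊ with hn
  have hnn₀ : n ≤ n₀ := Nat.floor_le_floor (by gcongr; exact ht.2)
  have hη0 : 0 ≤ η := by positivity
  have hcomp := norm_sub_evolution_le_of_noisy_euler hM (A := A) y (T := T) (K := K) (H := U)
    (K' := K₁ * U) (δ := δ) (η := η) (NeZero.pos N) (h := h)
    (w := fun k m => dataWeight x y (q k) m) (n₀ := n₀) hη0 (by positivity) (htime n₀ le_rfl) hAb
    (fun k hk l => (hstep k hk l).2)
    (fun k hk => by have := (hap k (htime k hk)).1; linarith [norm_nonneg y])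
    (fun k hk => (pi_norm_le_iff_of_nonneg (by positivity)).2 fun l => (hstep k hk l).1)
    (fun k hk m => hfreq k (le_trans (by exact_mod_cast hk) hn₀T) m) h0 hnn₀
  have htn : |(n : ℝ) / N - t| ≤ 1 / N := by
    have h1 : (n : ℝ) ≤ N * t := Nat.floor_le (mul_nonneg hN'.le ht.1)
    have h2 : (N : ℝ) * t < n + 1 := Nat.lt_floor_add_one _
    rw [abs_le]
    constructor
    · rw [neg_le_sub_iff_le_add, ← add_div, le_div_iff₀ hN']
      linarith
    · have : (n : ℝ) / N ≤ t := by rw [div_le_iff₀ hN']; linarith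
      have : 0 ≤ 1 / (N : ℝ) := by positivity
      linarith
  have hlip := norm_evolution_sub_le hM hAb y (T := T) ht
    (show (n : ℝ) / N ∈ Icc 0 T from ⟨by positivity, htime n hnn₀⟩)
  have hlip' : ‖evolution A y (n / N) - evolution A y t‖ ≤ K * (‖y‖ * X) / N := by
    refine hlip.trans ?_
    calc K * (‖y‖ * X) * |(n : ℝ) / N - t| ≤ K * (‖y‖ * X) * (1 / N) := by gcongr
      _ = _ := by ring
  have htotal : ‖h n - evolution A y t‖ ≤ ε := by
    have h1 := norm_sub_le_norm_sub_add_norm_sub (h n) (evolution A y (n / N)) (evolution A y t)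
    have h2 : (δ + M * (δ * ((‖y‖ + U) * K + T * (K₁ * U * K))) + T * η +
        T * (K * (K * (‖y‖ * X))) / N) * X + K * (‖y‖ * X) / N =
        c₁ * δ + c₂ * a + c₃ / N := by
      rw [hη, hc₁, hc₂, hc₃]
      ring
    linarith
  refine ⟨fun i => (((hap n (htime n hnn₀)).2 i).2).trans he1.le, fun m => ?_⟩
  exact (norm_le_pi_norm (h n - evolution A y t) m).trans htotal

end TwoLayer

/-! ### A second-moment law of large numbers given a common variable. -/

section WeakLaw

variable {Ω V W : Type*} [MeasurableSpace Ω] [MeasurableSpace V] [MeasurableSpace W]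
  {P : Measure Ω} [IsProbabilityMeasure P]

/-- Functions of i.i.d. variables and a common independent variable are uncorrelated once they are
centred given the common variable. -/
theorem integral_mul_centred_eq_zero {X X' : Ω → V} {Y : Ω → W} {μ : Measure V}
    [IsProbabilityMeasure μ] (hX : Measurable X) (hX' : Measurable X') (hY : Measurable Y)
    (hlaw : P.map X = μ) (hind : IndepFun X (fun ω => (X' ω, Y ω)) P) {F : V × W → ℝ}
    (hF : Measurable F) {K : ℝ} (hK : ∀ z, |F z| ≤ K) :
    ∫ ω, (F (X ω, Y ω) - ∫ v, F (v, Y ω) ∂μ) * (F (X' ω, Y ω) - ∫ v, F (v, Y ω) ∂μ) ∂P = 0 := by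
  have hK0 : 0 ≤ K := by
    obtain ⟨ω⟩ : Nonempty Ω := P.nonempty_of_neZero
    exact (abs_nonneg _).trans (hK (X ω, Y ω))
  set Fb : W → ℝ := fun w => ∫ v, F (v, w) ∂μ with hFb
  have hFbm : Measurable Fb :=
    (StronglyMeasurable.integral_prod_left (f := fun v w => F (v, w)) (μ := μ)
      hF.stronglyMeasurable).measurable
  have hFbK : ∀ w, |Fb w| ≤ K := fun w => by
    have := norm_integral_le_of_norm_le_const (μ := μ) (f := fun v => F (v, w)) (C := K)
      (Eventually.of_forall fun v => hK (v, w))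
    simpa using this
  set G : V × (V × W) → ℝ := fun z => (F (z.1, z.2.2) - Fb z.2.2) * (F z.2 - Fb z.2.2) with hG
  have hGm : Measurable G := by
    refine Measurable.mul (Measurable.sub ?_ ?_) (Measurable.sub ?_ ?_)
    · exact hF.comp (measurable_fst.prodMk measurable_snd.snd)
    · exact hFbm.comp measurable_snd.snd
    · exact hF.comp measurable_snd
    · exact hFbm.comp measurable_snd.snd
  have hX'Y : Measurable fun ω => (X' ω, Y ω) := hX'.prodMk hY
  set ν := P.map fun ω => (X' ω, Y ω) with hν
  have : IsProbabilityMeasure ν := Measure.isProbabilityMeasure_map hX'Y.aemeasurable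
  have hjoint : P.map (fun ω => (X ω, (X' ω, Y ω))) = μ.prod ν := by
    rw [← hlaw]
    exact (indepFun_iff_map_prod_eq_prod_map_map hX.aemeasurable hX'Y.aemeasurable).1 hind
  have h1 : ∫ ω, (F (X ω, Y ω) - Fb (Y ω)) * (F (X' ω, Y ω) - Fb (Y ω)) ∂P =
      ∫ z, G z ∂(μ.prod ν) := by
    rw [← hjoint, integral_map (hX.prodMk hX'Y).aemeasurable hGm.aestronglyMeasurable]
  have hGi : Integrable G (μ.prod ν) := by
    refine Integrable.of_bound hGm.aestronglyMeasurable ((K + K) * (K + K))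
      (Eventually.of_forall fun z => ?_)
    rw [hG, Real.norm_eq_abs, abs_mul]
    refine mul_le_mul ?_ ?_ (abs_nonneg _) (by positivity)
    · exact (abs_sub _ _).trans (add_le_add (hK _) (hFbK _))
    · exact (abs_sub _ _).trans (add_le_add (hK _) (hFbK _))
  -- With (X', Y) fixed, only the first factor depends on X, and it integrates to zero.
  rw [h1, integral_prod_symm G hGi]
  refine integral_eq_zero_of_ae (Eventually.of_forall fun z => ?_)
  simp only [hG, Pi.zero_apply]
  rw [integral_mul_const, integral_sub _ (integrable_const _)]
  · simp [hFb]
  · exact Integrable.of_bound (hF.comp (measurable_id.prodMk measurable_const)).aestronglyMeasurable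
      K (Eventually.of_forall fun v => hK _)

/-- The weak law of large numbers, with a rate, for functions of i.i.d. variables and a common
independent variable. -/
theorem tendstoInMeasure_centred_sum {X : ℕ → Ω → V} {Y : Ω → W} {μ : Measure V}
    [IsProbabilityMeasure μ] (hX : ∀ i, Measurable (X i)) (hY : Measurable Y)
    (hlaw : ∀ i, P.map (X i) = μ) (hind : ∀ i j, i ≠ j → IndepFun (X i) (fun ω => (X j ω, Y ω)) P)
    {F : V × W → ℝ} (hF : Measurable F) {K : ℝ} (hK : ∀ z, |F z| ≤ K) {s : ℝ} (hs : 1 / 2 < s) :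
    TendstoInMeasure P (fun (n : ℕ) ω => 1 / (n : ℝ) ^ s *
      ∑ i ∈ Finset.range n, (F (X i ω, Y ω) - ∫ v, F (v, Y ω) ∂μ)) atTop 0 := by
  have hK0 : 0 ≤ K := by
    obtain ⟨ω⟩ : Nonempty Ω := P.nonempty_of_neZero
    exact (abs_nonneg _).trans (hK (X 0 ω, Y ω))
  set D : ℕ → Ω → ℝ := fun i ω => F (X i ω, Y ω) - ∫ v, F (v, Y ω) ∂μ with hD
  have hDm : ∀ i, Measurable (D i) := fun i =>
    (hF.comp ((hX i).prodMk hY)).sub ((StronglyMeasurable.integral_prod_left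
      (f := fun v w => F (v, w)) (μ := μ) hF.stronglyMeasurable).measurable.comp hY)
  have hDb : ∀ i ω, |D i ω| ≤ 2 * K := fun i ω => by
    have h1 := norm_integral_le_of_norm_le_const (μ := μ) (f := fun v => F (v, Y ω)) (C := K)
      (Eventually.of_forall fun v => hK (v, Y ω))
    have h2 := abs_sub (F (X i ω, Y ω)) (∫ v, F (v, Y ω) ∂μ)
    have h3 := hK (X i ω, Y ω)
    simp at h1
    linarith
  have hDD : ∀ i j, Integrable (fun ω => D i ω * D j ω) P := fun i j =>
    Integrable.of_bound ((hDm i).mul (hDm j)).aestronglyMeasurable (2 * K * (2 * K))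
      (Eventually.of_forall fun ω => by
        rw [Real.norm_eq_abs, abs_mul]
        exact mul_le_mul (hDb i ω) (hDb j ω) (abs_nonneg _) (by positivity))
  -- The off-diagonal terms vanish, so the second moment grows only linearly.
  have hS2 : ∀ n : ℕ, Integrable (fun ω => (∑ i ∈ Finset.range n, D i ω) ^ 2) P ∧
      ∫ ω, (∑ i ∈ Finset.range n, D i ω) ^ 2 ∂P ≤ n * (2 * K * (2 * K)) := by
    intro n
    have e : (fun ω => (∑ i ∈ Finset.range n, D i ω) ^ 2) =
        fun ω => ∑ i ∈ Finset.range n, ∑ j ∈ Finset.range n, D i ω * D j ω := by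
      funext ω
      rw [sq, Finset.sum_mul_sum]
    rw [e]
    refine ⟨integrable_finsetSum _ fun i _ => integrable_finsetSum _ fun j _ => hDD i j, ?_⟩
    rw [integral_finsetSum _ fun i _ => integrable_finsetSum _ fun j _ => hDD i j]
    have hi : ∀ i ∈ Finset.range n, ∫ ω, ∑ j ∈ Finset.range n, D i ω * D j ω ∂P ≤
        2 * K * (2 * K) := by
      intro i hi
      rw [integral_finsetSum _ fun j _ => hDD i j, Finset.sum_eq_single_of_mem i hi]
      · refine (integral_mono (hDD i i) (integrable_const (2 * K * (2 * K))) fun ω => ?_).trans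
          (by simp)
        refine (le_abs_self _).trans ?_
        rw [abs_mul]
        exact mul_le_mul (hDb i ω) (hDb i ω) (abs_nonneg _) (by positivity)
      · intro j _ hji
        exact integral_mul_centred_eq_zero (hX i) (hX j) hY (hlaw i) (hind i j hji.symm) hF hK
    refine (Finset.sum_le_card_nsmul _ _ _ hi).trans ?_
    simp
  rw [tendstoInMeasure_iff_measureReal_norm]
  intro ε hε
  -- Chebyshev's inequality gives the rate n^(1-2s), which decays because s > 1/2.
  have hbound : ∀ n : ℕ, 0 < n → P.real {ω | ε ≤ ‖1 / (n : ℝ) ^ s *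
      ∑ i ∈ Finset.range n, D i ω - (0 : Ω → ℝ) ω‖} ≤
      (2 * K * (2 * K)) / ε ^ 2 * (n : ℝ) ^ ((2 - 2 * s) - 1) := by
    intro n hn
    have hn' : (0 : ℝ) < n := Nat.cast_pos.2 hn
    have hp := Real.rpow_pos_of_pos hn' s
    have hsub : {ω | ε ≤ ‖1 / (n : ℝ) ^ s * ∑ i ∈ Finset.range n, D i ω - (0 : Ω → ℝ) ω‖} ⊆
        {ω | (ε * (n : ℝ) ^ s) ^ 2 ≤ (∑ i ∈ Finset.range n, D i ω) ^ 2} := by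
      intro ω hω
      simp only [mem_ofPred_eq, Pi.zero_apply, sub_zero, Real.norm_eq_abs, abs_mul] at hω ⊢
      rw [abs_of_pos (by positivity), one_div, inv_mul_eq_div, le_div_iff₀ hp] at hω
      rw [← sq_abs (∑ i ∈ Finset.range n, D i ω)]
      exact pow_le_pow_left₀ (by positivity) hω 2
    have hch := mul_meas_ge_le_integral_of_nonneg (μ := P)
      (Eventually.of_forall fun ω => sq_nonneg (∑ i ∈ Finset.range n, D i ω)) (hS2 n).1
      ((ε * (n : ℝ) ^ s) ^ 2)
    have h1 := (measureReal_mono hsub (measure_ne_top P _)).trans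
      ((le_div_iff₀' (by positivity)).2 (hch.trans (hS2 n).2))
    refine h1.trans (le_of_eq ?_)
    have e1 : (n : ℝ) ^ ((2 - 2 * s) - 1) = n / ((n : ℝ) ^ s) ^ 2 := by
      rw [← Real.rpow_natCast ((n : ℝ) ^ s) 2, ← Real.rpow_mul hn'.le,
        show (2 - 2 * s) - 1 = 1 - s * (2 : ℕ) by push_cast; ring, Real.rpow_sub hn',
        Real.rpow_one]
    rw [e1]
    field_simp
  have hlim : Tendsto (fun n : ℕ => (2 * K * (2 * K)) / ε ^ 2 * (n : ℝ) ^ ((2 - 2 * s) - 1))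
      atTop (𝓝 0) := by
    simpa using (TwoLayer.tendsto_natCast_rpow_sub_one (γ := 2 - 2 * s) (by linarith)).const_mul
      ((2 * K * (2 * K)) / ε ^ 2)
  refine squeeze_zero' (Eventually.of_forall fun n => measureReal_nonneg) ?_ hlim
  filter_upwards [eventually_gt_atTop 0] with n hn using hbound n hn

end WeakLaw

/-! ### Weak convergence of empirical measures. -/

section EmpiricalMeasure

variable {X : Type*} [MeasurableSpace X]

/-- The uniform average of point masses. -/
noncomputable def averageDirac {n : ℕ} [NeZero n] (v : Fin n → X) : ProbabilityMeasure X :=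
  ⟨(n : ℝ≥0∞)⁻¹ • ∑ i, Measure.dirac (v i), ⟨by
    simp [ENNReal.inv_mul_cancel, NeZero.ne n]⟩⟩

theorem integral_averageDirac [MeasurableSingletonClass X] {n : ℕ} [NeZero n] (v : Fin n → X)
    (f : X → ℝ) :
    ∫ z, f z ∂(averageDirac v : Measure X) = 1 / (n : ℝ) * ∑ i, f (v i) := by
  have : (averageDirac v : Measure X) = (n : ℝ≥0∞)⁻¹ • ∑ i, Measure.dirac (v i) := rfl
  rw [this, integral_smul_measure, integral_finsetSum_measure]
  · simp
  · intro i _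
    exact integrable_dirac (by simp)

variable [TopologicalSpace X] [BorelSpace X]

theorem continuous_averageDirac [MeasurableSingletonClass X] {n : ℕ} [NeZero n] :
    Continuous (averageDirac : (Fin n → X) → ProbabilityMeasure X) := by
  refine continuous_iff_continuousAt.2 fun v => ?_
  refine ProbabilityMeasure.tendsto_iff_forall_integral_tendsto.2 fun f => ?_
  simp only [integral_averageDirac]
  refine Tendsto.const_mul _ (tendsto_finsetSum _ fun i _ => ?_)
  exact (f.continuous.tendsto _).comp (tendsto_pi_nhds.1 tendsto_id i)

variable {Ω : Type*} [MeasurableSpace Ω] {P : Measure Ω} [IsProbabilityMeasure P]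

/-- **Varadarajan's theorem**: the empirical measures of i.i.d. variables converge weakly, almost
surely. -/
theorem tendsto_averageDirac_ae [MeasurableSingletonClass X] [SecondCountableTopology X]
    [HasOuterApproxClosed X] {V : ℕ → Ω → X} {μ : ProbabilityMeasure X}
    (hV : ∀ i, Measurable (V i)) (hlaw : ∀ i, P.map (V i) = μ)
    (hind : Pairwise fun i j => IndepFun (V i) (V j) P) :
    ∀ᵐ ω ∂P, Tendsto (fun n : ℕ => averageDirac (n := n + 1) fun i => V i ω) atTop (𝓝 μ) := by
  obtain ⟨b, hbc, -, hb⟩ := TopologicalSpace.exists_countable_basis X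
  -- Inserting ∅ guarantees a nonempty family, which can be enumerated by ℕ.
  obtain ⟨e, he⟩ := (hbc.insert ∅).exists_eq_range (insert_nonempty ∅ b)
  have heo : ∀ i, IsOpen (e i) := fun i => by
    have : e i ∈ insert ∅ b := he ▸ mem_range_self i
    rcases this with h | h
    · rw [h]; exact isOpen_empty
    · exact hb.isOpen h
  have hU : ∀ s : Finset ℕ, MeasurableSet (⋃ i ∈ s, e i) := fun s =>
    (isOpen_biUnion fun i _ => heo i).measurableSet
  -- There are countably many finite unions of basic sets, so one null set serves them all.
  have hslln : ∀ᵐ ω ∂P, ∀ s : Finset ℕ, Tendsto (fun n : ℕ =>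
      (∑ k ∈ Finset.range n, (⋃ i ∈ s, e i).indicator (fun _ => (1 : ℝ)) (V k ω)) / n) atTop
      (𝓝 ((μ : Measure X).real (⋃ i ∈ s, e i))) := by
    refine ae_all_iff.2 fun s => ?_
    set f : X → ℝ := (⋃ i ∈ s, e i).indicator fun _ => (1 : ℝ) with hf
    have hfm : Measurable f := measurable_const.indicator (hU s)
    have hmean : ∫ ω, f (V 0 ω) ∂P = (μ : Measure X).real (⋃ i ∈ s, e i) := by
      rw [← integral_map (hV 0).aemeasurable hfm.aestronglyMeasurable, hlaw, hf]
      exact integral_indicator_one (hU s)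
    rw [← hmean]
    refine strong_law_ae_real (fun k ω => f (V k ω)) ?_ ?_ ?_
    · refine Integrable.of_bound (hfm.comp (hV 0)).aestronglyMeasurable 1
        (Eventually.of_forall fun ω => ?_)
      rw [hf]
      refine (norm_indicator_le_norm_self _ _).trans (by simp)
    · exact fun i j hij => (hind hij).comp hfm hfm
    · exact fun i => IdentDistrib.comp ⟨(hV i).aemeasurable, (hV 0).aemeasurable,
        (hlaw i).trans (hlaw 0).symm⟩ hfm
  filter_upwards [hslln] with ω hω
  -- By the portmanteau theorem open sets suffice. An open G is an increasing union of finite unions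
  -- of basic sets; each of these has convergent empirical mass, and its limiting mass tends to that
  -- of G.
  refine tendsto_of_forall_isOpen_le_liminf_nat' fun G hG => ?_
  classical
  set s : ℕ → Finset ℕ := fun n => (Finset.range n).filter fun i => e i ⊆ G with hs
  have hmono : Monotone fun n => ⋃ i ∈ s n, e i := by
    intro m n hmn
    refine biUnion_subset_biUnion_left fun i hi => ?_
    simp only [hs, Finset.coe_filter, Finset.mem_range, mem_ofPred_eq] at hi ⊢
    exact ⟨hi.1.trans_le hmn, hi.2⟩
  have hunion : ⋃ n, ⋃ i ∈ s n, e i = G := by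
    refine Subset.antisymm ?_ fun z hz => ?_
    · refine iUnion_subset fun n => iUnion₂_subset fun i hi => ?_
      exact (Finset.mem_filter.1 hi).2
    · obtain ⟨u, hu, hzu, huG⟩ := hb.exists_subset_of_mem_open hz hG
      obtain ⟨i, rfl⟩ : u ∈ range e := he ▸ mem_insert_of_mem _ hu
      refine mem_iUnion.2 ⟨i + 1, mem_iUnion₂.2 ⟨i, ?_, hzu⟩⟩
      exact Finset.mem_filter.2 ⟨Finset.mem_range.2 (Nat.lt_succ_self i), huG⟩
  have hlim := tendsto_measure_iUnion_atTop (μ := (μ : Measure X)) hmono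
  rw [hunion] at hlim
  refine le_of_tendsto' hlim fun n => ?_
  have hconv : Tendsto (fun k : ℕ => (averageDirac (n := k + 1) (fun i => V i ω) : Measure X)
      (⋃ i ∈ s n, e i)) atTop (𝓝 ((μ : Measure X) (⋃ i ∈ s n, e i))) := by
    have h1 := ENNReal.tendsto_ofReal ((hω (s n)).comp (tendsto_add_atTop_nat 1))
    rw [ofReal_measureReal (measure_ne_top _ _)] at h1
    refine h1.congr fun k => ?_
    rw [← ofReal_measureReal (measure_ne_top _ _), ← integral_indicator_one (hU (s n)), integral_averageDirac]
    simp only [Function.comp_apply, Finset.sum_range]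
    rw [div_eq_inv_mul, one_div]
    rfl
  rw [Function.comp_apply, ← hconv.liminf_eq]
  exact liminf_le_liminf (Eventually.of_forall fun k => measure_mono
    ((subset_iUnion (fun n => ⋃ i ∈ s n, e i) n).trans hunion.subset))

end EmpiricalMeasure

/-! ### Auxiliary facts on product measures, independence and averages. -/

theorem MeasureTheory.Measure.pi_dirac_eq_dirac {ι : Type*} [Fintype ι] {X : ι → Type*}
    [∀ i, MeasurableSpace (X i)] (v : ∀ i, X i) :
    Measure.pi (fun i => Measure.dirac (v i)) = Measure.dirac v := by
  refine Measure.pi_eq fun s hs => ?_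
  rw [Measure.dirac_apply' _ (MeasurableSet.univ_pi hs)]
  simp only [Measure.dirac_apply' _ (hs _)]
  classical
  by_cases h : ∀ i, v i ∈ s i
  · rw [indicator_of_mem (by simpa using h)]
    simp [h]
  · rw [indicator_of_notMem (by simpa using h)]
    obtain ⟨i, hi⟩ := not_forall.1 h
    exact (Finset.prod_eq_zero (Finset.mem_univ i) (by simp [hi])).symm

theorem ProbabilityTheory.iIndep.indepFun_of_disjoint {Ω ι β β' : Type*} [MeasurableSpace Ω]
    [MeasurableSpace β] [MeasurableSpace β'] {P : Measure Ω} {m : ι → MeasurableSpace Ω}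
    (h : iIndep m P) (hle : ∀ i, m i ≤ ‹MeasurableSpace Ω›) {S T : Set ι} (hST : Disjoint S T)
    {f : Ω → β} {g : Ω → β'} (hf : Measurable[⨆ i ∈ S, m i] f)
    (hg : Measurable[⨆ i ∈ T, m i] g) : IndepFun f g P := by
  rw [IndepFun_iff_Indep]
  exact indep_of_indep_of_le_left (indep_of_indep_of_le_right (indep_iSup_of_disjoint hle h hST)
    hg.comap_le) hf.comap_le

/-- Almost sure sublinearity of partial sums, made uniform over an initial segment. -/
theorem eventually_forall_le_mul_of_tendsto_div {S : ℕ → ℝ}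
    (hS : Tendsto (fun k : ℕ => S k / k) atTop (𝓝 0)) {T δ : ℝ} (hT : 0 ≤ T) (hδ : 0 < δ) :
    ∀ᶠ N : ℕ in atTop, ∀ k : ℕ, (k : ℝ) ≤ N * T → |S k| ≤ δ * N := by
  have h1 : ∀ᶠ k : ℕ in atTop, |S k / k| < δ / (T + 1) := by
    have := hS.abs
    rw [abs_zero] at this
    exact this.eventually (gt_mem_nhds (by positivity))
  obtain ⟨k₀, hk₀⟩ := eventually_atTop.1 h1
  -- The finitely many early indices, where S k / k is not yet small, are absorbed by taking N
  -- large.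
  have h2 : ∀ᶠ N : ℕ in atTop, ∑ k ∈ Finset.range (k₀ + 1), |S k| ≤ δ * N :=
    (tendsto_natCast_atTop_atTop.const_mul_atTop hδ).eventually_ge_atTop _
  filter_upwards [h2] with N hN k hk
  by_cases hkk : k < k₀ + 1
  · exact (Finset.single_le_sum (f := fun k => |S k|) (fun i _ => abs_nonneg _)
      (Finset.mem_range.2 hkk)).trans hN
  · have hk0 : (0 : ℝ) < k := by
      have : 0 < k := by omega
      exact_mod_cast this
    have h3 := hk₀ k (by omega)
    rw [abs_div, abs_of_pos hk0, div_lt_iff₀ hk0] at h3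
    refine h3.le.trans ?_
    calc δ / (T + 1) * k ≤ δ / (T + 1) * (N * T) := by gcongr
      _ = δ * N * (T / (T + 1)) := by ring
      _ ≤ δ * N * 1 := by
          gcongr
          rw [div_le_one (by positivity)]
          linarith
      _ = δ * N := mul_one _

/-! ### Laws and independence of the initial weights. -/

namespace TwoLayer

variable {d N₁ M : ℕ}

/-- The law of the weights `(C^i, (W^{2,j,i})_j)` of one unit. -/
noncomputable abbrev unitLaw (N₁ : ℕ) (μC μW2 : ProbabilityMeasure ℝ) :
    Measure (ℝ × (Fin N₁ → ℝ)) :=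
  (μC : Measure ℝ).prod (Measure.pi fun _ : Fin N₁ => (μW2 : Measure ℝ))

/-- The first layer enters as a point mass, so integrals against the random initial measure become
integrals against a fixed law with `w1` as a parameter. Continuity and measurability in `w1` rest on
this form. -/
theorem initialMeasure_eq_map (μC μW2 : ProbabilityMeasure ℝ)
    (w1 : Fin N₁ → EuclideanSpace ℝ (Fin d)) :
    (initialMeasure μC μW2 w1 : Measure (Theta d N₁)) =
      (unitLaw N₁ μC μW2).map fun v => (v.1, v.2, w1) := by
  have h : (initialMeasure μC μW2 w1 : Measure (Theta d N₁)) =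
      (μC : Measure ℝ).prod ((Measure.pi fun _ : Fin N₁ => (μW2 : Measure ℝ)).prod
        (Measure.pi fun j => Measure.dirac (w1 j))) := rfl
  rw [h, Measure.pi_dirac_eq_dirac, Measure.prod_dirac]
  conv_lhs => rw [← Measure.map_id (μ := (μC : Measure ℝ))]
  rw [Measure.map_prod_map _ _ measurable_id (by fun_prop)]
  rfl

theorem integral_initialMeasure (μC μW2 : ProbabilityMeasure ℝ)
    (w1 : Fin N₁ → EuclideanSpace ℝ (Fin d)) {F : Theta d N₁ → ℝ} (hF : Measurable F) :
    ∫ θ, F θ ∂(initialMeasure μC μW2 w1 : Measure (Theta d N₁)) =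
      ∫ v, F (v.1, v.2, w1) ∂(unitLaw N₁ μC μW2) := by
  rw [initialMeasure_eq_map, integral_map (by fun_prop) hF.aestronglyMeasurable]

/-- The initial measure depends continuously on the weights of the first layer. -/
theorem continuous_initialMeasure (μC μW2 : ProbabilityMeasure ℝ) :
    Continuous (initialMeasure (d := d) (N₁ := N₁) μC μW2) := by
  refine continuous_iff_continuousAt.2 fun w => ?_
  refine ProbabilityMeasure.tendsto_iff_forall_integral_tendsto.2 fun f => ?_
  simp only [integral_initialMeasure μC μW2 _ f.continuous.measurable]
  refine tendsto_integral_filter_of_dominated_convergence (fun _ => ‖f‖) ?_ ?_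
    (integrable_const _) ?_
  · exact Eventually.of_forall fun w =>
      (f.continuous.comp (by fun_prop)).aestronglyMeasurable
  · exact Eventually.of_forall fun w => Eventually.of_forall fun v => f.norm_coe_le_norm _
  · exact Eventually.of_forall fun v => (f.continuous.comp (by fun_prop :
      Continuous fun w1 : Fin N₁ → EuclideanSpace ℝ (Fin d) => (v.1, v.2, w1))).tendsto w

variable {Ω : Type*}

section Independence

variable (C₀ : ℕ → Ω → ℝ) (W2₀ : Fin N₁ → ℕ → Ω → ℝ)
  (W1₀ : Fin N₁ → Ω → EuclideanSpace ℝ (Fin d)) (q : ℕ → Ω → EuclideanSpace ℝ (Fin d) × ℝ)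

/-- The σ-algebras generated by the initial parameters and the data points. -/
abbrev inputAlgebra : ℕ ⊕ (Fin N₁ × ℕ) ⊕ Fin N₁ ⊕ ℕ → MeasurableSpace Ω :=
  Sum.elim (fun i : ℕ => MeasurableSpace.comap (C₀ i) inferInstance)
    (Sum.elim (fun ji : Fin N₁ × ℕ => MeasurableSpace.comap (W2₀ ji.1 ji.2) inferInstance)
      (Sum.elim (fun j : Fin N₁ => MeasurableSpace.comap (W1₀ j) inferInstance)
        (fun k : ℕ => MeasurableSpace.comap (q k) inferInstance)))

/-- The initial weights `(C^i, (W^{2,j,i})_j)` of one unit. -/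
def unitWeights (i : ℕ) (ω : Ω) : ℝ × (Fin N₁ → ℝ) := (C₀ i ω, fun j => W2₀ j i ω)

/-- The indices of the initial weights of one unit. -/
def unitIndices (N₁ i : ℕ) : Set (ℕ ⊕ (Fin N₁ × ℕ) ⊕ Fin N₁ ⊕ ℕ) :=
  {a | a = .inl i ∨ ∃ j, a = .inr (.inl (j, i))}

variable {C₀ W2₀ W1₀ q}

theorem measurable_C₀ {S : Set (ℕ ⊕ (Fin N₁ × ℕ) ⊕ Fin N₁ ⊕ ℕ)} {i : ℕ} (h : .inl i ∈ S) :
    Measurable[⨆ a ∈ S, inputAlgebra C₀ W2₀ W1₀ q a] (C₀ i) :=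
  Measurable.mono (comap_measurable (C₀ i)) (le_iSup₂_of_le (.inl i) h le_rfl) le_rfl

theorem measurable_W2₀ {S : Set (ℕ ⊕ (Fin N₁ × ℕ) ⊕ Fin N₁ ⊕ ℕ)} {i : ℕ} {j : Fin N₁}
    (h : .inr (.inl (j, i)) ∈ S) :
    Measurable[⨆ a ∈ S, inputAlgebra C₀ W2₀ W1₀ q a] (W2₀ j i) :=
  Measurable.mono (comap_measurable (W2₀ j i)) (le_iSup₂_of_le (.inr (.inl (j, i))) h le_rfl)
    le_rfl

theorem measurable_W1₀ {S : Set (ℕ ⊕ (Fin N₁ × ℕ) ⊕ Fin N₁ ⊕ ℕ)} {j : Fin N₁}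
    (h : .inr (.inr (.inl j)) ∈ S) :
    Measurable[⨆ a ∈ S, inputAlgebra C₀ W2₀ W1₀ q a] (W1₀ j) :=
  Measurable.mono (comap_measurable (W1₀ j)) (le_iSup₂_of_le (.inr (.inr (.inl j))) h le_rfl)
    le_rfl

variable [MeasurableSpace Ω] {P : Measure Ω}

theorem inputAlgebra_le (hC₀ : ∀ i, Measurable (C₀ i)) (hW2₀ : ∀ j i, Measurable (W2₀ j i))
    (hW1₀ : ∀ j, Measurable (W1₀ j)) (hq : ∀ k, Measurable (q k)) (a) :
    inputAlgebra C₀ W2₀ W1₀ q a ≤ ‹MeasurableSpace Ω› := by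
  rcases a with i | ⟨j, i⟩ | j | k
  · exact (hC₀ i).comap_le
  · exact (hW2₀ j i).comap_le
  · exact (hW1₀ j).comap_le
  · exact (hq k).comap_le

theorem measurable_unitWeights (hC₀ : ∀ i, Measurable (C₀ i))
    (hW2₀ : ∀ j i, Measurable (W2₀ j i)) (i : ℕ) : Measurable (unitWeights C₀ W2₀ i) :=
  (hC₀ i).prodMk (measurable_pi_lambda _ fun j => hW2₀ j i)

theorem map_unitWeights [IsProbabilityMeasure P] (hC₀ : ∀ i, Measurable (C₀ i)) (hW2₀ : ∀ j i, Measurable (W2₀ j i))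
    (hW1₀ : ∀ j, Measurable (W1₀ j)) (hq : ∀ k, Measurable (q k))
    {μC μW2 : ProbabilityMeasure ℝ} (hC₀_law : ∀ i, P.map (C₀ i) = μC)
    (hW2₀_law : ∀ j i, P.map (W2₀ j i) = μW2)
    (h_indep : iIndep (inputAlgebra C₀ W2₀ W1₀ q) P) (i : ℕ) :
    P.map (unitWeights C₀ W2₀ i) = unitLaw N₁ μC μW2 := by
  have h1 : IndepFun (C₀ i) (fun ω j => W2₀ j i ω) P := by
    refine h_indep.indepFun_of_disjoint (inputAlgebra_le hC₀ hW2₀ hW1₀ hq) (S := {.inl i})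
      (T := {a | ∃ j, a = .inr (.inl (j, i))}) ?_ (measurable_C₀ rfl)
      (@measurable_pi_lambda _ _ _ (_) _ _ fun j => measurable_W2₀ ⟨j, rfl⟩)
    rw [Set.disjoint_singleton_left]
    rintro ⟨j, hj⟩
    simp at hj
  have h2 : iIndepFun (fun j => W2₀ j i) P := by
    rw [iIndepFun_iff_iIndep]
    exact h_indep.precomp (g := fun j : Fin N₁ => .inr (.inl (j, i)))
      fun a b hab => by simpa using hab
  have h3 := (iIndepFun_iff_map_fun_eq_pi_map fun j => (hW2₀ j i).aemeasurable).1 h2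
  have h4 := (indepFun_iff_map_prod_eq_prod_map_map (hC₀ i).aemeasurable
    (measurable_pi_lambda _ fun j => hW2₀ j i).aemeasurable).1 h1
  rw [h3, hC₀_law] at h4
  simp only [hW2₀_law] at h4
  exact h4

/-- The two sides use disjoint sets of indices. The common first layer is paired with the other unit
because this is the independence under which `tendstoInMeasure_centred_sum` kills the cross terms.
-/
theorem indepFun_unitWeights (hC₀ : ∀ i, Measurable (C₀ i)) (hW2₀ : ∀ j i, Measurable (W2₀ j i))
    (hW1₀ : ∀ j, Measurable (W1₀ j)) (hq : ∀ k, Measurable (q k))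
    (h_indep : iIndep (inputAlgebra C₀ W2₀ W1₀ q) P) {i k : ℕ} (hik : i ≠ k) :
    IndepFun (unitWeights C₀ W2₀ i) (fun ω => (unitWeights C₀ W2₀ k ω, fun j => W1₀ j ω)) P := by
  refine h_indep.indepFun_of_disjoint (inputAlgebra_le hC₀ hW2₀ hW1₀ hq) (S := unitIndices N₁ i)
    (T := unitIndices N₁ k ∪ {a | ∃ j, a = .inr (.inr (.inl j))}) ?_ ?_ ?_
  · rw [Set.disjoint_left]
    rintro a (rfl | ⟨j, rfl⟩) ((h | ⟨j', h⟩) | ⟨j', h⟩) <;> simp at h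
    · exact hik h
    · exact hik h.2
  · exact @Measurable.prodMk _ _ _ _ _ (_) _ _ (measurable_C₀ (.inl rfl))
      (@measurable_pi_lambda _ _ _ (_) _ _ fun j => measurable_W2₀ (.inr ⟨j, rfl⟩))
  · exact @Measurable.prodMk _ _ _ _ _ (_) _ _
      (@Measurable.prodMk _ _ _ _ _ (_) _ _ (measurable_C₀ (.inl (.inl rfl)))
        (@measurable_pi_lambda _ _ _ (_) _ _ fun j => measurable_W2₀ (.inl (.inr ⟨j, rfl⟩))))
      (@measurable_pi_lambda _ _ _ (_) _ _ fun j => measurable_W1₀ (.inr ⟨j, rfl⟩))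

theorem pairwise_indepFun_data (h_indep : iIndep (inputAlgebra C₀ W2₀ W1₀ q) P) :
    Pairwise fun k l => IndepFun (q k) (q l) P := by
  have h : iIndepFun q P := by
    rw [iIndepFun_iff_iIndep]
    exact h_indep.precomp (g := fun k : ℕ => .inr (.inr (.inr k)))
      fun a b hab => by simpa using hab
  exact fun k l hkl => h.indepFun hkl

end Independence

end TwoLayer

/-! ### Concentration at initialization and of the data frequencies. -/

namespace TwoLayer

variable {d N₁ N M : ℕ}

/-- Moving each unit by at most `ε` moves the empirical measure by at most `ε`. -/
theorem edist_empirical_le [NeZero N] {p p' : Params d N₁ N} {ε : ℝ}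
    (h : ∀ i, ‖p.unit i - p'.unit i‖ ≤ ε) :
    edist (LevyProkhorov.ofMeasure p.empirical) (LevyProkhorov.ofMeasure p'.empirical) ≤
      ENNReal.ofReal ε := by
  rw [LevyProkhorov.edist_probabilityMeasure_def]
  refine levyProkhorovEDist_le_of_forall_le _ _ _ fun r B hr hr' hB => ?_
  have e : ∀ p : Params d N₁ N, (p.empirical : Measure (Theta d N₁)) =
      (N : ℝ≥0∞)⁻¹ • ∑ i, Measure.dirac (p.unit i) := fun _ => rfl
  -- Every atom in B is matched by its moved copy in the thickening, so the additive slack r can be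
  -- dropped.
  refine le_add_right ?_
  simp only [e, Measure.smul_apply, Measure.finsetSum_apply, smul_eq_mul]
  refine mul_le_mul_right (Finset.sum_le_sum fun i _ => ?_) _
  rw [Measure.dirac_apply' _ hB, Measure.dirac_apply' _ Metric.isOpen_thickening.measurableSet]
  by_cases hi : p.unit i ∈ B
  · have ht : p'.unit i ∈ Metric.thickening r.toReal B := by
      refine Metric.mem_thickening_iff.2 ⟨p.unit i, hi, ?_⟩
      rw [dist_comm, dist_eq_norm]
      exact (h i).trans_lt ((ENNReal.ofReal_lt_iff_lt_toReal
        ((norm_nonneg _).trans (h i)) hr'.ne).1 hr)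
    rw [indicator_of_mem hi, indicator_of_mem ht]
    exact le_rfl
  · rw [indicator_of_notMem hi]
    exact zero_le

theorem ae_dataMeasure (x : Fin M → EuclideanSpace ℝ (Fin d)) (y : Fin M → ℝ) :
    ∀ᵐ z ∂(dataMeasure x y), ∃ m, z = (x m, y m) := by
  have hS : MeasurableSet {z | ∃ m, z = (x m, y m)} := by
    have : {z | ∃ m, z = (x m, y m)} = range fun m => (x m, y m) := by
      ext z
      simp [eq_comm]
    rw [this]
    exact (finite_range _).measurableSet
  rw [ae_iff]
  change dataMeasure x y {z | ∃ m, z = (x m, y m)}ᶜ = 0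
  simp only [dataMeasure, Measure.smul_apply, Measure.finsetSum_apply,
    Measure.dirac_apply' _ hS.compl]
  simpa using fun i => ⟨i, rfl, rfl⟩

theorem measurable_dataWeight (x : Fin M → EuclideanSpace ℝ (Fin d)) (y : Fin M → ℝ) (m : Fin M) :
    Measurable fun q => dataWeight x y q m := by
  classical
  unfold dataWeight
  exact Measurable.ite (measurableSet_singleton _) measurable_const measurable_const

theorem integral_dataWeight (hM : 0 < M) (x : Fin M → EuclideanSpace ℝ (Fin d)) (y : Fin M → ℝ)
    (m : Fin M) : ∫ q, dataWeight x y q m ∂(dataMeasure x y) = 1 / M := by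
  classical
  have : NeZero M := ⟨hM.ne'⟩
  have e : dataMeasure x y = (averageDirac fun m => (x m, y m) : Measure _) := rfl
  rw [e, integral_averageDirac]
  have hpos : (0 : ℝ) < (Finset.univ.filter fun m' => (x m', y m') = (x m, y m)).card := by
    exact_mod_cast Finset.card_pos.2 ⟨m, by simp⟩
  unfold dataWeight
  rw [Finset.sum_ite, Finset.sum_const, Finset.sum_const_zero, add_zero, nsmul_eq_mul]
  have hcard : ((Finset.univ.filter fun m' => (x m', y m') = (x m, y m)).card : ℝ) * (1 /
      (Finset.univ.filter fun m' => (x m', y m') = (x m, y m)).card) = 1 := by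
    field_simp
  convert mul_one (1 / (M : ℝ)) using 2

variable {Ω : Type*} [MeasurableSpace Ω] {P : Measure Ω} [IsProbabilityMeasure P]
  {C₀ : ℕ → Ω → ℝ} {W2₀ : Fin N₁ → ℕ → Ω → ℝ}
  {W1₀ : Fin N₁ → Ω → EuclideanSpace ℝ (Fin d)} {q : ℕ → Ω → EuclideanSpace ℝ (Fin d) × ℝ}

/-- The frequencies of the data points are asymptotically correct, uniformly over the training. -/
theorem tendsto_measure_frequency_deviation (hM : 0 < M) (x : Fin M → EuclideanSpace ℝ (Fin d))
    (y : Fin M → ℝ) (hq : ∀ k, Measurable (q k)) (hq_law : ∀ k, P.map (q k) = dataMeasure x y)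
    (hind : Pairwise fun k l => IndepFun (q k) (q l) P) {T δ : ℝ} (hT : 0 ≤ T) (hδ : 0 < δ)
    (m : Fin M) :
    Tendsto (fun n : ℕ => P {ω | ∃ k : ℕ, (k : ℝ) ≤ (n + 1 : ℕ) * T ∧
      δ * (n + 1 : ℕ) < |∑ i ∈ Finset.range k, (dataWeight x y (q i ω) m - 1 / M)|})
      atTop (𝓝 0) := by
  set f : EuclideanSpace ℝ (Fin d) × ℝ → ℝ := fun z => dataWeight x y z m - 1 / M with hf
  have hfm : Measurable f := (measurable_dataWeight x y m).sub_const _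
  have : IsProbabilityMeasure (dataMeasure x y) := by
    rw [← hq_law 0]
    exact Measure.isProbabilityMeasure_map (hq 0).aemeasurable
  have hwi : Integrable (fun z => dataWeight x y z m) (dataMeasure x y) := by
    refine Integrable.of_bound (measurable_dataWeight x y m).aestronglyMeasurable 1
      (Eventually.of_forall fun z => ?_)
    unfold dataWeight
    split_ifs
    · rw [Real.norm_of_nonneg (by positivity)]
      refine div_le_one_of_le₀ ?_ (by positivity)
      exact_mod_cast Finset.card_pos.2 ⟨m, by simp⟩
    · simp
  have hfi : Integrable f (dataMeasure x y) := hwi.sub (integrable_const _)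
  have hmean : ∫ ω, f (q 0 ω) ∂P = 0 := by
    rw [← integral_map (hq 0).aemeasurable hfm.aestronglyMeasurable, hq_law, hf,
      integral_sub hwi (integrable_const _), integral_dataWeight hM]
    simp
  have hslln := strong_law_ae_real (μ := P) (fun k ω => f (q k ω))
    ((integrable_map_measure hfm.aestronglyMeasurable (hq 0).aemeasurable).1 (by rwa [hq_law]))
    (fun i j hij => (hind hij).comp hfm hfm)
    (fun i => IdentDistrib.comp ⟨(hq i).aemeasurable, (hq 0).aemeasurable,
      (hq_law i).trans (hq_law 0).symm⟩ hfm)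
  rw [hmean] at hslln
  rw [← measure_empty (μ := P)]
  -- By the strong law almost every ω leaves the bad events eventually, so their indicators tend to
  -- zero almost surely and their probabilities tend to zero.
  refine tendsto_measure_of_ae_tendsto_indicator_of_isFiniteMeasure atTop MeasurableSet.empty
    (fun n => ?_) ?_
  · have e : {ω | ∃ k : ℕ, (k : ℝ) ≤ (n + 1 : ℕ) * T ∧
        δ * (n + 1 : ℕ) < |∑ i ∈ Finset.range k, f (q i ω)|} =
        ⋃ k : ℕ, ⋃ _ : (k : ℝ) ≤ (n + 1 : ℕ) * T,
          {ω | δ * (n + 1 : ℕ) < |∑ i ∈ Finset.range k, f (q i ω)|} := by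
      ext ω
      simp
    rw [e]
    refine MeasurableSet.iUnion fun k => MeasurableSet.iUnion fun _ => ?_
    refine measurableSet_lt measurable_const ?_
    exact (Finset.measurable_fun_sum _ fun i _ => hfm.comp (hq i)).abs
  · filter_upwards [hslln] with ω hω
    have := (tendsto_add_atTop_nat 1).eventually
      (eventually_forall_le_mul_of_tendsto_div hω hT hδ)
    filter_upwards [this] with n hn
    refine iff_of_false ?_ (notMem_empty ω)
    rintro ⟨k, hk, hk'⟩
    exact absurd hk' (not_lt.2 (hn k hk))

/-- Averages of a continuous function over the initial units concentrate around the integral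
against the initial measure. -/
theorem tendstoInMeasure_unit_sum (hC₀ : ∀ i, Measurable (C₀ i))
    (hW2₀ : ∀ j i, Measurable (W2₀ j i)) (hW1₀ : ∀ j, Measurable (W1₀ j))
    (hq : ∀ k, Measurable (q k)) {μC μW2 : ProbabilityMeasure ℝ}
    (hC₀_law : ∀ i, P.map (C₀ i) = μC) (hW2₀_law : ∀ j i, P.map (W2₀ j i) = μW2)
    (h_indep : iIndep (inputAlgebra C₀ W2₀ W1₀ q) P) {R : ℝ}
    (hR : ∀ᵐ ω ∂P, (∀ i, ‖unitWeights C₀ W2₀ i ω‖ ≤ R) ∧ ‖fun j => W1₀ j ω‖ ≤ R)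
    (hRμ : ∀ᵐ v ∂(unitLaw N₁ μC μW2), ‖v‖ ≤ R) {G : Theta d N₁ → ℝ} (hG : Continuous G) {s : ℝ}
    (hs : 1 / 2 < s) :
    TendstoInMeasure P (fun (n : ℕ) ω => 1 / (n : ℝ) ^ s * ∑ i : Fin n,
      (G (C₀ i ω, fun j => W2₀ j i ω, fun j => W1₀ j ω) -
        ∫ θ, G θ ∂(initialMeasure μC μW2 fun j => W1₀ j ω : Measure (Theta d N₁)))) atTop 0 := by
  set S : Set ((ℝ × (Fin N₁ → ℝ)) × (Fin N₁ → EuclideanSpace ℝ (Fin d))) :=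
    {z | ‖z.1‖ ≤ R ∧ ‖z.2‖ ≤ R} with hS
  have hSm : MeasurableSet S := by
    refine IsClosed.measurableSet (IsClosed.inter ?_ ?_)
    · exact isClosed_le continuous_fst.norm continuous_const
    · exact isClosed_le continuous_snd.norm continuous_const
  -- Truncation to the ball makes the function bounded, as the weak law requires. Almost surely it
  -- changes neither the summands nor the integral.
  set F : (ℝ × (Fin N₁ → ℝ)) × (Fin N₁ → EuclideanSpace ℝ (Fin d)) → ℝ :=
    S.indicator fun z => G (z.1.1, z.1.2, z.2) with hF
  have hFm : Measurable F := (hG.comp (by fun_prop)).measurable.indicator hSm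
  obtain ⟨K, hK0, hK⟩ := hG.exists_bound_closedBall R
  have hFK : ∀ z, |F z| ≤ K := by
    intro z
    by_cases hz : z ∈ S
    · rw [hF, indicator_of_mem hz]
      refine hK _ (mem_closedBall_zero_iff.2 ?_)
      obtain ⟨h1, h2⟩ := hz
      exact max_le ((norm_fst_le z.1).trans h1) (max_le ((norm_snd_le z.1).trans h1) h2)
    · rw [hF, indicator_of_notMem hz, abs_zero]
      exact hK0
  have h := tendstoInMeasure_centred_sum (measurable_unitWeights hC₀ hW2₀)
    (measurable_pi_lambda _ hW1₀)
    (map_unitWeights hC₀ hW2₀ hW1₀ hq hC₀_law hW2₀_law h_indep)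
    (fun i k hik => indepFun_unitWeights hC₀ hW2₀ hW1₀ hq h_indep hik) hFm hFK hs
  refine h.congr_left fun n => ?_
  filter_upwards [hR] with ω hω
  congr 1
  rw [Finset.sum_range]
  refine Finset.sum_congr rfl fun i _ => ?_
  congr 1
  · exact indicator_of_mem (show (unitWeights C₀ W2₀ i ω, fun j => W1₀ j ω) ∈ S from
      ⟨hω.1 i, hω.2⟩) _
  · rw [integral_initialMeasure μC μW2 _ hG.measurable]
    refine integral_congr_ae ?_
    filter_upwards [hRμ] with v hv
    exact indicator_of_mem (show (v, fun j => W1₀ j ω) ∈ S from ⟨hv, hω.2⟩) _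

/-- `Z` does not involve c, so the integral factors and the mean of `μC` appears. This centres the
initial output. -/
theorem integral_unitOutput_initialMeasure {σ : ℝ → ℝ} {γ₁ : ℝ}
    (hσ : ContDiff ℝ ((⊤ : ℕ∞) : WithTop ℕ∞) σ) {μC μW2 : ProbabilityMeasure ℝ}
    (hμC_mean : ∫ c, c ∂(μC : Measure ℝ) = 0) (w1 : Fin N₁ → EuclideanSpace ℝ (Fin d))
    (x : EuclideanSpace ℝ (Fin d)) :
    ∫ θ, unitOutput σ γ₁ x θ ∂(initialMeasure μC μW2 w1 : Measure (Theta d N₁)) = 0 := by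
  rw [integral_initialMeasure μC μW2 _ (contDiff_unitOutput hσ x).continuous.measurable]
  have h := integral_prod_mul (μ := (μC : Measure ℝ))
    (ν := Measure.pi fun _ : Fin N₁ => (μW2 : Measure ℝ)) (fun c : ℝ => c)
    (fun w => σ (Z σ γ₁ x ((0 : ℝ), w, w1)))
  rw [hμC_mean, zero_mul] at h
  exact h

theorem measurable_integral_initialMeasure (μC μW2 : ProbabilityMeasure ℝ) {G : Theta d N₁ → ℝ}
    (hG : Continuous G) :
    Measurable fun w1 : Fin N₁ → EuclideanSpace ℝ (Fin d) => ∫ θ, G θ ∂(initialMeasure μC μW2 w1 : Measure (Theta d N₁)) := by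
  simp only [integral_initialMeasure μC μW2 _ hG.measurable]
  exact (StronglyMeasurable.integral_prod_left (μ := unitLaw N₁ μC μW2)
    (f := fun v w1 => G (v.1, v.2, w1)) (hG.comp (by fun_prop)).stronglyMeasurable).measurable

theorem measurable_kernelA_initialMeasure {σ : ℝ → ℝ} {γ₁ : ℝ}
    (hσ : ContDiff ℝ ((⊤ : ℕ∞) : WithTop ℕ∞) σ) (αC αW1 αW2 : ℝ) (μC μW2 : ProbabilityMeasure ℝ)
    (x z : EuclideanSpace ℝ (Fin d)) :
    Measurable fun w1 : Fin N₁ → EuclideanSpace ℝ (Fin d) =>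
      kernelA σ γ₁ αC αW1 αW2 (initialMeasure μC μW2 w1) x z := by
  have h1 := measurable_integral_initialMeasure (d := d) (N₁ := N₁) μC μW2
    (contDiff_B1 (γ₁ := γ₁) hσ x z).continuous
  have h2 := fun j => measurable_integral_initialMeasure (d := d) (N₁ := N₁) μC μW2
    (contDiff_B2 (γ₁ := γ₁) hσ j x z).continuous
  have h3 := fun x j => measurable_integral_initialMeasure (d := d) (N₁ := N₁) μC μW2
    (contDiff_B3 (γ₁ := γ₁) hσ j x).continuous
  unfold kernelA
  refine (h1.const_mul _).add ((Finset.measurable_fun_sum _ fun j _ => ?_).const_mul _)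
  exact ((h2 j).const_mul _).add (((h3 x j).const_mul _).mul (h3 z j))

/-- The initial empirical measures converge in probability to the initial measure. -/
theorem tendstoInMeasure_empirical (hC₀ : ∀ i, Measurable (C₀ i))
    (hW2₀ : ∀ j i, Measurable (W2₀ j i)) (hW1₀ : ∀ j, Measurable (W1₀ j))
    (hq : ∀ k, Measurable (q k)) {μC μW2 : ProbabilityMeasure ℝ}
    (hC₀_law : ∀ i, P.map (C₀ i) = μC) (hW2₀_law : ∀ j i, P.map (W2₀ j i) = μW2)
    (h_indep : iIndep (inputAlgebra C₀ W2₀ W1₀ q) P) :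
    TendstoInMeasure P (fun (n : ℕ) ω => LevyProkhorov.ofMeasure (Params.empirical
      (N₂ := n + 1) { C := fun i => C₀ i ω, W2 := fun j i => W2₀ j i ω, W1 := fun j => W1₀ j ω }))
      atTop (fun ω => LevyProkhorov.ofMeasure (initialMeasure μC μW2 fun j => W1₀ j ω)) := by
  refine tendstoInMeasure_of_tendsto_ae (fun n => ?_) ?_
  · have hc := (LevyProkhorov.continuous_ofMeasure_probabilityMeasure).comp
      (continuous_averageDirac (X := Theta d N₁) (n := n + 1))
    have hm : Measurable fun ω => fun i : Fin (n + 1) =>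
        ((C₀ i ω, fun j => W2₀ j i ω, fun j => W1₀ j ω) : Theta d N₁) :=
      measurable_pi_lambda _ fun i => (hC₀ i).prodMk
        ((measurable_pi_lambda _ fun j => hW2₀ j i).prodMk (measurable_pi_lambda _ hW1₀))
    exact (hc.stronglyMeasurable.comp_measurable hm).aestronglyMeasurable
  -- Units sharing a random first layer are not independent, so Varadarajan's theorem is applied to
  -- the weights (C, W²) alone. The first layer is inserted afterwards, for each ω, by a continuous
  -- map.
  · have h := tendsto_averageDirac_ae (P := P) (V := unitWeights C₀ W2₀)
      (μ := ⟨unitLaw N₁ μC μW2, inferInstance⟩) (measurable_unitWeights hC₀ hW2₀)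
      (map_unitWeights hC₀ hW2₀ hW1₀ hq hC₀_law hW2₀_law h_indep)
      (fun i k hik => (indepFun_unitWeights hC₀ hW2₀ hW1₀ hq h_indep hik).comp measurable_id
        measurable_fst)
    filter_upwards [h] with ω hω
    refine (LevyProkhorov.continuous_ofMeasure_probabilityMeasure.tendsto _).comp ?_
    refine ProbabilityMeasure.tendsto_iff_forall_integral_tendsto.2 fun f => ?_
    have hιc : Continuous fun v : ℝ × (Fin N₁ → ℝ) =>
        ((v.1, v.2, fun j => W1₀ j ω) : Theta d N₁) := by fun_prop
    have h1 := ProbabilityMeasure.tendsto_iff_forall_integral_tendsto.1 hω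
      (f.compContinuous ⟨_, hιc⟩)
    rw [integral_initialMeasure μC μW2 _ f.continuous.measurable]
    simp only [integral_empirical]
    simp only [integral_averageDirac] at h1
    exact h1

end TwoLayer

/-! ### Union bound, Skorokhod distance and the limit process. -/

theorem tendsto_measure_zero_of_ae_exists {Ω ι : Type*} [Finite ι] [MeasurableSpace Ω]
    {P : Measure Ω} {B : ℕ → Set Ω} {bad : ι → ℕ → Set Ω}
    (hbad : ∀ i, Tendsto (fun n => P (bad i n)) atTop (𝓝 0))
    (h : ∀ᶠ n in atTop, ∀ᵐ ω ∂P, ω ∈ B n → ∃ i, ω ∈ bad i n) :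
    Tendsto (fun n => P (B n)) atTop (𝓝 0) := by
  cases nonempty_fintype ι
  have hsum : Tendsto (fun n => ∑ i, P (bad i n)) atTop (𝓝 0) := by
    simpa using tendsto_finsetSum Finset.univ fun i _ => hbad i
  refine tendsto_of_tendsto_of_tendsto_of_le_of_le' tendsto_const_nhds hsum
    (Eventually.of_forall fun n => zero_le) ?_
  filter_upwards [h] with n hn
  calc P (B n) ≤ P (⋃ i, bad i n) := measure_mono_ae (by
        filter_upwards [hn] with ω hω hB
        exact mem_iUnion.2 (hω hB))
    _ ≤ ∑ i, P (bad i n) := measure_iUnion_fintype_le P _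

namespace SkorokhodSpace

/-- A continuous path. -/
def ofContinuous {T : ℝ} {E : Type*} [TopologicalSpace E] (f : Set.Icc (0 : ℝ) T → E)
    (hf : Continuous f) : SkorokhodSpace T E where
  toFun := f
  right_continuous _ := hf.continuousWithinAt
  left_limits t := ⟨f t, (hf.tendsto t).mono_left nhdsWithin_le_nhds⟩

/-- The identity time change bounds the Skorokhod distance by the uniform one. -/
theorem edist_le_of_forall {T : ℝ} {E : Type*} [PseudoEMetricSpace E] {X Y : SkorokhodSpace T E}
    {ε : ℝ≥0∞} (h : ∀ t, edist (X t) (Y t) ≤ ε) : edist X Y ≤ ε := by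
  refine iInf_le_of_le (OrderIso.refl _) (max_le (iSup_le fun t => ?_) (iSup_le fun t => h t))
  simp

end SkorokhodSpace

namespace TwoLayer

variable {d N₁ M : ℕ}

/-- The kernel of the limit, evaluated on the data set. -/
noncomputable def limitKernel (σ : ℝ → ℝ) (γ₁ αC αW1 αW2 : ℝ)
    (x : Fin M → EuclideanSpace ℝ (Fin d)) (μC μW2 : ProbabilityMeasure ℝ)
    (w1 : Fin N₁ → EuclideanSpace ℝ (Fin d)) : Matrix (Fin M) (Fin M) ℝ :=
  fun l m => kernelA σ γ₁ αC αW1 αW2 (initialMeasure μC μW2 w1) (x l) (x m)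

/-- The limit of the training paths: the measure is frozen, the outputs follow the linear
evolution. -/
noncomputable def limitPath (T : ℝ) (σ : ℝ → ℝ) (γ₁ αC αW1 αW2 : ℝ)
    (x : Fin M → EuclideanSpace ℝ (Fin d)) (y : Fin M → ℝ) (μC μW2 : ProbabilityMeasure ℝ)
    (w1 : Fin N₁ → EuclideanSpace ℝ (Fin d)) : SkorokhodSpace T (State d N₁ M) :=
  SkorokhodSpace.ofContinuous
    (fun t => (LevyProkhorov.ofMeasure (initialMeasure μC μW2 w1),
      evolution (limitKernel σ γ₁ αC αW1 αW2 x μC μW2 w1) y t))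
    (continuous_const.prodMk ((continuous_evolution _ y).comp continuous_subtype_val))

theorem stronglyMeasurable_limitPath {T : ℝ} {σ : ℝ → ℝ} {γ₁ : ℝ}
    (hσ : ContDiff ℝ ((⊤ : ℕ∞) : WithTop ℕ∞) σ) (αC αW1 αW2 : ℝ)
    (x : Fin M → EuclideanSpace ℝ (Fin d)) (y : Fin M → ℝ) (μC μW2 : ProbabilityMeasure ℝ)
    (t : Set.Icc (0 : ℝ) T) :
    StronglyMeasurable fun w1 : Fin N₁ → EuclideanSpace ℝ (Fin d) =>
      limitPath T σ γ₁ αC αW1 αW2 x y μC μW2 w1 t := by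
  refine StronglyMeasurable.prodMk ?_ ?_
  · exact (LevyProkhorov.continuous_ofMeasure_probabilityMeasure.comp
      (continuous_initialMeasure μC μW2)).stronglyMeasurable
  · have h1 : Continuous fun A : Fin M → Fin M → ℝ => evolution (Matrix.of A) y (t : ℝ) :=
      continuous_evolution_left y t
    have h2 : Measurable fun w1 : Fin N₁ → EuclideanSpace ℝ (Fin d) => fun l m =>
        kernelA σ γ₁ αC αW1 αW2 (initialMeasure μC μW2 w1) (x l) (x m) :=
      measurable_pi_lambda _ fun l => measurable_pi_lambda _ fun m =>
        measurable_kernelA_initialMeasure hσ αC αW1 αW2 μC μW2 (x l) (x m)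
    exact h1.stronglyMeasurable.comp_measurable h2

theorem evolution_eq_integral (A : Matrix (Fin M) (Fin M) ℝ) (y : Fin M → ℝ) (t : ℝ)
    (m : Fin M) :
    evolution A y t m = ∫ s in (0 : ℝ)..t, 1 / (M : ℝ) * ∑ m', (y m' - evolution A y s m') *
      A m m' := by
  have hd : ∀ s ∈ Set.uIcc 0 t, HasDerivAt (fun s => evolution A y s m)
      (1 / (M : ℝ) * ∑ m', (y m' - evolution A y s m') * A m m') s := fun s _ => by
    have h := hasDerivAt_pi.1 (hasDerivAt_evolution A y s) m
    rw [averageOperator_apply] at h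
    simpa only [Pi.sub_apply, mul_comm] using h
  have hc : Continuous fun s => 1 / (M : ℝ) * ∑ m', (y m' - evolution A y s m') * A m m' := by
    have := continuous_evolution A y
    fun_prop
  rw [intervalIntegral.integral_eq_sub_of_hasDerivAt hd (hc.intervalIntegrable 0 t),
    evolution_zero]
  simp

theorem exists_ae_norm_le {E : Type*} [NormedAddCommGroup E] [MeasurableSpace E]
    {μ : Measure E} (h : ∃ K : Set E, IsCompact K ∧ ∀ᵐ c ∂μ, c ∈ K) :
    ∃ R : ℝ, ∀ᵐ c ∂μ, ‖c‖ ≤ R := by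
  obtain ⟨K, hK, hμ⟩ := h
  obtain ⟨R, hR⟩ := hK.isBounded.exists_norm_le
  exact ⟨R, hμ.mono fun c hc => hR c hc⟩

end TwoLayer

/-! ### Assembly of the theorem. -/

theorem mainTheorem1
    {Ω : Type*} [MeasurableSpace Ω] (P : Measure Ω) [IsProbabilityMeasure P]
    (d N₁ M : ℕ) (hN₁ : 0 < N₁) (hM : 0 < M) (T : ℝ) (hT : 0 ≤ T)
    (γ₁ γ₂ : ℝ) (hγ₁ : γ₁ ∈ Set.Ioo (1 / 2 : ℝ) 1) (hγ₂ : γ₂ ∈ Set.Ioo (1 / 2 : ℝ) 1)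
    (αC αW1 αW2 : ℝ) (hαC : 0 < αC) (hαW1 : 0 < αW1) (hαW2 : 0 < αW2)
    -- the activation function
    (σ : ℝ → ℝ) (hσ : ContDiff ℝ ((⊤ : ℕ∞) : WithTop ℕ∞) σ) (hσ_bdd : ∃ K : ℝ, ∀ z, |σ z| ≤ K)
    -- the data set
    (x : Fin M → EuclideanSpace ℝ (Fin d)) (y : Fin M → ℝ)
    -- the laws of the initial parameters: mean zero, carried by compact sets
    (μC μW2 : ProbabilityMeasure ℝ) (μW1 : ProbabilityMeasure (EuclideanSpace ℝ (Fin d)))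
    (hμC : ∃ K : Set ℝ, IsCompact K ∧ ∀ᵐ c ∂(μC : Measure ℝ), c ∈ K)
    (hμW2 : ∃ K : Set ℝ, IsCompact K ∧ ∀ᵐ w ∂(μW2 : Measure ℝ), w ∈ K)
    (hμW1 : ∃ K : Set (EuclideanSpace ℝ (Fin d)), IsCompact K ∧
      ∀ᵐ w ∂(μW1 : Measure (EuclideanSpace ℝ (Fin d))), w ∈ K)
    (hμC_mean : ∫ c, c ∂(μC : Measure ℝ) = 0)
    (hμW2_mean : ∫ w, w ∂(μW2 : Measure ℝ) = 0)
    (hμW1_mean : ∫ w, w ∂(μW1 : Measure (EuclideanSpace ℝ (Fin d))) = 0)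
    -- the initial parameters and the data points `(x_k, y_k)` used by the gradient descent
    (C₀ : ℕ → Ω → ℝ) (W2₀ : Fin N₁ → ℕ → Ω → ℝ) (W1₀ : Fin N₁ → Ω → EuclideanSpace ℝ (Fin d))
    (q : ℕ → Ω → EuclideanSpace ℝ (Fin d) × ℝ)
    (hC₀ : ∀ i, Measurable (C₀ i)) (hW2₀ : ∀ j i, Measurable (W2₀ j i))
    (hW1₀ : ∀ j, Measurable (W1₀ j)) (hq : ∀ k, Measurable (q k))
    (hC₀_law : ∀ i, P.map (C₀ i) = μC) (hW2₀_law : ∀ j i, P.map (W2₀ j i) = μW2)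
    (hW1₀_law : ∀ j, P.map (W1₀ j) = μW1) (hq_law : ∀ k, P.map (q k) = TwoLayer.dataMeasure x y)
    -- all these random variables are mutually independent
    (h_indep : iIndep
      (Sum.elim (fun i : ℕ => MeasurableSpace.comap (C₀ i) inferInstance)
        (Sum.elim (fun ji : Fin N₁ × ℕ => MeasurableSpace.comap (W2₀ ji.1 ji.2) inferInstance)
          (Sum.elim (fun j : Fin N₁ => MeasurableSpace.comap (W1₀ j) inferInstance)
            (fun k : ℕ => MeasurableSpace.comap (q k) inferInstance)))) P) :
    ∃ X : Ω → SkorokhodSpace T (TwoLayer.State d N₁ M),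
      -- `X = (γ, h)` is a stochastic process
      (∀ t, StronglyMeasurable fun ω => X ω t) ∧
      -- convergence in probability in the Skorokhod space, as `N₂ = n + 1 → ∞`
      TendstoInMeasure P
        (fun (n : ℕ) (ω : Ω) =>
          TwoLayer.trainingPath (N₂ := n + 1) T σ γ₁ γ₂ αC αW1 αW2 x
            { C := fun i => C₀ i ω, W2 := fun j i => W2₀ j i ω, W1 := fun j => W1₀ j ω }
            (fun k => q k ω))
        atTop X ∧
      ∀ ω,
        -- the limit measure is frozen
        (∀ t, (X ω t).1.toMeasure = TwoLayer.initialMeasure μC μW2 fun j => W1₀ j ω) ∧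
        -- the limit output solves the linear evolution equation
        (X ω ⟨0, Set.left_mem_Icc.2 hT⟩).2 = 0 ∧
        ∀ (t : Set.Icc (0 : ℝ) T) (m : Fin M),
          (X ω t).2 m = (X ω ⟨0, Set.left_mem_Icc.2 hT⟩).2 m +
            ∫ s in (0 : ℝ)..t, 1 / (M : ℝ) * ∑ m' : Fin M,
              (y m' - (X ω (Set.projIcc 0 T hT s)).2 m') *
                TwoLayer.kernelA σ γ₁ αC αW1 αW2
                  (TwoLayer.initialMeasure μC μW2 fun j => W1₀ j ω) (x m) (x m') := by
  obtain ⟨RC, hRC⟩ := TwoLayer.exists_ae_norm_le hμC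
  obtain ⟨RW2, hRW2⟩ := TwoLayer.exists_ae_norm_le hμW2
  obtain ⟨RW1, hRW1⟩ := TwoLayer.exists_ae_norm_le hμW1
  -- The entry 0 keeps R nonnegative, as needed to bound sup norms over possibly empty index sets.
  set R : ℝ := max (max RC RW2) (max RW1 0) with hRdef
  have hR0 : 0 ≤ R := (le_max_right _ _).trans (le_max_right _ _)
  have hC : ∀ᵐ ω ∂P, ∀ i, ‖C₀ i ω‖ ≤ R := ae_all_iff.2 fun i => by
    rw [← hC₀_law i] at hRC
    filter_upwards [ae_of_ae_map (hC₀ i).aemeasurable hRC] with ω hω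
    exact hω.trans ((le_max_left _ _).trans (le_max_left _ _))
  have hW2 : ∀ᵐ ω ∂P, ∀ j i, ‖W2₀ j i ω‖ ≤ R := ae_all_iff.2 fun j => ae_all_iff.2 fun i => by
    rw [← hW2₀_law j i] at hRW2
    filter_upwards [ae_of_ae_map (hW2₀ j i).aemeasurable hRW2] with ω hω
    exact hω.trans ((le_max_right _ _).trans (le_max_left _ _))
  have hW1 : ∀ᵐ ω ∂P, ∀ j, ‖W1₀ j ω‖ ≤ R := ae_all_iff.2 fun j => by
    rw [← hW1₀_law j] at hRW1
    filter_upwards [ae_of_ae_map (hW1₀ j).aemeasurable hRW1] with ω hω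
    exact hω.trans ((le_max_left _ _).trans (le_max_right _ _))
  have hR : ∀ᵐ ω ∂P, (∀ i, ‖TwoLayer.unitWeights C₀ W2₀ i ω‖ ≤ R) ∧
      ‖fun j => W1₀ j ω‖ ≤ R := by
    filter_upwards [hC, hW2, hW1] with ω h1 h2 h3
    exact ⟨fun i => max_le (h1 i) ((pi_norm_le_iff_of_nonneg hR0).2 fun j => h2 j i),
      (pi_norm_le_iff_of_nonneg hR0).2 h3⟩
  have hlaw := TwoLayer.map_unitWeights hC₀ hW2₀ hW1₀ hq hC₀_law hW2₀_law h_indep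
  have hRμ : ∀ᵐ v ∂(TwoLayer.unitLaw N₁ μC μW2), ‖v‖ ≤ R := by
    rw [← hlaw 0, ae_map_iff (TwoLayer.measurable_unitWeights hC₀ hW2₀ 0).aemeasurable
      (isClosed_le continuous_norm continuous_const).measurableSet]
    filter_upwards [hR] with ω hω using hω.1 0
  have hdata : ∀ᵐ ω ∂P, ∀ k, ∃ m, q k ω = (x m, y m) := ae_all_iff.2 fun k => by
    have h := TwoLayer.ae_dataMeasure x y
    rw [← hq_law k] at h
    exact ae_of_ae_map (hq k).aemeasurable h
  set p₀ : (n : ℕ) → Ω → TwoLayer.Params d N₁ (n + 1) := fun n ω =>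
    { C := fun i => C₀ i ω, W2 := fun j i => W2₀ j i ω, W1 := fun j => W1₀ j ω } with hp₀
  set γ₀ : Ω → ProbabilityMeasure (TwoLayer.Theta d N₁) := fun ω =>
    TwoLayer.initialMeasure μC μW2 fun j => W1₀ j ω with hγ₀
  set A : Ω → Matrix (Fin M) (Fin M) ℝ := fun ω =>
    TwoLayer.limitKernel σ γ₁ αC αW1 αW2 x μC μW2 fun j => W1₀ j ω with hA
  refine ⟨fun ω => TwoLayer.limitPath T σ γ₁ αC αW1 αW2 x y μC μW2 fun j => W1₀ j ω,
    fun t => (TwoLayer.stronglyMeasurable_limitPath hσ αC αW1 αW2 x y μC μW2 t).comp_measurable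
      (measurable_pi_lambda _ hW1₀), ?_, fun ω => ⟨fun t => rfl, ?_, fun t m => ?_⟩⟩
  rotate_left
  · exact evolution_zero _ y
  · have h0 : (TwoLayer.limitPath T σ γ₁ αC αW1 αW2 x y μC μW2 (fun j => W1₀ j ω)
        ⟨0, Set.left_mem_Icc.2 hT⟩).2 m = 0 := congrFun (evolution_zero (A ω) y) m
    rw [h0, zero_add]
    refine (TwoLayer.evolution_eq_integral (A ω) y t m).trans
      (intervalIntegral.integral_congr fun s hs => ?_)
    rw [Set.uIcc_of_le t.2.1] at hs
    have hproj : ((Set.projIcc 0 T hT s : Set.Icc (0 : ℝ) T) : ℝ) = s := by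
      rw [Set.projIcc_of_mem hT ⟨hs.1, hs.2.trans t.2.2⟩]
    simp only [TwoLayer.limitPath, SkorokhodSpace.ofContinuous, hproj]
    rfl
  refine tendstoInMeasure_of_ne_top fun ε hε hε_top => ?_
  -- The measure component costs ε₁ twice (training drift and initial fluctuation); a third keeps
  -- the total strictly below ε.
  set ε₁ := ε.toReal / 3 with hε₁
  have hε₁0 : 0 < ε₁ := by
    have := ENNReal.toReal_pos hε.ne' hε_top
    positivity
  obtain ⟨δ, hδ, hclose⟩ := TwoLayer.training_close_to_limit (γ₁ := γ₁) hσ hN₁ hM hγ₂.2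
    αC αW1 αW2 x y R hT hε₁0
  obtain ⟨K, hK0, hKb, -⟩ := TwoLayer.kernelTest_bounds (N₁ := N₁) (γ₁ := γ₁) hσ x R
  set Q : ℝ := ∑ l : Fin M, ∑ m : Fin M,
    (|αC| + |αW2| + |αW1| * |inner ℝ (x l) (x m)| * (2 * K)) with hQ
  have hQ0 : 0 ≤ Q := by positivity
  have hQle : ∀ l m, |αC| + |αW2| + |αW1| * |inner ℝ (x l) (x m)| * (2 * K) ≤ Q := fun l m =>
    (Finset.single_le_sum (f := fun m => |αC| + |αW2| + |αW1| * |inner ℝ (x l) (x m)| * (2 * K))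
      (fun m _ => by positivity) (Finset.mem_univ m)).trans
    (Finset.single_le_sum (f := fun l => ∑ m : Fin M,
      (|αC| + |αW2| + |αW1| * |inner ℝ (x l) (x m)| * (2 * K)))
      (fun l _ => by positivity) (Finset.mem_univ l))
  -- Q bounds the Lipschitz constants of the kernel in its integrals, so accuracy δ' in each
  -- integral gives accuracy δ in the kernel.
  set δ' := δ / (Q + 1) with hδ'
  have hδ'0 : 0 < δ' := by positivity
  have hQδ : Q * δ' ≤ δ := by
    rw [hδ', mul_div_assoc', div_le_iff₀ (by positivity)]
    nlinarith
  -- Four kinds of bad event: large initial output, inaccurate kernel integral, wrong data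
  -- frequency, initial empirical measure far from its limit. Outside them the deterministic theorem
  -- applies.
  set bad : (Fin M ⊕ TwoLayer.KernelIndex N₁ M) ⊕ (Fin M ⊕ Unit) → ℕ → Set Ω :=
    Sum.elim
      (Sum.elim (fun m n => {ω | δ ≤ |(p₀ n ω).output σ γ₁ γ₂ (x m)|})
        (fun i n => {ω | δ' ≤ |∫ θ, TwoLayer.kernelTest σ γ₁ x i θ
            ∂((p₀ n ω).empirical : Measure (TwoLayer.Theta d N₁)) -
          ∫ θ, TwoLayer.kernelTest σ γ₁ x i θ ∂(γ₀ ω : Measure (TwoLayer.Theta d N₁))|}))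
      (Sum.elim (fun m n => {ω | ∃ k : ℕ, (k : ℝ) ≤ (n + 1 : ℕ) * T ∧ δ * (n + 1 : ℕ) <
          |∑ i ∈ Finset.range k, (TwoLayer.dataWeight x y (q i ω) m - 1 / M)|})
        (fun _ n => {ω | ENNReal.ofReal ε₁ ≤
          edist (LevyProkhorov.ofMeasure (p₀ n ω).empirical)
            (LevyProkhorov.ofMeasure (γ₀ ω))})) with hbaddef
  -- Used with exponent s = γ₂ for the initial outputs and s = 1 for the kernel integrals.
  have hconc := fun (G : TwoLayer.Theta d N₁ → ℝ) (hG : Continuous G) (s : ℝ)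
    (hs : 1 / 2 < s) => (TwoLayer.tendstoInMeasure_unit_sum hC₀ hW2₀ hW1₀ hq hC₀_law hW2₀_law
      h_indep hR hRμ hG hs).comp (tendsto_add_atTop_nat 1)
  refine tendsto_measure_zero_of_ae_exists (bad := bad) ?_ ?_
  · rintro ((m | i) | (m | _))
    · have h := tendstoInMeasure_iff_norm.1 (hconc _ (TwoLayer.contDiff_unitOutput (γ₁ := γ₁) hσ
        (x m)).continuous γ₂ hγ₂.1) δ hδ
      refine h.congr fun n => ?_
      congr 1
      ext ω
      simp only [Function.comp_apply, mem_ofPred_eq, Pi.zero_apply, sub_zero, Real.norm_eq_abs,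
        TwoLayer.integral_unitOutput_initialMeasure hσ hμC_mean, hbaddef, Sum.elim_inl]
      rfl
    · have h := tendstoInMeasure_iff_norm.1 (hconc _ (TwoLayer.contDiff_kernelTest (γ₁ := γ₁) hσ
        x i).continuous 1 (by norm_num)) δ' hδ'0
      refine h.congr fun n => ?_
      congr 1
      ext ω
      simp only [Function.comp_apply, mem_ofPred_eq, Pi.zero_apply, sub_zero, Real.norm_eq_abs,
        hbaddef, Sum.elim_inl, Sum.elim_inr, TwoLayer.integral_empirical, Real.rpow_one,
        Finset.sum_sub_distrib, mul_sub]
      have hn : ((n + 1 : ℕ) : ℝ) ≠ 0 := by positivity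
      simp only [Finset.sum_const, Finset.card_univ, Fintype.card_fin, nsmul_eq_mul]
      rw [← mul_assoc, one_div_mul_cancel hn, one_mul]
      rfl
    · exact TwoLayer.tendsto_measure_frequency_deviation hM x y hq hq_law
        (TwoLayer.pairwise_indepFun_data h_indep) hT hδ m
    · exact TwoLayer.tendstoInMeasure_empirical hC₀ hW2₀ hW1₀ hq hC₀_law hW2₀_law h_indep _
        (ENNReal.ofReal_pos.2 hε₁0)
  · have hclose' := (tendsto_add_atTop_nat 1).eventually hclose
    filter_upwards [hclose'] with n hn
    filter_upwards [hR, hdata] with ω hRω hdω hB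
    by_contra hgood
    push Not at hgood
    have g1 : ∀ m, |(p₀ n ω).output σ γ₁ γ₂ (x m)| ≤ δ := fun m =>
      (not_le.1 (hgood (.inl (.inl m)))).le
    have g2 : ∀ i, |∫ θ, TwoLayer.kernelTest σ γ₁ x i θ
            ∂((p₀ n ω).empirical : Measure (TwoLayer.Theta d N₁)) -
          ∫ θ, TwoLayer.kernelTest σ γ₁ x i θ ∂(γ₀ ω : Measure (TwoLayer.Theta d N₁))| ≤ δ' :=
      fun i => (not_le.1 (hgood (.inl (.inr i)))).le
    have g3 : ∀ k : ℕ, (k : ℝ) ≤ (n + 1 : ℕ) * T → ∀ m,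
        |∑ i ∈ Finset.range k, (TwoLayer.dataWeight x y (q i ω) m - 1 / M)| ≤
          δ * (n + 1 : ℕ) := fun k hk m => by
      by_contra hlt
      exact hgood (.inr (.inl m)) ⟨k, hk, not_le.1 hlt⟩
    have g4 : edist (LevyProkhorov.ofMeasure (p₀ n ω).empirical)
        (LevyProkhorov.ofMeasure (γ₀ ω)) ≤ ENNReal.ofReal ε₁ :=
      (not_le.1 (hgood (.inr (.inr ())))).le
    have hunit : ∀ i, ‖(p₀ n ω).unit i‖ ≤ R := fun i =>
      max_le ((norm_fst_le (TwoLayer.unitWeights C₀ W2₀ i ω)).trans (hRω.1 i))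
        (max_le ((norm_snd_le (TwoLayer.unitWeights C₀ W2₀ i ω)).trans (hRω.1 i)) hRω.2)
    have hker : ∀ l m, |TwoLayer.kernelA σ γ₁ αC αW1 αW2 (p₀ n ω).empirical (x l) (x m) -
        A ω l m| ≤ δ := fun l m => by
      refine (TwoLayer.abs_kernelA_sub_le hN₁ αC αW1 αW2 x (K := K) (fun i => ?_) (fun i => ?_)
        g2 l m).trans ((mul_le_mul_of_nonneg_right (hQle l m) hδ'0.le).trans hQδ)
      · rw [TwoLayer.integral_empirical]
        exact TwoLayer.abs_average_le (Nat.succ_pos n) fun k => hKb i _ (hunit k)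
      · rw [TwoLayer.integral_initialMeasure μC μW2 _
          (TwoLayer.contDiff_kernelTest hσ x i).continuous.measurable]
        have := norm_integral_le_of_norm_le_const (μ := TwoLayer.unitLaw N₁ μC μW2)
          (f := fun v => TwoLayer.kernelTest σ γ₁ x i (v.1, v.2, fun j => W1₀ j ω)) (C := K)
          (by
            filter_upwards [hRμ] with v hv
            exact hKb i _ (max_le ((norm_fst_le v).trans hv)
              (max_le ((norm_snd_le v).trans hv) hRω.2)))
        simpa using this
    have hmain := hn (p₀ n ω) (fun k => q k ω) (A ω) hunit hdω g1 hker g3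
    have hdist : edist (TwoLayer.trainingPath (N₂ := n + 1) T σ γ₁ γ₂ αC αW1 αW2 x (p₀ n ω)
        fun k => q k ω) (TwoLayer.limitPath T σ γ₁ αC αW1 αW2 x y μC μW2 fun j => W1₀ j ω) ≤
        ENNReal.ofReal (ε₁ + ε₁) := by
      refine SkorokhodSpace.edist_le_of_forall fun t => max_le ?_ ?_
      · rw [ENNReal.ofReal_add hε₁0.le hε₁0.le]
        exact (edist_triangle _ _ _).trans
          (add_le_add (TwoLayer.edist_empirical_le (hmain t t.2).1) g4)
      · rw [edist_dist]
        refine ENNReal.ofReal_le_ofReal ?_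
        refine ((dist_pi_le_iff hε₁0.le).2 fun m => ?_).trans (by linarith)
        rw [Real.dist_eq]
        exact (hmain t t.2).2 m
    have hlt : ENNReal.ofReal (ε₁ + ε₁) < ε := by
      rw [ENNReal.ofReal_lt_iff_lt_toReal (by positivity) hε_top, hε₁]
      linarith [hε₁0]
    exact absurd (hB : ε ≤ _) (not_le.2 (hdist.trans_lt hlt))
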